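/- Let $F$ and $H$ be graphs. In the Constructor-Blocker game on $K_n$, two players, Constructor and Blocker, alternately claim unclaimed edges of the complete graph $K_n$, with Constructor moving first. Constructor may only claim an edge if the graph formed by all her edges remains $F$-free (contains no subgraph isomorphic to $F$), while Blocker may claim any unclaimed edge. The game ends when Constructor cannot claim any more edges or when all edges have been claimed. The score of the game is the number of copies of $H$ (subgraphs isomorphic to $H$) in Constructor's graph at the end of the game; Constructor aims to maximize the score and Blocker aims to minimize it. Let $g(n,H,F)$ denote the score when both players play optimally. Let $K_3$ be the triangle and let $P_6$ be the path on six vertices. Then, as $n\to\infty$, $$g(n,K_3,P_6)=(1+o(1))\,\frac{n}{2}.$$ -/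

import Mathlib

open Filter Topology

noncomputable section

namespace ConstructorBlocker

open Classical in
/-- The free edges of the complete graph on `V`: those claimed neither by Constructor
(who has claimed the edges in `C`) nor by Blocker (who has claimed the edges in `B`). -/
def freeEdges {V : Type*} [Fintype V] (C B : Finset (Sym2 V)) : Finset (Sym2 V) :=
  (⊤ : SimpleGraph V).edgeFinset \ (C ∪ B)

open Classical in
/-- The edges Constructor may claim: free edges that keep her graph `F`-free. -/
def legalEdges {V W : Type*} [Fintype V] (F : SimpleGraph W) (C B : Finset (Sym2 V)) :
    Finset (Sym2 V) :=
  (freeEdges C B).filter fun e =>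
    F.Free (SimpleGraph.fromEdgeSet (↑(insert e C) : Set (Sym2 V)))

/-- The number of copies of `H` (subgraphs isomorphic to `H`) in the graph with edge set `C`. -/
def copies {V U : Type*} [Fintype V] (H : SimpleGraph U) (C : Finset (Sym2 V)) : ℕ :=
  (SimpleGraph.fromEdgeSet (↑C : Set (Sym2 V))).copyCount H

open Classical in
theorem card_freeEdges_insert_left {V : Type*} [Fintype V] {C B : Finset (Sym2 V)} {e : Sym2 V}
    (he : e ∈ freeEdges C B) :
    (freeEdges (insert e C) B).card < (freeEdges C B).card := by
  apply Finset.card_lt_card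
  rw [Finset.ssubset_iff_of_subset]
  · exact ⟨e, he, by simp [freeEdges]⟩
  · intro x hx
    simp only [freeEdges, Finset.mem_sdiff, Finset.mem_union, Finset.mem_insert] at hx ⊢
    tauto

open Classical in
theorem card_freeEdges_insert_right {V : Type*} [Fintype V] {C B : Finset (Sym2 V)} {e : Sym2 V}
    (he : e ∈ freeEdges C B) :
    (freeEdges C (insert e B)).card < (freeEdges C B).card := by
  apply Finset.card_lt_card
  rw [Finset.ssubset_iff_of_subset]
  · exact ⟨e, he, by simp [freeEdges]⟩
  · intro x hx
    simp only [freeEdges, Finset.mem_sdiff, Finset.mem_union, Finset.mem_insert] at hx ⊢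
    tauto

section

open Classical

mutual

/-- The final score under optimal play from the position `(C, B)` with Constructor to move.
The game is over when she has no legal edge; otherwise she claims one, maximizing the score. -/
def constructorValue {V U W : Type*} [Fintype V] (H : SimpleGraph U) (F : SimpleGraph W)
    (C B : Finset (Sym2 V)) : ℕ :=
  if h : (legalEdges F C B).Nonempty then
    (legalEdges F C B).attach.sup' (Finset.attach_nonempty_iff.mpr h)
      fun e => blockerValue H F (insert e.1 C) B
  else copies H C
termination_by (freeEdges C B).card
decreasing_by exact card_freeEdges_insert_left (Finset.mem_filter.mp e.2).1

/-- The final score under optimal play from the position `(C, B)` with Blocker to move.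
The game is over when no edge is free; otherwise he claims any free edge, minimizing the score. -/
def blockerValue {V U W : Type*} [Fintype V] (H : SimpleGraph U) (F : SimpleGraph W)
    (C B : Finset (Sym2 V)) : ℕ :=
  if h : (freeEdges C B).Nonempty then
    (freeEdges C B).attach.inf' (Finset.attach_nonempty_iff.mpr h)
      fun e => constructorValue H F C (insert e.1 B)
  else copies H C
termination_by (freeEdges C B).card
decreasing_by exact card_freeEdges_insert_right e.2

end

end

/-- `g n H F`: the score of the Constructor-Blocker game on the complete graph with `n` vertices
in which Constructor starts, must keep her graph `F`-free and maximizes the number of copies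
of `H` in it at the end of the game, while Blocker minimizes this number. -/
def g {U W : Type*} (n : ℕ) (H : SimpleGraph U) (F : SimpleGraph W) : ℕ :=
  constructorValue (V := Fin n) H F ∅ ∅

end ConstructorBlocker

end

-- Copies of the triangle and freeness of the six-vertex path

namespace ConstructorBlocker

-- Upper bound: Blocker keeps every component `S` of Constructor's graph in a state, `Settled`,
-- which forces at most |S|/2 triangles in it (`Settled.bound`). Summing over components gives n/2
-- (`card_triangles_le`). A move of Constructor changes only one component, either by an edge inside
-- it or by merging two, so it suffices that Blocker can always settle that component with at most
-- one move (`exists_answer`). His surplus moves are harmless because `Settled` is stable under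
-- further Blocker edges.
--
-- The state depends on the size of `S` and on whether it contains a 4-cycle. For |S| ≤ 5 it is an
-- explicit pattern of Blocker edges, sometimes with one more edge pending that Blocker can obtain
-- in two ways, only one of which Constructor can spoil. For |S| ≥ 6 without a 4-cycle, freeness of
-- the path makes any two triangles meet, and no two share an edge, so they form a sunflower around
-- one vertex and there are fewer than |S|/2 of them (`sunflower_bound`). For |S| ≥ 6 with a
-- 4-cycle, the remaining vertices hang on two opposite vertices of the cycle. The triples that may
-- still become triangles are then so restricted that either there are at most |S|/2 of them, or no
-- free edge lies in two unfinished ones and Blocker destroys one for each one completed. The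
-- delicate moment is the creation of a 4-cycle `a b c d` with `a c` adjacent, where all |S| - 2
-- triples containing `a, c` may be open. From seven vertices on, Blocker must have spoilt one of
-- them beforehand, which is what dead hub edges record.
--
-- Lower bound: Constructor builds disjoint friendship graphs, that is, triangles sharing one
-- centre. Any path on three vertices inside such a graph meets the centre, so no six-vertex path
-- arises (`Friendship.pathSixFree`). She attaches leaves to the centre and joins two leaves once
-- three are unmatched; the newest leaf has two possible partners, and Blocker's single reply spoils
-- at most one. A block of q triangles costs 2q + 2 vertices and 3q + 1 moves. Blocker thus has only
-- O(n) edges, and as long as n/q vertices remain unused, these contain a set without Blocker edges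
-- large enough for the next block. This yields about (q - 1)n / (2(q + 1)) triangles, and q may be
-- taken arbitrarily large.

open Classical in
/-- The triangles of a graph, as sets of three vertices. -/
noncomputable def triangles {V : Type*} [Fintype V] (G : SimpleGraph V) : Finset (Finset V) :=
  Finset.univ.filter fun s => G.IsNClique 3 s

theorem mem_triangles {V : Type*} [Fintype V] {G : SimpleGraph V} {s : Finset V} :
    s ∈ triangles G ↔ G.IsNClique 3 s := by
  simp [triangles]

/-- The complete subgraph on a vertex set which is a clique. -/
def cliqueSubgraph {V : Type*} (G : SimpleGraph V) (s : Finset V) (hs : G.IsClique s) :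
    G.Subgraph where
  verts := s
  Adj a b := a ∈ s ∧ b ∈ s ∧ a ≠ b
  adj_sub h := hs h.1 h.2.1 h.2.2
  edge_vert h := h.1
  symm := ⟨fun _ _ h => ⟨h.2.1, h.1, h.2.2.symm⟩⟩

theorem nonempty_iso_cliqueSubgraph {V : Type*} {G : SimpleGraph V} {s : Finset V}
    (hs : G.IsNClique 3 s) :
    Nonempty ((⊤ : SimpleGraph (Fin 3)) ≃g (cliqueSubgraph G s hs.isClique).coe) := by
  let e : Fin 3 ≃ (cliqueSubgraph G s hs.isClique).verts :=
    (Finset.equivFinOfCardEq hs.card_eq).symm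
  refine ⟨⟨e, ?_⟩⟩
  intro a b
  rw [SimpleGraph.top_adj]
  constructor
  · rintro h rfl
    exact h.ne rfl
  · intro h
    exact ⟨(e a).2, (e b).2, fun h' => h (e.injective (Subtype.ext h'))⟩

theorem adj_of_iso_top {V : Type*} {G : SimpleGraph V} {G' : G.Subgraph}
    (e : (⊤ : SimpleGraph (Fin 3)) ≃g G'.coe) {a b : V} (ha : a ∈ G'.verts) (hb : b ∈ G'.verts)
    (hab : a ≠ b) : G'.Adj a b := by
  have h : (⊤ : SimpleGraph (Fin 3)).Adj (e.symm ⟨a, ha⟩) (e.symm ⟨b, hb⟩) := by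
    rw [SimpleGraph.top_adj]
    intro h
    exact hab (congrArg Subtype.val (e.symm.injective h))
  simpa using e.symm.map_adj_iff.mp h

open Classical in
-- A subgraph isomorphic to the triangle has all edges among its vertices, so it is determined by
-- its vertex set.
theorem copies_triangle {V : Type*} [Fintype V] (C : Finset (Sym2 V)) :
    copies (⊤ : SimpleGraph (Fin 3)) C =
      (triangles (SimpleGraph.fromEdgeSet (↑C : Set (Sym2 V)))).card := by
  unfold copies SimpleGraph.copyCount
  generalize SimpleGraph.fromEdgeSet (↑C : Set (Sym2 V)) = G
  apply Finset.card_bij (fun (G' : G.Subgraph) _ => G'.verts.toFinset)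
  · intro G' hG'
    obtain ⟨e⟩ := (Finset.mem_filter.mp hG').2
    rw [mem_triangles]
    constructor
    · intro a ha b hb hab
      simp only [Set.coe_toFinset] at ha hb
      exact (adj_of_iso_top e ha hb hab).adj_sub
    · rw [Set.toFinset_card, ← Fintype.card_congr e.toEquiv]
      simp
  · intro G₁ h₁ G₂ h₂ h
    obtain ⟨e₁⟩ := (Finset.mem_filter.mp h₁).2
    obtain ⟨e₂⟩ := (Finset.mem_filter.mp h₂).2
    have hv : G₁.verts = G₂.verts := by simpa using h
    ext a b
    · rw [hv]
    · constructor
      · intro hab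
        exact adj_of_iso_top e₂ (hv ▸ hab.fst_mem) (hv ▸ hab.snd_mem) hab.ne
      · intro hab
        exact adj_of_iso_top e₁ (hv ▸ hab.fst_mem) (hv ▸ hab.snd_mem) hab.ne
  · intro s hs
    rw [mem_triangles] at hs
    have h := nonempty_iso_cliqueSubgraph hs
    have hv : (cliqueSubgraph G s hs.isClique).verts = s := rfl
    generalize cliqueSubgraph G s hs.isClique = G' at h hv
    refine ⟨G', ?_, ?_⟩
    · simpa using h
    · ext; simp [hv]

theorem triangles_mono {V : Type*} [Fintype V] {G G' : SimpleGraph V} (h : G ≤ G') :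
    triangles G ⊆ triangles G' := by
  intro s hs
  rw [mem_triangles] at hs ⊢
  exact hs.mono h

/-- No six distinct vertices form a path. -/
def PathSixFree {V : Type*} (G : SimpleGraph V) : Prop :=
  ∀ a b c d e f : V, [a, b, c, d, e, f].Nodup → G.Adj a b → G.Adj b c → G.Adj c d → G.Adj d e →
    G.Adj e f → False

theorem pathSixFree_iff {V : Type*} {G : SimpleGraph V} :
    (SimpleGraph.pathGraph 6).Free G ↔ PathSixFree G := by
  constructor
  · intro h a b c d e f hn hab hbc hcd hde hef
    refine h ⟨⟨⟨fun i => [a, b, c, d, e, f].get i, ?_⟩, ?_⟩⟩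
    · intro i j hij
      rw [SimpleGraph.pathGraph_adj] at hij
      fin_cases i <;> fin_cases j <;> simp_all [SimpleGraph.adj_comm]
    · exact hn.injective_get
  · rintro h ⟨f⟩
    have hadj : ∀ i j : Fin 6, i.val + 1 = j.val → G.Adj (f i) (f j) := fun i j hij =>
      f.toHom.map_adj (SimpleGraph.pathGraph_adj.mpr (Or.inl hij))
    refine h (f 0) (f 1) (f 2) (f 3) (f 4) (f 5) ?_ (hadj _ _ rfl) (hadj _ _ rfl) (hadj _ _ rfl)
      (hadj _ _ rfl) (hadj _ _ rfl)
    have : [f 0, f 1, f 2, f 3, f 4, f 5] = (List.finRange 6).map f := by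
      simp [List.finRange_succ]
    rw [this]
    exact (List.nodup_finRange 6).map f.injective

theorem PathSixFree.mono {V : Type*} {G G' : SimpleGraph V} (h : G ≤ G') (hG' : PathSixFree G') :
    PathSixFree G :=
  fun a b c d e f hn h1 h2 h3 h4 h5 =>
    hG' a b c d e f hn (h h1) (h h2) (h h3) (h h4) (h h5)

-- Bounding the value of the game

section Game

variable {V U W : Type*} [Fintype V] {H : SimpleGraph U} {F : SimpleGraph W}

open Classical in
theorem mem_freeEdges {C B : Finset (Sym2 V)} {e : Sym2 V} :
    e ∈ freeEdges C B ↔ ¬ e.IsDiag ∧ e ∉ C ∧ e ∉ B := by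
  simp [freeEdges]

open Classical in
-- Strategy principle for Blocker: a reply that restores `Inv` keeps the score at most `k`. The
-- second alternative covers Constructor taking the last free edge, when there is no reply.
theorem constructorValue_le_of_invariant {k : ℕ}
    (Inv : Finset (Sym2 V) → Finset (Sym2 V) → Prop)
    (hscore : ∀ C B, Inv C B → copies H C ≤ k)
    (hstep : ∀ C B e, Inv C B → e ∈ legalEdges F C B →
      (∃ f ∈ freeEdges (insert e C) B, Inv (insert e C) (insert f B)) ∨
        (freeEdges (insert e C) B = ∅ ∧ copies H (insert e C) ≤ k)) :
    ∀ C B, Inv C B → constructorValue H F C B ≤ k := by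
  suffices h : ∀ (N : ℕ) C B, (freeEdges C B).card ≤ N → Inv C B → constructorValue H F C B ≤ k from
    fun C B => h _ C B le_rfl
  intro N
  induction N with
  | zero =>
    intro C B hN hI
    have h0 : freeEdges C B = ∅ := Finset.card_eq_zero.mp (Nat.le_zero.mp hN)
    rw [constructorValue, dif_neg]
    · exact hscore C B hI
    · simp [legalEdges, h0]
  | succ N ih =>
    intro C B hN hI
    rw [constructorValue]
    split_ifs with h
    · apply Finset.sup'_le
      rintro ⟨e, he⟩ -
      have hlt := card_freeEdges_insert_left (Finset.mem_filter.mp he).1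
      rcases hstep C B e hI he with ⟨f, hf, hI'⟩ | ⟨h0, hk⟩
      · rw [blockerValue, dif_pos ⟨f, hf⟩]
        refine (Finset.inf'_le _ (Finset.mem_attach _ ⟨f, hf⟩)).trans ?_
        refine ih _ _ ?_ hI'
        have := card_freeEdges_insert_right hf
        dsimp only at *
        omega
      · rw [blockerValue, dif_neg (by simp [h0])]
        exact hk
    · exact hscore C B hI

theorem copies_triangle_mono {C C' : Finset (Sym2 V)} (h : C ⊆ C') :
    copies (⊤ : SimpleGraph (Fin 3)) C ≤ copies (⊤ : SimpleGraph (Fin 3)) C' := by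
  rw [copies_triangle, copies_triangle]
  apply Finset.card_le_card
  apply triangles_mono
  exact SimpleGraph.fromEdgeSet_mono (by exact_mod_cast h)

open Classical in
-- Constructor's edges are never removed, so triangles already built survive to the end under any
-- play.
theorem copies_le_constructorValue :
    ∀ C B : Finset (Sym2 V), copies (⊤ : SimpleGraph (Fin 3)) C ≤ constructorValue (⊤ : SimpleGraph (Fin 3)) F C B := by
  suffices h : ∀ (N : ℕ) (C B : Finset (Sym2 V)), (freeEdges C B).card ≤ N →
      copies (⊤ : SimpleGraph (Fin 3)) C ≤ constructorValue (⊤ : SimpleGraph (Fin 3)) F C B from fun C B => h _ C B le_rfl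
  intro N
  induction N with
  | zero =>
    intro C B hN
    have h0 : freeEdges C B = ∅ := Finset.card_eq_zero.mp (Nat.le_zero.mp hN)
    rw [constructorValue, dif_neg]
    simp [legalEdges, h0]
  | succ N ih =>
    intro C B hN
    rw [constructorValue]
    split_ifs with h
    · obtain ⟨e, he⟩ := h
      refine le_trans ?_ (Finset.le_sup' _ (Finset.mem_attach _ ⟨e, he⟩))
      have hlt := card_freeEdges_insert_left (Finset.mem_filter.mp he).1
      refine (copies_triangle_mono (Finset.subset_insert e C)).trans ?_
      rw [blockerValue]
      split_ifs with h'
      · apply Finset.le_inf'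
        rintro ⟨f, hf⟩ -
        apply ih
        have := card_freeEdges_insert_right hf
        dsimp only at *
        omega
      · exact le_rfl
    · exact le_rfl

open Classical in
theorem le_constructorValue_of_move {k : ℕ} {C B : Finset (Sym2 V)} {e : Sym2 V}
    (he : e ∈ legalEdges F C B) (hne : (freeEdges (insert e C) B).Nonempty)
    (h : ∀ f ∈ freeEdges (insert e C) B, k ≤ constructorValue H F (insert e C) (insert f B)) :
    k ≤ constructorValue H F C B := by
  rw [constructorValue, dif_pos ⟨e, he⟩]
  refine le_trans ?_ (Finset.le_sup' _ (Finset.mem_attach _ ⟨e, he⟩))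
  rw [blockerValue, dif_pos hne]
  apply Finset.le_inf'
  rintro ⟨f, hf⟩ -
  exact h f hf

end Game

end ConstructorBlocker

-- Components and four-cycles in graphs without a six-vertex path

namespace ConstructorBlocker

variable {V : Type*}

/-- Adding one edge to a graph. -/
def addEdge (G : SimpleGraph V) (x y : V) : SimpleGraph V := G ⊔ SimpleGraph.edge x y

theorem addEdge_adj {G : SimpleGraph V} {x y u v : V} :
    (addEdge G x y).Adj u v ↔ G.Adj u v ∨ (u = x ∧ v = y ∨ u = y ∧ v = x) ∧ x ≠ y := by
  rw [addEdge, SimpleGraph.sup_adj, SimpleGraph.edge_adj]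
  grind

theorem le_addEdge {G : SimpleGraph V} {x y : V} : G ≤ addEdge G x y := le_sup_left

theorem addEdge_comm {G : SimpleGraph V} {x y : V} : addEdge G x y = addEdge G y x := by
  rw [addEdge, addEdge, SimpleGraph.edge_comm]

/-- A pair of vertices which neither player has claimed. -/
def FreePair (G R : SimpleGraph V) (u v : V) : Prop := u ≠ v ∧ ¬ G.Adj u v ∧ ¬ R.Adj u v

theorem FreePair.symm {G R : SimpleGraph V} {u v : V} (h : FreePair G R u v) :
    FreePair G R v u :=
  ⟨h.1.symm, fun h' => h.2.1 h'.symm, fun h' => h.2.2 h'.symm⟩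

/-- `S` is the vertex set of a connected component of `G`. -/
structure IsComp (G : SimpleGraph V) (S : Finset V) : Prop where
  nonempty : S.Nonempty
  closed : ∀ u ∈ S, ∀ v, G.Adj u v → v ∈ S
  reachable : ∀ u ∈ S, ∀ v ∈ S, G.Reachable u v

/-- Induction along a walk; this is the way connectivity is used throughout. -/
theorem mem_of_reachable {G : SimpleGraph V} {X : V → Prop} {u v : V} (h : G.Reachable u v)
    (hu : X u) (hX : ∀ a, X a → ∀ b, G.Adj a b → X b) : X v := by
  obtain ⟨p⟩ := h
  induction p with
  | nil => exact hu
  | cons h p ih => exact ih (hX _ hu _ h)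

theorem IsComp.forall_of_closed {G : SimpleGraph V} {S : Finset V} (hS : IsComp G S)
    {X : V → Prop} {u : V} (huS : u ∈ S) (hu : X u)
    (hX : ∀ a ∈ S, X a → ∀ b ∈ S, G.Adj a b → X b) : ∀ v ∈ S, X v := by
  intro v hv
  have := mem_of_reachable (X := fun a => a ∈ S ∧ X a) (hS.reachable u huS v hv) ⟨huS, hu⟩
    (fun a ha b hab => ⟨hS.closed a ha.1 b hab, hX a ha.1 ha.2 b (hS.closed a ha.1 b hab) hab⟩)
  exact this.2

theorem IsComp.exists_adj {G : SimpleGraph V} {S : Finset V} (hS : IsComp G S) (hc : 2 ≤ S.card)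
    {u : V} (hu : u ∈ S) : ∃ v ∈ S, G.Adj u v := by
  by_contra! h
  have := hS.forall_of_closed (X := fun a => a = u) hu rfl (by
    rintro a ha rfl b hb hab
    exact absurd hab (h b hb))
  obtain ⟨v, hv, hvu⟩ := Finset.exists_mem_ne hc u
  exact hvu (this v hv)

theorem IsComp.eq_of_mem {G : SimpleGraph V} {S S' : Finset V} (hS : IsComp G S)
    (hS' : IsComp G S') {u : V} (hu : u ∈ S) (hu' : u ∈ S') : S = S' := by
  ext v
  constructor
  · intro hv
    exact mem_of_reachable (X := fun a => a ∈ S') (hS.reachable u hu v hv) hu' hS'.closed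
  · intro hv
    exact mem_of_reachable (X := fun a => a ∈ S) (hS'.reachable u hu' v hv) hu hS.closed

/-- `a b c d` is a cycle of length four. -/
structure IsC4 (G : SimpleGraph V) (a b c d : V) : Prop where
  ab : G.Adj a b
  bc : G.Adj b c
  cd : G.Adj c d
  da : G.Adj d a
  ac : a ≠ c
  bd : b ≠ d

theorem IsC4.rotate {G : SimpleGraph V} {a b c d : V} (h : IsC4 G a b c d) : IsC4 G b c d a :=
  ⟨h.bc, h.cd, h.da, h.ab, h.bd, h.ac.symm⟩

theorem IsC4.mono {G G' : SimpleGraph V} (hle : G ≤ G') {a b c d : V} (h : IsC4 G a b c d) :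
    IsC4 G' a b c d :=
  ⟨hle h.ab, hle h.bc, hle h.cd, hle h.da, h.ac, h.bd⟩

/-- The component `S` contains a cycle of length four. -/
def HasC4 (G : SimpleGraph V) (S : Finset V) : Prop :=
  ∃ a b c d, a ∈ S ∧ b ∈ S ∧ c ∈ S ∧ d ∈ S ∧ IsC4 G a b c d

/-- `x` is not a vertex of the cycle `a b c d`. -/
def Off (a b c d x : V) : Prop := x ≠ a ∧ x ≠ b ∧ x ≠ c ∧ x ≠ d

theorem Off.rotate {a b c d x : V} (h : Off a b c d x) : Off b c d a x :=
  ⟨h.2.1, h.2.2.1, h.2.2.2, h.1⟩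

theorem PathSixFree.false {G : SimpleGraph V} (hG : PathSixFree G) {a b c d e f : V}
    (h1 : G.Adj a b) (h2 : G.Adj b c) (h3 : G.Adj c d) (h4 : G.Adj d e) (h5 : G.Adj e f)
    (h6 : a ≠ c ∧ a ≠ d ∧ a ≠ e ∧ a ≠ f ∧ b ≠ d ∧ b ≠ e ∧ b ≠ f ∧ c ≠ e ∧ c ≠ f ∧ d ≠ f) :
    False := by
  refine hG a b c d e f ?_ h1 h2 h3 h4 h5
  have := h1.ne; have := h2.ne; have := h3.ne; have := h4.ne; have := h5.ne
  simp only [List.nodup_cons, List.mem_cons, List.not_mem_nil, or_false, not_or, List.nodup_nil,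
    not_false_eq_true, and_true]
  tauto

/-- Otherwise `y x a b c d` is a path. -/
theorem IsC4.not_far {G : SimpleGraph V} (hG : PathSixFree G) {a b c d x y : V}
    (h : IsC4 G a b c d) (hx : Off a b c d x) (hy : Off a b c d y)
    (hxa : G.Adj x a) (hyx : G.Adj y x) : False := by
  have := h.ab.ne; have := h.bc.ne; have := h.cd.ne; have := h.da.ne; have := h.ac; have := h.bd
  obtain ⟨_, _, _, _⟩ := hx
  obtain ⟨_, _, _, _⟩ := hy
  exact hG.false hyx hxa h.ab h.bc h.cd (by grind)

/-- Otherwise `x a d c b y`, going the long way around the cycle, is a path. -/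
theorem IsC4.not_adjacent {G : SimpleGraph V} (hG : PathSixFree G) {a b c d x y : V}
    (h : IsC4 G a b c d) (hx : Off a b c d x) (hy : Off a b c d y) (hxy : x ≠ y)
    (hxa : G.Adj x a) (hyb : G.Adj y b) : False := by
  have := h.ab.ne; have := h.bc.ne; have := h.cd.ne; have := h.da.ne; have := h.ac; have := h.bd
  obtain ⟨_, _, _, _⟩ := hx
  obtain ⟨_, _, _, _⟩ := hy
  exact hG.false hxa h.da.symm h.cd.symm h.bc.symm hyb.symm (by grind)

theorem IsC4.dominates {G : SimpleGraph V} (hG : PathSixFree G) {S : Finset V} (hS : IsComp G S)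
    {a b c d : V} (ha : a ∈ S) (h : IsC4 G a b c d) :
    ∀ x ∈ S, Off a b c d x → G.Adj x a ∨ G.Adj x b ∨ G.Adj x c ∨ G.Adj x d := by
  have key := hS.forall_of_closed (X := fun x => Off a b c d x → G.Adj x a ∨ G.Adj x b ∨
    G.Adj x c ∨ G.Adj x d) ha (fun h => absurd rfl h.1) ?_
  · exact key
  · intro x hx hX y hy hxy hoff
    by_cases hxo : Off a b c d x
    · exfalso
      have h2 := h.rotate
      have h3 := h2.rotate
      have h4 := h3.rotate
      rcases hX hxo with h' | h' | h' | h'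
      · exact h.not_far hG hxo hoff h' hxy.symm
      · exact h2.not_far hG hxo.rotate hoff.rotate h' hxy.symm
      · exact h3.not_far hG hxo.rotate.rotate hoff.rotate.rotate h' hxy.symm
      · exact h4.not_far hG hxo.rotate.rotate.rotate hoff.rotate.rotate.rotate h' hxy.symm
    · have : x = a ∨ x = b ∨ x = c ∨ x = d := by
        unfold Off at hxo; tauto
      rcases this with rfl | rfl | rfl | rfl
      · exact Or.inl hxy.symm
      · exact Or.inr (Or.inl hxy.symm)
      · exact Or.inr (Or.inr (Or.inl hxy.symm))
      · exact Or.inr (Or.inr (Or.inr hxy.symm))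

/-- In a component with at least six vertices, a cycle of length four can be labelled so that all
other vertices are attached to one of two opposite vertices only. -/
theorem exists_hubs {G : SimpleGraph V} (hG : PathSixFree G) {S : Finset V} (hS : IsComp G S)
    (hc : 6 ≤ S.card) (h4 : HasC4 G S) :
    ∃ a b c d, a ∈ S ∧ b ∈ S ∧ c ∈ S ∧ d ∈ S ∧ IsC4 G a b c d ∧
      (∀ x ∈ S, Off a b c d x → G.Adj x a ∨ G.Adj x c) := by
  classical
  obtain ⟨a, b, c, d, ha, hb, hcS, hd, h⟩ := h4
  have hdom := h.dominates hG hS ha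
  have hcard : ({a, b, c, d} : Finset V).card ≤ 4 := Finset.card_le_four
  have hex : ∃ x ∈ S, Off a b c d x := by
    by_contra! hno
    have hsub : S ⊆ {a, b, c, d} := by
      intro x hx
      have := hno x hx
      unfold Off at this
      simp only [Finset.mem_insert, Finset.mem_singleton]
      tauto
    have := Finset.card_le_card hsub
    omega
  have hex2 : ∀ x, ∃ y ∈ S, Off a b c d y ∧ y ≠ x := by
    intro x
    by_contra! hno
    have hsub : S ⊆ insert x {a, b, c, d} := by
      intro y hy
      have := hno y hy
      unfold Off at this
      simp only [Finset.mem_insert, Finset.mem_singleton]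
      tauto
    have := Finset.card_le_card hsub
    have := Finset.card_insert_le x {a, b, c, d}
    omega
  obtain ⟨x, hxS, hx⟩ := hex
  have n1 : ∀ x y, Off a b c d x → Off a b c d y → x ≠ y → G.Adj x a → ¬ G.Adj y b :=
    fun x y hx hy hxy h1 h2 => h.not_adjacent hG hx hy hxy h1 h2
  have n2 : ∀ x y, Off a b c d x → Off a b c d y → x ≠ y → G.Adj x b → ¬ G.Adj y c :=
    fun x y hx hy hxy h1 h2 => h.rotate.not_adjacent hG hx.rotate hy.rotate hxy h1 h2
  have n3 : ∀ x y, Off a b c d x → Off a b c d y → x ≠ y → G.Adj x c → ¬ G.Adj y d :=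
    fun x y hx hy hxy h1 h2 =>
      h.rotate.rotate.not_adjacent hG hx.rotate.rotate hy.rotate.rotate hxy h1 h2
  have n4 : ∀ x y, Off a b c d x → Off a b c d y → x ≠ y → G.Adj x d → ¬ G.Adj y a :=
    fun x y hx hy hxy h1 h2 => h.rotate.rotate.rotate.not_adjacent hG hx.rotate.rotate.rotate
      hy.rotate.rotate.rotate hxy h1 h2
  -- One vertex `x` off the cycle decides the diagonal: different off-cycle vertices cannot attach
  -- to consecutive cycle vertices, so the others attach to the same diagonal as `x`.
  by_cases hac : G.Adj x a ∨ G.Adj x c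
  · refine ⟨a, b, c, d, ha, hb, hcS, hd, h, ?_⟩
    intro y hyS hy
    by_cases hxy : x = y
    · rwa [← hxy]
    · have := hdom y hyS hy
      have := n1 x y hx hy hxy
      have := n2 y x hy hx (Ne.symm hxy)
      have := n3 x y hx hy hxy
      have := n4 y x hy hx (Ne.symm hxy)
      tauto
  · have hbd : G.Adj x b ∨ G.Adj x d := by
      have := hdom x hxS hx
      tauto
    refine ⟨b, c, d, a, hb, hcS, hd, ha, h.rotate, ?_⟩
    intro y hyS hy
    have hy' : Off a b c d y := ⟨hy.2.2.2, hy.1, hy.2.1, hy.2.2.1⟩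
    by_cases hxy : x = y
    · rwa [← hxy]
    · have := hdom y hyS hy'
      have := n1 y x hy' hx (Ne.symm hxy)
      have := n2 x y hx hy' hxy
      have := n3 y x hy' hx (Ne.symm hxy)
      have := n4 x y hx hy' hxy
      tauto

/-- The complete graph on a set of vertices. -/
def cliqueOn (τ : Finset V) : SimpleGraph V where
  Adj u v := u ∈ τ ∧ v ∈ τ ∧ u ≠ v
  symm := ⟨fun _ _ h => ⟨h.2.1, h.1, h.2.2.symm⟩⟩
  loopless := ⟨fun _ h => h.2.2 rfl⟩

theorem cliqueOn_le {G : SimpleGraph V} {τ : Finset V} (h : G.IsClique τ) : cliqueOn τ ≤ G :=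
  fun _ _ huv => h huv.1 huv.2.1 huv.2.2

/-- With the labelling of `exists_hubs`, a further triangle through a vertex off the cycle has
to be spanned by that vertex and the two hubs. -/
theorem IsC4.adj_of_off {K : SimpleGraph V} (hK : PathSixFree K) {a b c d : V}
    (h : IsC4 K a b c d) {x y z : V} (hx : Off a b c d x) (hy : Off a b c d y) (hxy : x ≠ y)
    (hxac : K.Adj x a ∨ K.Adj x c) (hyac : K.Adj y a ∨ K.Adj y c) (hxz : K.Adj x z)
    (hz : z = b ∨ z = d ∨ (Off a b c d z)) : False := by
  have h2 := h.rotate.rotate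
  rcases hz with rfl | rfl | hz
  · rcases hyac with h' | h'
    · exact h.not_adjacent hK hy hx hxy.symm h' hxz
    · exact h.rotate.not_adjacent hK hx.rotate hy.rotate hxy hxz h'
  · rcases hyac with h' | h'
    · exact h.rotate.rotate.rotate.not_adjacent hK hx.rotate.rotate.rotate hy.rotate.rotate.rotate
        hxy hxz h'
    · exact h2.not_adjacent hK hy.rotate.rotate hx.rotate.rotate hxy.symm h' hxz
  · rcases hxac with h' | h'
    · exact h.not_far hK hx hz h' hxz.symm
    · exact h2.not_far hK hx.rotate.rotate hz.rotate.rotate h' hxz.symm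

end ConstructorBlocker

-- Settled components and the bound on their triangles

namespace ConstructorBlocker

variable {V : Type*}

section

open Classical

/-- The triangles of `G` inside the vertex set `S`. -/
noncomputable def trianglesIn (G : SimpleGraph V) (S : Finset V) : Finset (Finset V) :=
  (S.powersetCard 3).filter fun τ => G.IsClique τ

/-- The triples in `S` which Constructor may hope to complete to triangles, given that Blocker has
claimed the edges of `R`. -/
noncomputable def potential (G R : SimpleGraph V) (S : Finset V) : Finset (Finset V) :=
  (S.powersetCard 3).filter fun τ => (∀ u ∈ τ, ∀ v ∈ τ, ¬ R.Adj u v) ∧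
    PathSixFree (G ⊔ cliqueOn τ)

/-- Blocker's edges leave no triangle through some `v ∈ S`, and one of them avoids `v`. -/
def Dull (R : SimpleGraph V) (S : Finset V) : Prop :=
  ∃ v ∈ S, (∃ p ∈ S, ∃ q ∈ S, p ≠ v ∧ q ≠ v ∧ R.Adj p q) ∧
    ∀ x ∈ S, ∀ y ∈ S, x ≠ v → y ≠ v → x ≠ y → R.Adj v x ∨ R.Adj v y ∨ R.Adj x y

/-- One Blocker edge already limits the triangles to two; the rest prepares for a fifth vertex. The
third pattern awaits a second edge at `b d` or `a d`, and Constructor can take only one of these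
before Blocker replies. -/
def Settled4 (G R : SimpleGraph V) (S : Finset V) : Prop :=
  ∃ a b c d, S = {a, b, c, d} ∧ (R.Adj a c ∧ R.Adj b d ∨ R.Adj b c ∧ R.Adj b d ∨
    R.Adj a c ∧ ¬ G.Adj b d ∧ ¬ G.Adj a d)

/-- The last alternative is again a pending move with two distinct ways to make it. The separate
Blocker edge in the first conjunct serves when a sixth vertex is attached to the centre of a star.
-/
def Settled5 (G R : SimpleGraph V) (S : Finset V) : Prop :=
  (∃ p ∈ S, ∃ q ∈ S, R.Adj p q) ∧ (Dull R S ∨ ∃ p ∈ S, ∃ q ∈ S, ∃ p' ∈ S, ∃ q' ∈ S,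
    FreePair G R p q ∧ FreePair G R p' q' ∧ s(p, q) ≠ s(p', q') ∧
      Dull (addEdge R p q) S ∧ Dull (addEdge R p' q') S)

/-- With `T` triangles and `P` potential ones, the inequality with the parity term says T + ⌈(P -
T)/2⌉ ≤ |S|/2: Constructor, who moves first, gets half of the unfinished triples rounded up. The
last clause ensures that one edge completes at most one of them. -/
def SettledC4 (G R : SimpleGraph V) (S : Finset V) : Prop :=
  2 * (potential G R S).card ≤ S.card ∨
    ((trianglesIn G S).card + (potential G R S).card +
        ((potential G R S).card - (trianglesIn G S).card) % 2 ≤ S.card ∧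
      ∀ τ ∈ potential G R S, τ ∉ trianglesIn G S → ∀ τ' ∈ potential G R S, τ' ∉ trianglesIn G S →
        τ ≠ τ' → ∀ u v, u ∈ τ → v ∈ τ → u ∈ τ' → v ∈ τ' → ¬ FreePair G R u v)

/-- An edge meeting all edges of `G` inside `S`. -/
def Hub (G : SimpleGraph V) (S : Finset V) (a c : V) : Prop :=
  a ∈ S ∧ c ∈ S ∧ G.Adj a c ∧ ∀ u ∈ S, ∀ v ∈ S, G.Adj u v → u = a ∨ u = c ∨ v = a ∨ v = c

/-- Blocker has claimed the edge from one of `a`, `c` to a neighbour of the other. -/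
def Dead (G R : SimpleGraph V) (S : Finset V) (a c : V) : Prop :=
  ∃ w ∈ S, w ≠ a ∧ w ≠ c ∧ (G.Adj w a ∧ R.Adj c w ∨ G.Adj w c ∧ R.Adj a w)

/-- A new 4-cycle with adjacent hubs `a, c` may open all triples {w, a, c}; a dead hub edge has one
of them blocked already. With six vertices all four triples are affordable, but a lone live edge is
required so that one move can clear it when the component grows to seven. -/
def LiveHub (G R : SimpleGraph V) (S : Finset V) (a c : V) : Prop :=
  Hub G S a c ∧ ¬ Dead G R S a c

/-- The condition which Blocker maintains for every component of Constructor's graph. -/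
structure Settled (G R : SimpleGraph V) (S : Finset V) : Prop where
  three : S.card = 3 → ∃ p ∈ S, ∃ q ∈ S, R.Adj p q
  four : S.card = 4 → Settled4 G R S
  five : S.card = 5 → Settled5 G R S
  hasC4 : 6 ≤ S.card → HasC4 G S → SettledC4 G R S
  six : S.card = 6 → ¬ HasC4 G S → ∀ a c a' c', LiveHub G R S a c → LiveHub G R S a' c' →
    s(a, c) = s(a', c')
  seven : 7 ≤ S.card → ¬ HasC4 G S → ∀ a c, ¬ LiveHub G R S a c

theorem mem_trianglesIn {G : SimpleGraph V} {S τ : Finset V} :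
    τ ∈ trianglesIn G S ↔ τ ⊆ S ∧ τ.card = 3 ∧ G.IsClique τ := by
  simp [trianglesIn, Finset.mem_powersetCard, and_assoc]

theorem mem_potential {G R : SimpleGraph V} {S τ : Finset V} :
    τ ∈ potential G R S ↔ τ ⊆ S ∧ τ.card = 3 ∧ (∀ u ∈ τ, ∀ v ∈ τ, ¬ R.Adj u v) ∧
      PathSixFree (G ⊔ cliqueOn τ) := by
  simp [potential, Finset.mem_powersetCard, and_assoc]

theorem trianglesIn_subset_potential {G R : SimpleGraph V} {S : Finset V} (hG : PathSixFree G)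
    (hR : ∀ u v, G.Adj u v → ¬ R.Adj u v) : trianglesIn G S ⊆ potential G R S := by
  intro τ hτ
  rw [mem_trianglesIn] at hτ
  rw [mem_potential]
  refine ⟨hτ.1, hτ.2.1, fun u hu v hv h => hR u v (hτ.2.2 hu hv h.ne) h, ?_⟩
  rwa [sup_of_le_left (cliqueOn_le hτ.2.2)]

theorem potential_subset {G G' R R' : SimpleGraph V} {S : Finset V} (hG : G ≤ G') (hR : R ≤ R') :
    potential G' R' S ⊆ potential G R S := by
  intro τ hτ
  rw [mem_potential] at hτ ⊢
  exact ⟨hτ.1, hτ.2.1, fun u hu v hv h => hτ.2.2.1 u hu v hv (hR h),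
    hτ.2.2.2.mono (sup_le_sup_right hG _)⟩

theorem trianglesIn_mono {G G' : SimpleGraph V} {S : Finset V} (hG : G ≤ G') :
    trianglesIn G S ⊆ trianglesIn G' S := by
  intro τ hτ
  rw [mem_trianglesIn] at hτ ⊢
  exact ⟨hτ.1, hτ.2.1, hτ.2.2.mono hG⟩

theorem trianglesIn_congr {G G' : SimpleGraph V} {S : Finset V}
    (h : ∀ u ∈ S, ∀ v ∈ S, G'.Adj u v ↔ G.Adj u v) : trianglesIn G' S = trianglesIn G S := by
  ext τ
  rw [mem_trianglesIn, mem_trianglesIn]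
  refine and_congr_right fun hτ => and_congr_right fun _ => ?_
  constructor
  · intro hc u hu v hv huv
    exact (h u (hτ hu) v (hτ hv)).mp (hc hu hv huv)
  · intro hc u hu v hv huv
    exact (h u (hτ hu) v (hτ hv)).mpr (hc hu hv huv)

/-- A triple in a four-set omits exactly one vertex, here `p` or `q`. -/
theorem card_le_two_of_pair {S : Finset V} {T : Finset (Finset V)} (hS : S.card = 4)
    (hT : T ⊆ S.powersetCard 3) {p q : V} (hp : p ∈ S) (hq : q ∈ S)
    (h : ∀ τ ∈ T, ¬ (p ∈ τ ∧ q ∈ τ)) : T.card ≤ 2 := by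
  have hsub : T ⊆ {S.erase p, S.erase q} := by
    intro τ hτ
    obtain ⟨h1, h2⟩ := Finset.mem_powersetCard.mp (hT hτ)
    have key : ∀ r ∈ S, r ∉ τ → τ = S.erase r := by
      intro r hr hrτ
      apply Finset.eq_of_subset_of_card_le
      · intro x hx
        exact Finset.mem_erase.mpr ⟨fun h => hrτ (h ▸ hx), h1 hx⟩
      · rw [Finset.card_erase_of_mem hr]; omega
    have := h τ hτ
    simp only [Finset.mem_insert, Finset.mem_singleton]
    by_cases hpτ : p ∈ τ
    · exact Or.inr (key q hq fun hqτ => this ⟨hpτ, hqτ⟩)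
    · exact Or.inl (key p hp hpτ)
  exact (Finset.card_le_card hsub).trans Finset.card_le_two

theorem exists_of_card_three {G : SimpleGraph V} {τ : Finset V} (hτ : τ.card = 3)
    (hc : G.IsClique τ) {u : V} (hu : u ∈ τ) :
    ∃ x y, τ = {u, x, y} ∧ G.Adj u x ∧ G.Adj u y ∧ G.Adj x y := by
  obtain ⟨x, y, hxy, h⟩ := Finset.card_eq_two.mp
    (show (τ.erase u).card = 2 by rw [Finset.card_erase_of_mem hu, hτ])
  have hx : x ∈ τ.erase u := by rw [h]; simp
  have hy : y ∈ τ.erase u := by rw [h]; simp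
  rw [Finset.mem_erase] at hx hy
  refine ⟨x, y, ?_, hc hu hx.2 hx.1.symm, hc hu hy.2 hy.1.symm, hc hx.2 hy.2 hxy⟩
  rw [← h, Finset.insert_erase hu]

/-- All potential triples avoid the dull vertex, so they lie in a four-set which still contains a
Blocker edge. -/
theorem dull_bound {G R : SimpleGraph V} {S : Finset V} (hS : S.card = 5) (h : Dull R S) :
    (potential G R S).card ≤ 2 := by
  obtain ⟨v, hv, ⟨p, hp, q, hq, hpv, hqv, hpq⟩, hvT⟩ := h
  have hnv : ∀ τ ∈ potential G R S, v ∉ τ := by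
    intro τ hτ hvτ
    rw [mem_potential] at hτ
    obtain ⟨h1, h2, h3, -⟩ := hτ
    obtain ⟨x, y, hxy, h⟩ := Finset.card_eq_two.mp
      (show (τ.erase v).card = 2 by rw [Finset.card_erase_of_mem hvτ, h2])
    have hx : x ∈ τ.erase v := by rw [h]; simp
    have hy : y ∈ τ.erase v := by rw [h]; simp
    rw [Finset.mem_erase] at hx hy
    rcases hvT x (h1 hx.2) y (h1 hy.2) hx.1 hy.1 hxy with h | h | h
    · exact h3 v hvτ x hx.2 h
    · exact h3 v hvτ y hy.2 h
    · exact h3 x hx.2 y hy.2 h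
  apply card_le_two_of_pair (S := S.erase v) (p := p) (q := q)
  · rw [Finset.card_erase_of_mem hv, hS]
  · intro τ hτ
    have h := mem_potential.mp hτ
    rw [Finset.mem_powersetCard]
    exact ⟨fun x hx => Finset.mem_erase.mpr ⟨fun h => hnv τ hτ (h ▸ hx), h.1 hx⟩, h.2.1⟩
  · exact Finset.mem_erase.mpr ⟨hpv, hp⟩
  · exact Finset.mem_erase.mpr ⟨hqv, hq⟩
  · intro τ hτ h
    exact (mem_potential.mp hτ).2.2.1 p h.1 q h.2 hpq

theorem disjoint_addEdge {G R : SimpleGraph V} (hR : ∀ u v, G.Adj u v → ¬ R.Adj u v) {p q : V}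
    (hpq : ¬ G.Adj p q) : ∀ u v, G.Adj u v → ¬ (addEdge R p q).Adj u v := by
  intro u v huv h
  rw [addEdge_adj] at h
  rcases h with h | ⟨⟨rfl, rfl⟩ | ⟨rfl, rfl⟩, -⟩
  · exact hR u v huv h
  · exact hpq huv
  · exact hpq huv.symm

/-- Traversing a triangle and then walking three steps away from it uses six vertices. So every
vertex is within distance two of the first triangle, and a disjoint second triangle would be reached
too soon, leaving room for its own vertices on the path. -/
theorem triangles_meet {G : SimpleGraph V} {S : Finset V} (hG : PathSixFree G) (hS : IsComp G S)
    {τ τ' : Finset V} (hτ : τ ∈ trianglesIn G S) (hτ' : τ' ∈ trianglesIn G S) :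
    ∃ u, u ∈ τ ∧ u ∈ τ' := by
  rw [mem_trianglesIn] at hτ hτ'
  by_contra! hdis
  obtain ⟨h1, h2, h3⟩ := hτ
  obtain ⟨h1', h2', h3'⟩ := hτ'
  obtain ⟨t₀, ht₀⟩ : τ.Nonempty := Finset.card_pos.mp (by omega)
  obtain ⟨s, hs⟩ : τ'.Nonempty := Finset.card_pos.mp (by omega)
  have near : ∀ t ∈ τ, ∀ s ∈ τ', ¬ G.Adj t s := by
    intro t ht s hs hts
    obtain ⟨x, y, rfl, htx, hty, hxy⟩ := exists_of_card_three h2 h3 ht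
    obtain ⟨x', y', rfl, hsx, hsy, hxy'⟩ := exists_of_card_three h2' h3' hs
    simp only [Finset.mem_insert, Finset.mem_singleton, forall_eq_or_imp, forall_eq, not_or] at hdis
    have := htx.ne; have := hty.ne; have := hsx.ne; have := hsy.ne
    exact hG.false hxy hty.symm hts hsx hxy' (by grind)
  have key := hS.forall_of_closed (X := fun v => v ∈ τ ∨ (∃ t ∈ τ, G.Adj t v) ∨
    ∃ t ∈ τ, ∃ n, n ∉ τ ∧ v ∉ τ ∧ G.Adj t n ∧ G.Adj n v) (h1 ht₀) (Or.inl ht₀) ?_ s (h1' hs)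
  · rcases key with h | ⟨t, ht, hts⟩ | ⟨t, ht, n, hn, -, htn, hns⟩
    · exact hdis s h hs
    · exact near t ht s hs hts
    · by_cases hn' : n ∈ τ'
      · exact near t ht n hn' htn
      obtain ⟨x, y, rfl, htx, hty, hxy⟩ := exists_of_card_three h2 h3 ht
      obtain ⟨x', y', rfl, hsx, hsy, hxy'⟩ := exists_of_card_three h2' h3' hs
      simp only [Finset.mem_insert, Finset.mem_singleton, forall_eq_or_imp, forall_eq, not_or]
        at hdis hn hn'
      have := htx.ne; have := hty.ne; have := hsx.ne; have := hsy.ne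
      exact hG.false hxy hty.symm htn hns hsx (by grind)
  · rintro v - hv b - hvb
    by_cases hbτ : b ∈ τ
    · exact Or.inl hbτ
    by_cases hvτ : v ∈ τ
    · exact Or.inr (Or.inl ⟨v, hvτ, hvb⟩)
    rcases hv with h | ⟨t, ht, htv⟩ | ⟨t, ht, n, hn, -, htn, hnv⟩
    · exact absurd h hvτ
    · exact Or.inr (Or.inr ⟨t, ht, v, hvτ, hbτ, htv, hvb⟩)
    · by_cases hbn : b = n
      · exact Or.inr (Or.inl ⟨t, ht, hbn ▸ htn⟩)
      exfalso
      obtain ⟨x, y, rfl, htx, hty, hxy⟩ := exists_of_card_three h2 h3 ht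
      simp only [Finset.mem_insert, Finset.mem_singleton, not_or] at hbτ hvτ hn
      have := htx.ne; have := hty.ne
      exact hG.false hxy hty.symm htn hnv hvb (by grind)

/-- Two triangles with a common edge contain a 4-cycle, so distinct triangles share exactly one
vertex. This vertex is the same for all, and removing it leaves disjoint pairs in `S`. -/
theorem sunflower_bound {G : SimpleGraph V} {S : Finset V} (hG : PathSixFree G) (hS : IsComp G S)
    (hc : 2 ≤ S.card) (h4 : ¬ HasC4 G S) : 2 * (trianglesIn G S).card ≤ S.card := by
  have share : ∀ τ ∈ trianglesIn G S, ∀ τ' ∈ trianglesIn G S, ∀ u v, u ≠ v → u ∈ τ → v ∈ τ →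
      u ∈ τ' → v ∈ τ' → τ = τ' := by
    intro τ hτ τ' hτ' u v huv hu hv hu' hv'
    rw [mem_trianglesIn] at hτ hτ'
    have third : ∀ σ : Finset V, σ.card = 3 → u ∈ σ → v ∈ σ → ∃ x, x ≠ u ∧ x ≠ v ∧
        σ = {u, v, x} := by
      intro σ hσ hu hv
      have : ((σ.erase u).erase v).card = 1 := by
        rw [Finset.card_erase_of_mem (Finset.mem_erase.mpr ⟨huv.symm, hv⟩),
          Finset.card_erase_of_mem hu, hσ]
      obtain ⟨x, hx⟩ := Finset.card_eq_one.mp this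
      have hxm : x ∈ (σ.erase u).erase v := by rw [hx]; simp
      simp only [Finset.mem_erase] at hxm
      refine ⟨x, hxm.2.1, hxm.1, ?_⟩
      rw [← hx, Finset.insert_erase (Finset.mem_erase.mpr ⟨huv.symm, hv⟩), Finset.insert_erase hu]
    obtain ⟨x, hxu, hxv, rfl⟩ := third τ hτ.2.1 hu hv
    obtain ⟨y, hyu, hyv, rfl⟩ := third τ' hτ'.2.1 hu' hv'
    by_contra hne
    have hxy : x ≠ y := fun h => hne (by rw [h])
    refine h4 ⟨u, x, v, y, hτ.1 hu, hτ.1 (by simp), hτ.1 hv, hτ'.1 (by simp), ?_⟩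
    exact ⟨hτ.2.2 hu (by simp) hxu.symm, hτ.2.2 (by simp) hv hxv,
      hτ'.2.2 hv' (by simp) hyv.symm, hτ'.2.2 (by simp) hu' hyu, huv, hxy⟩
  by_cases hT : (trianglesIn G S).card ≤ 1
  · omega
  push Not at hT
  obtain ⟨τ₁, h₁, τ₂, h₂, hne⟩ := Finset.one_lt_card.mp hT
  obtain ⟨u, hu₁, hu₂⟩ := triangles_meet hG hS h₁ h₂
  -- A triangle missing `u` meets the first two at distinct vertices `b` and `d`; then `u b d` is a
  -- triangle sharing the edge `b d` with it, hence equal to it, which is absurd.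
  have hall : ∀ τ ∈ trianglesIn G S, u ∈ τ := by
    intro τ hτ
    by_contra huτ
    obtain ⟨b, hb, hb₁⟩ := triangles_meet hG hS hτ h₁
    obtain ⟨d, hd, hd₂⟩ := triangles_meet hG hS hτ h₂
    have hub : u ≠ b := fun h => huτ (h ▸ hb)
    have hud : u ≠ d := fun h => huτ (h ▸ hd)
    have hbd : b ≠ d := by
      rintro rfl
      exact hne (share τ₁ h₁ τ₂ h₂ u b hub hu₁ hb₁ hu₂ hd₂)
    have m := mem_trianglesIn.mp hτ
    have m₁ := mem_trianglesIn.mp h₁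
    have m₂ := mem_trianglesIn.mp h₂
    have hcl : ({u, b, d} : Finset V) ∈ trianglesIn G S := by
      rw [mem_trianglesIn]
      refine ⟨?_, Finset.card_eq_three.mpr ⟨u, b, d, hub, hud, hbd, rfl⟩, ?_⟩
      · intro x hx
        simp only [Finset.mem_insert, Finset.mem_singleton] at hx
        rcases hx with rfl | rfl | rfl
        · exact m₁.1 hu₁
        · exact m.1 hb
        · exact m.1 hd
      · have e1 := m₁.2.2 hu₁ hb₁ hub
        have e2 := m₂.2.2 hu₂ hd₂ hud
        have e3 := m.2.2 hb hd hbd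
        intro x hx y hy hxy
        simp only [Finset.coe_insert, Finset.coe_singleton, Set.mem_insert_iff,
          Set.mem_singleton_iff] at hx hy
        rcases hx with rfl | rfl | rfl <;> rcases hy with rfl | rfl | rfl <;>
          first | exact absurd rfl hxy | assumption | (apply SimpleGraph.Adj.symm; assumption)
    have := share _ hcl τ hτ b d hbd (by simp) (by simp) hb hd
    exact huτ (this ▸ (by simp))
  have hcard : ((trianglesIn G S).biUnion fun τ => τ.erase u).card =
      2 * (trianglesIn G S).card := by
    rw [Finset.card_biUnion]
    · rw [Finset.sum_congr rfl (g := fun _ => 2), Finset.sum_const, smul_eq_mul, mul_comm]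
      intro τ hτ
      rw [Finset.card_erase_of_mem (hall τ hτ), (mem_trianglesIn.mp hτ).2.1]
    · intro τ hτ τ' hτ' hττ
      rw [Function.onFun, Finset.disjoint_left]
      intro x hx hx'
      rw [Finset.mem_erase] at hx hx'
      exact hττ (share τ hτ τ' hτ' u x hx.1.symm (hall τ hτ) hx.2 (hall τ' hτ') hx'.2)
  rw [← hcard]
  apply Finset.card_le_card
  intro x hx
  obtain ⟨τ, hτ, hxτ⟩ := Finset.mem_biUnion.mp hx
  exact (mem_trianglesIn.mp hτ).1 (Finset.mem_of_mem_erase hxτ)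

theorem trianglesIn_subset_powersetCard {G : SimpleGraph V} {S : Finset V} :
    trianglesIn G S ⊆ S.powersetCard 3 := Finset.filter_subset _ _

theorem Settled.bound {G R : SimpleGraph V} {S : Finset V} (hG : PathSixFree G)
    (hR : ∀ u v, G.Adj u v → ¬ R.Adj u v) (hS : IsComp G S) (h : Settled G R S) :
    2 * (trianglesIn G S).card ≤ S.card := by
  have hle : (trianglesIn G S).card ≤ S.card.choose 3 := by
    rw [← Finset.card_powersetCard]
    exact Finset.card_le_card trianglesIn_subset_powersetCard
  have hTP := Finset.card_le_card (trianglesIn_subset_potential (S := S) hG hR)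
  rcases lt_or_ge S.card 6 with h6 | h6
  · obtain h0 | h0 | h0 | h0 | h0 | h0 : S.card = 0 ∨ S.card = 1 ∨ S.card = 2 ∨ S.card = 3 ∨
        S.card = 4 ∨ S.card = 5 := by omega
    · rw [h0, Nat.choose_eq_zero_of_lt (by norm_num)] at hle; omega
    · rw [h0, Nat.choose_eq_zero_of_lt (by norm_num)] at hle; omega
    · rw [h0, Nat.choose_eq_zero_of_lt (by norm_num)] at hle; omega
    · rw [h0, Nat.choose_self] at hle; omega
    · have hpair : ∃ p ∈ S, ∃ q ∈ S, R.Adj p q := by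
        obtain ⟨a, b, c, d, rfl, h | h | h⟩ := h.four h0
        · exact ⟨a, by simp, c, by simp, h.1⟩
        · exact ⟨b, by simp, c, by simp, h.1⟩
        · exact ⟨a, by simp, c, by simp, h.1⟩
      obtain ⟨p, hp, q, hq, hpq⟩ := hpair
      have := card_le_two_of_pair h0 (trianglesIn_subset_powersetCard (G := G)) hp hq (by
        intro τ hτ hm
        exact hR p q ((mem_trianglesIn.mp hτ).2.2 hm.1 hm.2 hpq.ne) hpq)
      omega
    · obtain ⟨-, hd | ⟨p, hp, q, hq, p', hp', q', hq', hf, -, -, hd, -⟩⟩ := h.five h0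
      -- The pending pair is not Constructor's, so her present triangles stay potential even if it
      -- is given to Blocker.
      · have := dull_bound (G := G) h0 hd
        omega
      · have := dull_bound (G := G) h0 hd
        have := Finset.card_le_card (trianglesIn_subset_potential (S := S) hG
          (disjoint_addEdge hR hf.2.1))
        omega
  · by_cases h4 : HasC4 G S
    · rcases h.hasC4 h6 h4 with h | ⟨h, -⟩ <;> omega
    · exact sunflower_bound hG hS (by omega) h4

end

end ConstructorBlocker

-- Stability of settled components

namespace ConstructorBlocker

variable {V : Type*}

section

open Classical

theorem Dull.mono {R R' : SimpleGraph V} {S : Finset V} (hR : R ≤ R') (h : Dull R S) :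
    Dull R' S := by
  obtain ⟨v, hv, ⟨p, hp, q, hq, hpv, hqv, hpq⟩, hT⟩ := h
  refine ⟨v, hv, ⟨p, hp, q, hq, hpv, hqv, hR hpq⟩, fun x hx y hy hxv hyv hxy => ?_⟩
  rcases hT x hx y hy hxv hyv hxy with h | h | h
  · exact Or.inl (hR h)
  · exact Or.inr (Or.inl (hR h))
  · exact Or.inr (Or.inr (hR h))

theorem addEdge_mono {R R' : SimpleGraph V} (hR : R ≤ R') {p q : V} :
    addEdge R p q ≤ addEdge R' p q := sup_le_sup_right hR _

theorem addEdge_congr {R : SimpleGraph V} {p q p' q' : V} (h : s(p, q) = s(p', q')) :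
    addEdge R p q = addEdge R p' q' := by
  rcases Sym2.eq_iff.mp h with ⟨rfl, rfl⟩ | ⟨rfl, rfl⟩
  · rfl
  · exact addEdge_comm

theorem FreePair.addEdge {G R : SimpleGraph V} {p q u v : V} (h : FreePair G R u v)
    (hne : s(u, v) ≠ s(p, q)) : FreePair G (addEdge R p q) u v := by
  refine ⟨h.1, h.2.1, fun h' => ?_⟩
  rw [addEdge_adj] at h'
  rcases h' with h' | ⟨h', -⟩
  · exact h.2.2 h'
  · exact hne (Sym2.eq_iff.mpr h')

theorem LiveHub.of_le {G R R' : SimpleGraph V} {S : Finset V} {a c : V} (hR : R ≤ R')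
    (h : LiveHub G R' S a c) : LiveHub G R S a c := by
  refine ⟨h.1, fun ⟨w, hw, hwa, hwc, hd⟩ => h.2 ⟨w, hw, hwa, hwc, ?_⟩⟩
  rcases hd with hd | hd
  · exact Or.inl ⟨hd.1, hR hd.2⟩
  · exact Or.inr ⟨hd.1, hR hd.2⟩

theorem SettledC4.mono {G G' R R' : SimpleGraph V} {S : Finset V} (hG : G ≤ G') (hR : R ≤ R')
    (hG' : PathSixFree G') (hdis : ∀ u v, G'.Adj u v → ¬ R'.Adj u v)
    (hT : trianglesIn G' S = trianglesIn G S) (h : SettledC4 G R S) : SettledC4 G' R' S := by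
  have hPs := potential_subset (S := S) hG hR
  have hP := Finset.card_le_card hPs
  have hTP := Finset.card_le_card (trianglesIn_subset_potential (S := S) hG' hdis)
  rcases h with h | ⟨h, hD⟩
  · left; omega
  · right
    rw [hT] at hTP ⊢
    refine ⟨by omega, fun τ hτ hτT τ' hτ' hτT' hne u v h1 h2 h3 h4 hf => ?_⟩
    exact hD τ (hPs hτ) hτT τ' (hPs hτ') hτT' hne u v h1 h2 h3 h4
      ⟨hf.1, fun h' => hf.2.1 (hG h'), fun h' => hf.2.2 (hR h')⟩

/-- Blocker is obliged to move even when nothing needs an answer, and his reply in one component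
must not disturb the others. -/
theorem Settled.addEdge {G R : SimpleGraph V} {S : Finset V} {p q : V} (hG : PathSixFree G)
    (hR : ∀ u v, G.Adj u v → ¬ R.Adj u v) (hpq : ¬ G.Adj p q) (h : Settled G R S) :
    Settled G (addEdge R p q) S where
  three hc := by
    obtain ⟨a, ha, b, hb, hab⟩ := h.three hc
    exact ⟨a, ha, b, hb, le_addEdge hab⟩
  four hc := by
    obtain ⟨a, b, c, d, hS, h | h | h⟩ := h.four hc
    · exact ⟨a, b, c, d, hS, Or.inl ⟨le_addEdge h.1, le_addEdge h.2⟩⟩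
    · exact ⟨a, b, c, d, hS, Or.inr (Or.inl ⟨le_addEdge h.1, le_addEdge h.2⟩)⟩
    · exact ⟨a, b, c, d, hS, Or.inr (Or.inr ⟨le_addEdge h.1, h.2⟩)⟩
  five hc := by
    obtain ⟨⟨a, ha, b, hb, hab⟩, h⟩ := h.five hc
    refine ⟨⟨a, ha, b, hb, le_addEdge hab⟩, ?_⟩
    rcases h with h | ⟨u, hu, v, hv, u', hu', v', hv', hf, hf', hne, hd, hd'⟩
    · exact Or.inl (h.mono le_addEdge)
    -- If the added edge is one of the two pending pairs, the component becomes dull at once;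
    -- otherwise both stay free.
    · by_cases h1 : s(u, v) = s(p, q)
      · rw [addEdge_congr h1] at hd
        exact Or.inl hd
      by_cases h2 : s(u', v') = s(p, q)
      · rw [addEdge_congr h2] at hd'
        exact Or.inl hd'
      · exact Or.inr ⟨u, hu, v, hv, u', hu', v', hv', hf.addEdge h1, hf'.addEdge h2, hne,
          hd.mono (addEdge_mono le_addEdge), hd'.mono (addEdge_mono le_addEdge)⟩
  hasC4 hc h4 := (h.hasC4 hc h4).mono le_rfl le_addEdge hG (disjoint_addEdge hR hpq) rfl
  six hc h4 a c a' c' hl hl' :=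
    h.six hc h4 a c a' c' (hl.of_le le_addEdge) (hl'.of_le le_addEdge)
  seven hc h4 a c hl := h.seven hc h4 a c (hl.of_le le_addEdge)

theorem HasC4.congr {G G' : SimpleGraph V} {S : Finset V}
    (h : ∀ u ∈ S, ∀ v ∈ S, G'.Adj u v ↔ G.Adj u v) : HasC4 G' S ↔ HasC4 G S := by
  constructor
  · rintro ⟨a, b, c, d, ha, hb, hc, hd, h4⟩
    exact ⟨a, b, c, d, ha, hb, hc, hd, (h a ha b hb).mp h4.ab, (h b hb c hc).mp h4.bc,
      (h c hc d hd).mp h4.cd, (h d hd a ha).mp h4.da, h4.ac, h4.bd⟩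
  · rintro ⟨a, b, c, d, ha, hb, hc, hd, h4⟩
    exact ⟨a, b, c, d, ha, hb, hc, hd, (h a ha b hb).mpr h4.ab, (h b hb c hc).mpr h4.bc,
      (h c hc d hd).mpr h4.cd, (h d hd a ha).mpr h4.da, h4.ac, h4.bd⟩

theorem LiveHub.congr {G G' R : SimpleGraph V} {S : Finset V} {a c : V}
    (h : ∀ u ∈ S, ∀ v ∈ S, G'.Adj u v ↔ G.Adj u v) (hl : LiveHub G' R S a c) :
    LiveHub G R S a c := by
  obtain ⟨⟨ha, hc, hac, hcov⟩, hd⟩ := hl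
  refine ⟨⟨ha, hc, (h a ha c hc).mp hac, fun u hu v hv huv => hcov u hu v hv
    ((h u hu v hv).mpr huv)⟩, fun ⟨w, hw, hwa, hwc, hd'⟩ => hd ⟨w, hw, hwa, hwc, ?_⟩⟩
  rwa [h w hw a ha, h w hw c hc]

/-- Edges elsewhere matter only through `potential`, which tests path-freeness of the whole graph
and hence can only shrink. -/
theorem Settled.congr {G G' R : SimpleGraph V} {S : Finset V} (hle : G ≤ G')
    (hG' : PathSixFree G') (hR : ∀ u v, G'.Adj u v → ¬ R.Adj u v)
    (hS : ∀ u ∈ S, ∀ v ∈ S, G'.Adj u v ↔ G.Adj u v) (h : Settled G R S) : Settled G' R S where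
  three := h.three
  four hc := by
    obtain ⟨a, b, c, d, rfl, h | h | h⟩ := h.four hc
    · exact ⟨a, b, c, d, rfl, Or.inl h⟩
    · exact ⟨a, b, c, d, rfl, Or.inr (Or.inl h)⟩
    · refine ⟨a, b, c, d, rfl, Or.inr (Or.inr ⟨h.1, ?_, ?_⟩)⟩
      · rw [hS b (by simp) d (by simp)]; exact h.2.1
      · rw [hS a (by simp) d (by simp)]; exact h.2.2
  five hc := by
    obtain ⟨h0, h | ⟨u, hu, v, hv, u', hu', v', hv', hf, hf', hne, hd, hd'⟩⟩ := h.five hc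
    · exact ⟨h0, Or.inl h⟩
    · refine ⟨h0, Or.inr ⟨u, hu, v, hv, u', hu', v', hv', ⟨hf.1, ?_, hf.2.2⟩,
        ⟨hf'.1, ?_, hf'.2.2⟩, hne, hd, hd'⟩⟩
      · rw [hS u hu v hv]; exact hf.2.1
      · rw [hS u' hu' v' hv']; exact hf'.2.1
  hasC4 hc h4 := (h.hasC4 hc ((HasC4.congr hS).mp h4)).mono hle le_rfl hG' hR
    (trianglesIn_congr hS)
  six hc h4 a c a' c' hl hl' := h.six hc (fun h => h4 ((HasC4.congr hS).mpr h)) a c a' c'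
    (hl.congr hS) (hl'.congr hS)
  seven hc h4 a c hl := h.seven hc (fun h => h4 ((HasC4.congr hS).mpr h)) a c (hl.congr hS)

end

end ConstructorBlocker

-- Blocker's replies in components with at most five vertices

namespace ConstructorBlocker

variable {V : Type*}

section

open Classical

/-- Blocker can settle `S` with at most one move. -/
def Answerable (G R : SimpleGraph V) (S : Finset V) : Prop :=
  Settled G R S ∨ ∃ p q, FreePair G R p q ∧ Settled G (addEdge R p q) S

/-- Blocker may already own the desired edge; quantifying over all larger `R'` treats both
situations together. -/
theorem answerable_of_pair {G R : SimpleGraph V} {S : Finset V} {p q : V} (hpq : p ≠ q)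
    (hG : ¬ G.Adj p q) (h : ∀ R', R ≤ R' → R'.Adj p q → Settled G R' S) : Answerable G R S := by
  by_cases hR : R.Adj p q
  · exact Or.inl (h R le_rfl hR)
  · exact Or.inr ⟨p, q, ⟨hpq, hG, hR⟩, h _ le_addEdge (addEdge_adj.mpr (by simp [hpq]))⟩

theorem settled_of_card_le_two {G R : SimpleGraph V} {S : Finset V} (hS : S.card ≤ 2) :
    Settled G R S := by
  constructor <;> intros <;> omega

theorem settled_of_card_three {G R : SimpleGraph V} {S : Finset V} (hS : S.card = 3)
    (h : ∃ p ∈ S, ∃ q ∈ S, R.Adj p q) : Settled G R S := by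
  constructor <;> first | exact fun _ => h | (intros; omega)

theorem settled_of_card_four {G R : SimpleGraph V} {S : Finset V} (hS : S.card = 4)
    (h : Settled4 G R S) : Settled G R S := by
  constructor <;> first | exact fun _ => h | (intros; omega)

theorem settled_of_card_five {G R : SimpleGraph V} {S : Finset V} (hS : S.card = 5)
    (h : Settled5 G R S) : Settled G R S := by
  constructor <;> first | exact fun _ => h | (intros; omega)

theorem distinct_of_card_four {a b c d : V} (h : ({a, b, c, d} : Finset V).card = 4) :
    a ≠ b ∧ a ≠ c ∧ a ≠ d ∧ b ≠ c ∧ b ≠ d ∧ c ≠ d := by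
  rw [Finset.card_insert_eq_ite, Finset.card_insert_eq_ite, Finset.card_insert_eq_ite] at h
  split_ifs at h <;> simp_all

/-- The vertex `v` can form a triangle only with `z` and `w`, which are themselves separated. -/
theorem dull_of_cherry {R : SimpleGraph V} {S : Finset V} {v x y z w : V}
    (hS : ∀ u ∈ S, u = v ∨ u = x ∨ u = y ∨ u = z ∨ u = w) (hv : v ∈ S) (hz : z ∈ S) (hw : w ∈ S)
    (hvz : v ≠ z) (hvw : v ≠ w) (hvx : R.Adj v x) (hvy : R.Adj v y) (hzw : R.Adj z w) :
    Dull R S := by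
  refine ⟨v, hv, ⟨z, hz, w, hw, hvz.symm, hvw.symm, hzw⟩, fun p hp q hq hpv hqv hpq => ?_⟩
  have := hzw.symm
  rcases hS p hp with rfl | rfl | rfl | rfl | rfl <;>
    rcases hS q hq with rfl | rfl | rfl | rfl | rfl <;> tauto

theorem dull_of_star {R : SimpleGraph V} {S : Finset V} {v x y z w p q : V}
    (hS : ∀ u ∈ S, u = v ∨ u = x ∨ u = y ∨ u = z ∨ u = w) (hv : v ∈ S) (hp : p ∈ S) (hq : q ∈ S)
    (hvp : v ≠ p) (hvq : v ≠ q) (hvx : R.Adj v x) (hvy : R.Adj v y) (hvz : R.Adj v z)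
    (hpq : R.Adj p q) : Dull R S := by
  refine ⟨v, hv, ⟨p, hp, q, hq, hvp.symm, hvq.symm, hpq⟩, fun p hp q hq hpv hqv hpq => ?_⟩
  rcases hS p hp with rfl | rfl | rfl | rfl | rfl <;>
    rcases hS q hq with rfl | rfl | rfl | rfl | rfl <;> tauto

/-- Two pairs either of which makes `S` dull, and which Constructor has not claimed. -/
theorem settled5_of_two {G R : SimpleGraph V} {S : Finset V} {p q p' q' : V}
    (h0 : ∃ p ∈ S, ∃ q ∈ S, R.Adj p q) (hp : p ∈ S) (hq : q ∈ S) (hp' : p' ∈ S) (hq' : q' ∈ S)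
    (hpq : p ≠ q) (hpq' : p' ≠ q') (hG : ¬ G.Adj p q) (hG' : ¬ G.Adj p' q')
    (hne : s(p, q) ≠ s(p', q')) (h : ∀ R', R ≤ R' → R'.Adj p q → Dull R' S)
    (h' : ∀ R', R ≤ R' → R'.Adj p' q' → Dull R' S) : Settled5 G R S := by
  refine ⟨h0, ?_⟩
  by_cases h1 : R.Adj p q
  · exact Or.inl (h R le_rfl h1)
  by_cases h2 : R.Adj p' q'
  · exact Or.inl (h' R le_rfl h2)
  exact Or.inr ⟨p, hp, q, hq, p', hp', q', hq', ⟨hpq, hG, h1⟩, ⟨hpq', hG', h2⟩, hne,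
    h _ le_addEdge (addEdge_adj.mpr (by simp [hpq])),
    h' _ le_addEdge (addEdge_adj.mpr (by simp [hpq']))⟩

theorem answerable_two_one {G R : SimpleGraph V} {x y z : V} (hxy : x ≠ y) (hzy : z ≠ y)
    (hxz : x ≠ z) (hG : ¬ G.Adj z y) : Answerable G R {x, z, y} :=
  answerable_of_pair hzy hG fun R' _ h => settled_of_card_three
    (Finset.card_eq_three.mpr ⟨x, z, y, hxz, hxy, hzy, rfl⟩) ⟨z, by simp, y, by simp, h⟩

/-- The new vertex misses `p` or `q`; Blocker joins it there to get two edges at one vertex. -/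
theorem answerable_three_one {G R : SimpleGraph V} {p q r y : V} {S : Finset V}
    (hS : S = {r, p, q, y}) (hc : S.card = 4) (hpq : R.Adj p q)
    (hG : ¬ G.Adj p y ∨ ¬ G.Adj q y) : Answerable G R S := by
  obtain ⟨-, -, -, -, hpy, hqy⟩ := distinct_of_card_four (hS ▸ hc)
  rcases hG with hG | hG
  · refine answerable_of_pair hpy hG fun R' hR' h => settled_of_card_four hc ?_
    exact ⟨r, p, q, y, hS, Or.inr (Or.inl ⟨hR' hpq, h⟩)⟩
  · refine answerable_of_pair hqy hG fun R' hR' h => settled_of_card_four hc ?_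
    exact ⟨r, q, p, y, by rw [hS, Finset.insert_comm p q], Or.inr (Or.inl ⟨hR' hpq.symm, h⟩)⟩

theorem answerable_two_two {G R : SimpleGraph V} {a x y d : V} {S : Finset V}
    (hS : S = {a, x, y, d}) (hc : S.card = 4) (h1 : ¬ G.Adj a y) (h2 : ¬ G.Adj x d)
    (h3 : ¬ G.Adj a d) : Answerable G R S := by
  obtain ⟨-, hay, -, -, -, -⟩ := distinct_of_card_four (hS ▸ hc)
  refine answerable_of_pair hay h1 fun R' _ h => settled_of_card_four hc ?_
  exact ⟨a, x, y, d, hS, Or.inr (Or.inr ⟨h, h2, h3⟩)⟩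

/-- Only the pending pattern needs work: Blocker takes `b d` for two disjoint edges, or, if
Constructor just took it, `a d` for two edges at `a`. -/
theorem answerable_four_inner {G G' R : SimpleGraph V} {S : Finset V} {x y : V} (hc : S.card = 4)
    (hG' : G' = addEdge G x y) (h : Settled4 G R S) : Answerable G' R S := by
  obtain ⟨a, b, c, d, hS, h | h | h⟩ := h
  · exact Or.inl (settled_of_card_four hc ⟨a, b, c, d, hS, Or.inl h⟩)
  · exact Or.inl (settled_of_card_four hc ⟨a, b, c, d, hS, Or.inr (Or.inl h)⟩)
  · obtain ⟨hab, -, had, -, hbd, -⟩ := distinct_of_card_four (hS ▸ hc)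
    by_cases hbd' : G'.Adj b d
    · have had' : ¬ G'.Adj a d := by
        rw [hG', addEdge_adj] at hbd' ⊢
        grind
      refine answerable_of_pair had had' fun R' hR' hR => settled_of_card_four hc ?_
      refine ⟨b, a, c, d, ?_, Or.inr (Or.inl ⟨hR' h.1, hR⟩)⟩
      rw [hS, Finset.insert_comm]
    · refine answerable_of_pair hbd hbd' fun R' hR' hR => settled_of_card_four hc ?_
      exact ⟨a, b, c, d, hS, Or.inl ⟨hR' h.1, hR⟩⟩

theorem answerable_five_inner {G G' R : SimpleGraph V} {S : Finset V} {x y : V} (hc : S.card = 5)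
    (hG' : G' = addEdge G x y) (h : Settled5 G R S) : Answerable G' R S := by
  obtain ⟨⟨a, ha, b, hb, hab⟩, h | ⟨u, hu, v, hv, u', hu', v', hv', hf, hf', hne, hd, hd'⟩⟩ := h
  · exact Or.inl (settled_of_card_five hc ⟨⟨a, ha, b, hb, hab⟩, Or.inl h⟩)
  · have key : ∀ u v, FreePair G R u v → Dull (addEdge R u v) S → ¬ G'.Adj u v →
        Answerable G' R S := fun u v hf hd hG => Or.inr ⟨u, v, ⟨hf.1, hG, hf.2.2⟩,
          settled_of_card_five hc ⟨⟨a, ha, b, hb, le_addEdge hab⟩, Or.inl hd⟩⟩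
    by_cases huv : G'.Adj u v
    · refine key u' v' hf' hd' fun h => hne ?_
      have h1 := hf.2.1
      have h2 := hf'.2.1
      rw [hG', addEdge_adj] at huv h
      have h3 : s(u, v) = s(x, y) := Sym2.eq_iff.mpr (huv.resolve_left h1).1
      have h4 : s(u', v') = s(x, y) := Sym2.eq_iff.mpr (h.resolve_left h2).1
      rw [h3, h4]
    · exact key u v hf hd huv

/-- The new vertex `e` hangs on `x` only, so nearly all edges at `e` are available to Blocker. Two
disjoint Blocker edges together with any edge at `e` make the component dull (`hspoke`). -/
theorem answerable_four_one {G R : SimpleGraph V} {S : Finset V} {a b c d e x : V}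
    (hS : S = {a, b, c, d, e}) (hc : S.card = 5)
    (hd4 : a ≠ b ∧ a ≠ c ∧ a ≠ d ∧ b ≠ c ∧ b ≠ d ∧ c ≠ d)
    (he : e ≠ a ∧ e ≠ b ∧ e ≠ c ∧ e ≠ d)
    (hG : ∀ u, u ≠ x → ¬ G.Adj e u)
    (h : R.Adj a c ∧ R.Adj b d ∨ R.Adj b c ∧ R.Adj b d ∨
      R.Adj a c ∧ ¬ G.Adj b d ∧ ¬ G.Adj a d) : Answerable G R S := by
  obtain ⟨hab, hac, had, hbc, hbd, hcd⟩ := hd4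
  obtain ⟨hea, heb, hec, hed⟩ := he
  have m : ∀ u, u ∈ S ↔ u = a ∨ u = b ∨ u = c ∨ u = d ∨ u = e := by
    intro u; rw [hS]; simp
  have ma : a ∈ S := by rw [m]; simp
  have mb : b ∈ S := by rw [m]; simp
  have mc : c ∈ S := by rw [m]; simp
  have md : d ∈ S := by rw [m]; simp
  have me : e ∈ S := by rw [m]; simp
  have hspoke : ∀ R', R ≤ R' → R'.Adj a c → R'.Adj b d → ∀ u ∈ S, R'.Adj e u → Dull R' S := by
    intro R' _ h1 h2 u hu hR
    rcases (m u).mp hu with rfl | rfl | rfl | rfl | rfl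
    · exact dull_of_cherry (v := u) (x := c) (y := e) (z := b) (w := d) (by grind) ma mb md hab had
        h1 hR.symm h2
    · exact dull_of_cherry (v := u) (x := d) (y := e) (z := a) (w := c) (by grind) mb ma mc
        hab.symm hbc h2 hR.symm h1
    · exact dull_of_cherry (v := u) (x := a) (y := e) (z := b) (w := d) (by grind) mc mb md
        hbc.symm hcd h1.symm hR.symm h2
    · exact dull_of_cherry (v := u) (x := b) (y := e) (z := a) (w := c) (by grind) md ma mc
        had.symm hcd.symm h2.symm hR.symm h1
    · exact absurd rfl hR.ne
  rcases h with ⟨h1, h2⟩ | ⟨h1, h2⟩ | ⟨h1, h2, h3⟩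
  · obtain ⟨u, hu, hux, hue⟩ : ∃ u ∈ S, u ≠ x ∧ e ≠ u := by
      by_cases hax : a = x
      · exact ⟨b, mb, fun h => hab (hax.trans h.symm), heb⟩
      · exact ⟨a, ma, hax, hea⟩
    refine answerable_of_pair hue (hG u hux) fun R' hR' h => settled_of_card_five hc ?_
    exact ⟨⟨a, ma, c, mc, hR' h1⟩, Or.inl (hspoke R' hR' (hR' h1) (hR' h2) u hu h)⟩
  -- If `e` hangs on `a`, the edge `e b` gives `b` three Blocker neighbours, and either of `e c`, `e
  -- d` then finishes. Otherwise `e a` is available and complements the two edges at `b`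
  -- immediately.
  · by_cases hax : a = x
    · refine answerable_of_pair heb (hG b (fun h => hab (hax.trans h.symm))) fun R' hR' h =>
        settled_of_card_five hc ?_
      refine settled5_of_two ⟨b, mb, c, mc, hR' h1⟩ me mc me md hec hed
        (hG c (fun h => hac (hax.trans h.symm))) (hG d (fun h => had (hax.trans h.symm)))
        (by grind) ?_ ?_
      · intro R'' hR'' h''
        exact dull_of_star (v := b) (x := c) (y := d) (z := e) (w := a) (p := e) (q := c) (by grind)
          mb me mc heb.symm hbc (hR'' (hR' h1)) (hR'' (hR' h2)) (hR'' h.symm) h''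
      · intro R'' hR'' h''
        exact dull_of_star (v := b) (x := c) (y := d) (z := e) (w := a) (p := e) (q := d) (by grind)
          mb me md heb.symm hbd (hR'' (hR' h1)) (hR'' (hR' h2)) (hR'' h.symm) h''
    · refine answerable_of_pair hea (hG a hax) fun R' hR' h => settled_of_card_five hc ?_
      exact ⟨⟨b, mb, c, mc, hR' h1⟩, Or.inl (dull_of_cherry (v := b) (x := c) (y := d) (z := e)
        (w := a) (by grind) mb me ma heb.symm hab.symm (hR' h1) (hR' h2) h)⟩
  -- Taking `b d` creates two disjoint edges; two different edges at `e` then serve as the pending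
  -- pair.
  · refine answerable_of_pair hbd h2 fun R' hR' h => settled_of_card_five hc ?_
    obtain ⟨u, hu, v, hv, huv, hux, hvx, hue, hve⟩ :
        ∃ u ∈ S, ∃ v ∈ S, u ≠ v ∧ u ≠ x ∧ v ≠ x ∧ e ≠ u ∧ e ≠ v := by
      by_cases hax : a = x
      · exact ⟨b, mb, c, mc, hbc, by grind, by grind, heb, hec⟩
      by_cases hbx : b = x
      · exact ⟨a, ma, c, mc, hac, by grind, by grind, hea, hec⟩
      · exact ⟨a, ma, b, mb, hab, by grind, by grind, hea, heb⟩
    exact settled5_of_two ⟨a, ma, c, mc, hR' h1⟩ me hu me hv hue hve (hG u hux) (hG v hvx)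
      (by grind)
      (fun R'' hR'' h'' => hspoke R'' (hR'.trans hR'') (hR'' (hR' h1)) (hR'' h) u hu h'')
      (fun R'' hR'' h'' => hspoke R'' (hR'.trans hR'') (hR'' (hR' h1)) (hR'' h) v hv h'')

/-- Joining a component `{a, b, c}` with a component `{d, e}` by an edge at `d`. -/
theorem answerable_three_two {G R : SimpleGraph V} {S : Finset V} {a b c d e x : V}
    (hS : S = {a, b, c, d, e}) (hc : S.card = 5) (hd3 : a ≠ b ∧ a ≠ c ∧ b ≠ c)
    (hd : d ≠ a ∧ d ≠ b ∧ d ≠ c) (he : e ≠ a ∧ e ≠ b ∧ e ≠ c)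
    (hGe : ¬ G.Adj e a ∧ ¬ G.Adj e b ∧ ¬ G.Adj e c) (hGd : ∀ u, u ≠ x → u ≠ e → ¬ G.Adj d u)
    (hbc : R.Adj b c) : Answerable G R S := by
  obtain ⟨hab, hac, hbc'⟩ := hd3
  obtain ⟨hda, hdb, hdc⟩ := hd
  obtain ⟨hea, heb, hec⟩ := he
  obtain ⟨ga, gb, gc⟩ := hGe
  have m : ∀ u, u ∈ S ↔ u = a ∨ u = b ∨ u = c ∨ u = d ∨ u = e := by
    intro u; rw [hS]; simp
  have ma : a ∈ S := by rw [m]; simp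
  have mb : b ∈ S := by rw [m]; simp
  have mc : c ∈ S := by rw [m]; simp
  have md : d ∈ S := by rw [m]; simp
  have me : e ∈ S := by rw [m]; simp
  by_cases hax : a = x
  · refine answerable_of_pair hea ga fun R' hR' h => settled_of_card_five hc ?_
    refine settled5_of_two ⟨b, mb, c, mc, hR' hbc⟩ md mb md mc hdb hdc (hGd b (by grind) (by grind))
      (hGd c (by grind) (by grind)) (by grind) ?_ ?_
    · intro R'' hR'' h''
      exact dull_of_cherry (v := b) (x := c) (y := d) (z := e) (w := a) (by grind) mb me ma
        heb.symm hab.symm (hR'' (hR' hbc)) h''.symm (hR'' h)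
    · intro R'' hR'' h''
      exact dull_of_cherry (v := c) (x := b) (y := d) (z := e) (w := a) (by grind) mc me ma
        hec.symm hac.symm (hR'' (hR' hbc)).symm h''.symm (hR'' h)
  · refine answerable_of_pair hda (hGd a hax (by grind)) fun R' hR' h =>
      settled_of_card_five hc ?_
    refine settled5_of_two ⟨b, mb, c, mc, hR' hbc⟩ me mb me mc heb hec gb gc (by grind) ?_ ?_
    · intro R'' hR'' h''
      exact dull_of_cherry (v := b) (x := c) (y := e) (z := d) (w := a) (by grind) mb md ma
        hdb.symm hab.symm (hR'' (hR' hbc)) h''.symm (hR'' h)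
    · intro R'' hR'' h''
      exact dull_of_cherry (v := c) (x := b) (y := e) (z := d) (w := a) (by grind) mc md ma
        hdc.symm hac.symm (hR'' (hR' hbc)).symm h''.symm (hR'' h)

end

end ConstructorBlocker

-- Blocker's replies in large components that already have a four-cycle

namespace ConstructorBlocker

variable {V : Type*}

section

open Classical

theorem settled_of_hasC4 {G R : SimpleGraph V} {S : Finset V} (hc : 6 ≤ S.card) (h4 : HasC4 G S)
    (h : SettledC4 G R S) : Settled G R S where
  three := by omega
  four := by omega
  five := by omega
  hasC4 _ _ := h
  six _ h := absurd h4 h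
  seven _ h := absurd h4 h

theorem settled_of_not_hasC4 {G R : SimpleGraph V} {S : Finset V} (hc : 6 ≤ S.card)
    (h4 : ¬ HasC4 G S)
    (h6 : S.card = 6 → ∀ a c a' c', LiveHub G R S a c → LiveHub G R S a' c' → s(a, c) = s(a', c'))
    (h7 : 7 ≤ S.card → ∀ a c, ¬ LiveHub G R S a c) : Settled G R S where
  three := by omega
  four := by omega
  five := by omega
  hasC4 _ h := absurd h h4
  six h _ := h6 h
  seven h _ := h7 h

theorem disjoint_of_free {G R : SimpleGraph V} (hR : ∀ u v, G.Adj u v → ¬ R.Adj u v) {x y : V}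
    (hxy : FreePair G R x y) : ∀ u v, (addEdge G x y).Adj u v → ¬ R.Adj u v := by
  intro u v huv h
  exact disjoint_addEdge (G := R) (R := G) (fun u v h h' => hR u v h' h) hxy.2.2 u v h huv

/-- Constructor completes at most one unfinished triple, since two would share the free pair `x y`.
Blocker answers by spoiling another unfinished triple, which preserves both sum and parity in the
worst case. -/
theorem answerable_inner_of_hasC4 {G R : SimpleGraph V} {S : Finset V} {x y : V}
    (hG' : PathSixFree (addEdge G x y)) (hR : ∀ u v, G.Adj u v → ¬ R.Adj u v)
    (hxy : FreePair G R x y) (hc : 6 ≤ S.card) (h4 : HasC4 G S) (h : SettledC4 G R S) :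
    Answerable (addEdge G x y) R S := by
  have hdis := disjoint_of_free hR hxy
  have h4' : HasC4 (addEdge G x y) S := by
    obtain ⟨a, b, c, d, ha, hb, hc, hd, h⟩ := h4
    exact ⟨a, b, c, d, ha, hb, hc, hd, h.mono le_addEdge⟩
  have hPs : potential (addEdge G x y) R S ⊆ potential G R S := potential_subset le_addEdge le_rfl
  have hP := Finset.card_le_card hPs
  rcases h with h | ⟨h, hD⟩
  · exact Or.inl (settled_of_hasC4 hc h4' (Or.inl (by omega)))
  have hTs : trianglesIn G S ⊆ trianglesIn (addEdge G x y) S := trianglesIn_mono le_addEdge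
  have hTP' := trianglesIn_subset_potential (S := S) hG' hdis
  have hTP'c := Finset.card_le_card hTP'
  have hTP := Finset.card_le_card
    (trianglesIn_subset_potential (S := S) (hG'.mono le_addEdge) hR)
  have hnew : ∀ τ ∈ trianglesIn (addEdge G x y) S, τ ∉ trianglesIn G S → x ∈ τ ∧ y ∈ τ := by
    intro τ hτ hτ'
    rw [mem_trianglesIn] at hτ hτ'
    by_contra hno
    refine hτ' ⟨hτ.1, hτ.2.1, fun u hu v hv huv => ?_⟩
    have := hτ.2.2 hu hv huv
    rw [addEdge_adj] at this
    rcases this with h | ⟨⟨rfl, rfl⟩ | ⟨rfl, rfl⟩, -⟩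
    · exact h
    · exact absurd ⟨hu, hv⟩ hno
    · exact absurd ⟨hv, hu⟩ hno
  have hone : (trianglesIn (addEdge G x y) S \ trianglesIn G S).card ≤ 1 := by
    rw [Finset.card_le_one]
    intro τ hτ τ' hτ'
    rw [Finset.mem_sdiff] at hτ hτ'
    by_contra hne
    have m := hnew τ hτ.1 hτ.2
    have m' := hnew τ' hτ'.1 hτ'.2
    exact hD τ (hPs (hTP' hτ.1)) hτ.2 τ' (hPs (hTP' hτ'.1)) hτ'.2 hne x y m.1 m.2 m'.1 m'.2 hxy
  rw [Finset.card_sdiff_of_subset hTs] at hone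
  have hTc := Finset.card_le_card hTs
  by_cases hN : potential (addEdge G x y) R S ⊆ trianglesIn (addEdge G x y) S
  · have := Finset.card_le_card hN
    -- No unfinished triple is left. The parity term pays for the last one when their number was
    -- odd.
    refine Or.inl (settled_of_hasC4 hc h4' (Or.inl ?_))
    omega
  · obtain ⟨τ, hτ, hτT⟩ := Finset.not_subset.mp hN
    have hm := mem_potential.mp hτ
    have hex : ∃ u ∈ τ, ∃ v ∈ τ, u ≠ v ∧ ¬ (addEdge G x y).Adj u v := by
      by_contra! hno
      exact hτT (mem_trianglesIn.mpr ⟨hm.1, hm.2.1, fun u hu v hv huv => hno u hu v hv huv⟩)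
    obtain ⟨u, hu, v, hv, huv, hadj⟩ := hex
    refine Or.inr ⟨u, v, ⟨huv, hadj, hm.2.2.1 u hu v hv⟩, settled_of_hasC4 hc h4' (Or.inr ?_)⟩
    have hP2s : potential (addEdge G x y) (addEdge R u v) S ⊆
        (potential (addEdge G x y) R S).erase τ := by
      intro σ hσ
      rw [Finset.mem_erase]
      refine ⟨?_, potential_subset le_rfl le_addEdge hσ⟩
      rintro rfl
      exact (mem_potential.mp hσ).2.2.1 u hu v hv (addEdge_adj.mpr (by simp [huv]))
    have hP2 := Finset.card_le_card hP2s
    rw [Finset.card_erase_of_mem hτ] at hP2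
    have hpos := Finset.card_pos.mpr ⟨τ, hτ⟩
    have hTP2 := Finset.card_le_card
      (trianglesIn_subset_potential (S := S) hG' (disjoint_addEdge hdis hadj))
    refine ⟨by omega, fun σ hσ hσT σ' hσ' hσT' hne p q h1 h2 h3 h4 hf => ?_⟩
    have s1 := hPs (Finset.mem_of_mem_erase (hP2s hσ))
    have s2 := hPs (Finset.mem_of_mem_erase (hP2s hσ'))
    exact hD σ s1 (fun h => hσT (hTs h)) σ' s2 (fun h => hσT' (hTs h)) hne p q h1 h2 h3 h4
      ⟨hf.1, fun h => hf.2.1 (le_addEdge h), fun h => hf.2.2 (le_addEdge h)⟩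

theorem exists_off {S : Finset V} (hc : 5 ≤ S.card) (a b c d : V) : ∃ e ∈ S, Off a b c d e := by
  by_contra! hno
  have hsub : S ⊆ {a, b, c, d} := by
    intro x hx
    have := hno x hx
    unfold Off at this
    simp only [Finset.mem_insert, Finset.mem_singleton]
    tauto
  have := Finset.card_le_card hsub
  have : ({a, b, c, d} : Finset V).card ≤ 4 := Finset.card_le_four
  omega

theorem exists_off_ne {S : Finset V} (hc : 6 ≤ S.card) (a b c d x : V) :
    ∃ y ∈ S, Off a b c d y ∧ y ≠ x := by
  have : 5 ≤ (S.erase x).card := by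
    have := Finset.pred_card_le_card_erase (s := S) (a := x)
    omega
  obtain ⟨y, hy, hoff⟩ := exists_off this a b c d
  rw [Finset.mem_erase] at hy
  exact ⟨y, hy.2, hoff, hy.1⟩

/-- A new vertex `y` attached at `x` to a component with a cycle of length four can only form the
triangle with `x` and the vertex opposite to `x` on the cycle. -/
theorem exists_opposite {G R : SimpleGraph V} {S : Finset V} {x y : V} (hG : PathSixFree G)
    (hS' : IsComp G (insert y S)) (hc : 5 ≤ S.card) (hy : y ∉ S) (hxS : x ∈ S) (hyx : G.Adj y x)
    (h4 : HasC4 G S) : ∃ c ∈ S, c ≠ x ∧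
      ∀ τ ∈ potential G R (insert y S), y ∈ τ → τ = {y, x, c} := by
  have hne : ∀ u ∈ S, y ≠ u := fun u hu h => hy (h ▸ hu)
  have hlabel : ∃ b c d, b ∈ S ∧ c ∈ S ∧ d ∈ S ∧ IsC4 G x b c d := by
    obtain ⟨a, b, c, d, ha, hb, hcS, hd, h⟩ := h4
    by_cases hxo : Off a b c d x
    · exfalso
      have hyo : Off a b c d y := ⟨hne a ha, hne b hb, hne c hcS, hne d hd⟩
      rcases h.dominates hG hS' (Finset.mem_insert_of_mem ha) x (Finset.mem_insert_of_mem hxS) hxo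
        with h' | h' | h' | h'
      · exact h.not_far hG hxo hyo h' hyx
      · exact h.rotate.not_far hG hxo.rotate hyo.rotate h' hyx
      · exact h.rotate.rotate.not_far hG hxo.rotate.rotate hyo.rotate.rotate h' hyx
      · exact h.rotate.rotate.rotate.not_far hG hxo.rotate.rotate.rotate hyo.rotate.rotate.rotate
          h' hyx
    · have : x = a ∨ x = b ∨ x = c ∨ x = d := by
        unfold Off at hxo; tauto
      rcases this with rfl | rfl | rfl | rfl
      · exact ⟨b, c, d, hb, hcS, hd, h⟩
      · exact ⟨c, d, a, hcS, hd, ha, h.rotate⟩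
      · exact ⟨d, a, b, hd, ha, hb, h.rotate.rotate⟩
      · exact ⟨a, b, c, ha, hb, hcS, h.rotate.rotate.rotate⟩
  obtain ⟨b, c, d, hb, hcS, hd, h⟩ := hlabel
  refine ⟨c, hcS, h.ac.symm, fun τ hτ hyτ => ?_⟩
  obtain ⟨hsub, hcard, -, hK⟩ := mem_potential.mp hτ
  have hyo : Off x b c d y := ⟨hne x hxS, hne b hb, hne c hcS, hne d hd⟩
  obtain ⟨e, heS, heo⟩ := exists_off hc x b c d
  -- The further off-cycle vertex `e` hangs somewhere on the cycle; wherever that is, an edge from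
  -- `y` to `b` or `d` would give two off-cycle vertices at consecutive cycle vertices.
  have hye : y ≠ e := hne e heS
  have he := h.dominates hG hS' (Finset.mem_insert_of_mem hxS) e (Finset.mem_insert_of_mem heS) heo
  set K := G ⊔ cliqueOn τ with hKdef
  have hle : G ≤ K := le_sup_left
  have hKc : IsC4 K x b c d := h.mono hle
  have hKyx : K.Adj y x := hle hyx
  have heK : K.Adj e x ∨ K.Adj e b ∨ K.Adj e c ∨ K.Adj e d := by
    rcases he with h | h | h | h
    · exact Or.inl (hle h)
    · exact Or.inr (Or.inl (hle h))
    · exact Or.inr (Or.inr (Or.inl (hle h)))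
    · exact Or.inr (Or.inr (Or.inr (hle h)))
  have hsub' : τ ⊆ {y, x, c} := by
    intro z hz
    by_contra hzn
    simp only [Finset.mem_insert, Finset.mem_singleton, not_or] at hzn
    obtain ⟨hzy, hzx, hzc⟩ := hzn
    have hKyz : K.Adj y z := Or.inr ⟨hyτ, hz, Ne.symm hzy⟩
    by_cases hzo : Off x b c d z
    · exact hKc.not_far hK hyo hzo hKyx hKyz.symm
    · have hz' : z = b ∨ z = d := by
        unfold Off at hzo; tauto
      rcases hz' with rfl | rfl
      · rcases heK with h' | h' | h' | h'
        · exact hKc.not_adjacent hK heo hyo hye.symm h' hKyz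
        · exact hKc.not_adjacent hK hyo heo hye hKyx h'
        · exact hKc.rotate.not_adjacent hK hyo.rotate heo.rotate hye hKyz h'
        · exact hKc.rotate.rotate.rotate.not_adjacent hK heo.rotate.rotate.rotate
            hyo.rotate.rotate.rotate hye.symm h' hKyx
      · rcases heK with h' | h' | h' | h'
        · exact hKc.rotate.rotate.rotate.not_adjacent hK hyo.rotate.rotate.rotate
            heo.rotate.rotate.rotate hye hKyz h'
        · exact hKc.not_adjacent hK hyo heo hye hKyx h'
        · exact hKc.rotate.rotate.not_adjacent hK heo.rotate.rotate hyo.rotate.rotate hye.symm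
            h' hKyz
        · exact hKc.rotate.rotate.rotate.not_adjacent hK heo.rotate.rotate.rotate
            hyo.rotate.rotate.rotate hye.symm h' hKyx
  exact Finset.eq_of_subset_of_card_le hsub' (by rw [hcard]; exact Finset.card_le_three)

/-- The vertex `y` contributes a single potential triple {y, x, c}. From five to six vertices
Blocker tolerates it, as a dull set has at most two others and 3 = 6/2. From six on he removes it by
taking `c y`. -/
theorem answerable_join_of_hasC4 {G R : SimpleGraph V} {S : Finset V} {x y : V}
    (hG' : PathSixFree (addEdge G x y)) (hR : ∀ u v, G.Adj u v → ¬ R.Adj u v)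
    (hxy : FreePair G R x y) (hS' : IsComp (addEdge G x y) (insert y S)) (hc : 5 ≤ S.card)
    (hy : y ∉ S) (hxS : x ∈ S) (hyG : ∀ u, ¬ G.Adj y u) (h4 : HasC4 G S) (h : Settled G R S) :
    Answerable (addEdge G x y) R (insert y S) := by
  have hdis := disjoint_of_free hR hxy
  have h4' : HasC4 (addEdge G x y) S := by
    obtain ⟨a, b, c, d, ha, hb, hc, hd, h⟩ := h4
    exact ⟨a, b, c, d, ha, hb, hc, hd, h.mono le_addEdge⟩
  have h4i : HasC4 (addEdge G x y) (insert y S) := by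
    obtain ⟨a, b, c, d, ha, hb, hc, hd, h⟩ := h4'
    exact ⟨a, b, c, d, by simp [ha], by simp [hb], by simp [hc], by simp [hd], h⟩
  have hyx : (addEdge G x y).Adj y x := addEdge_adj.mpr (by simp [hxy.1])
  have hcard : (insert y S).card = S.card + 1 := Finset.card_insert_of_notMem hy
  have hyN : ∀ u, u ≠ x → ¬ (addEdge G x y).Adj y u := by
    intro u hu h
    rw [addEdge_adj] at h
    have := hyG u
    have := hxy.1
    grind
  obtain ⟨c, hcS, hcx, hopp⟩ := exists_opposite (R := R) hG' hS' hc hy hxS hyx h4'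
  have hcy : c ≠ y := fun h => hy (h ▸ hcS)
  rcases Nat.lt_or_ge S.card 6 with h5 | h6
  · have h5 : S.card = 5 := by omega
    have key : ∀ R', R ≤ R' → Dull R' S → Settled (addEdge G x y) R' (insert y S) := by
      intro R' hR' hd
      refine settled_of_hasC4 (by omega) h4i (Or.inl ?_)
      have hsub : potential (addEdge G x y) R' (insert y S) ⊆
          insert {y, x, c} (potential (addEdge G x y) R' S) := by
        intro τ hτ
        rw [Finset.mem_insert]
        by_cases hyτ : y ∈ τ
        · exact Or.inl (hopp τ (potential_subset le_rfl hR' hτ) hyτ)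
        · right
          rw [mem_potential] at hτ ⊢
          exact ⟨(Finset.subset_insert_iff_of_notMem hyτ).mp hτ.1, hτ.2⟩
      have h1 := Finset.card_le_card hsub
      have h2 := Finset.card_insert_le {y, x, c} (potential (addEdge G x y) R' S)
      have h3 := dull_bound (G := addEdge G x y) h5 hd
      omega
    obtain ⟨-, hd | ⟨p, hp, q, hq, -, -, -, -, hf, -, -, hd, -⟩⟩ := h.five h5
    · exact Or.inl (key R le_rfl hd)
    · refine Or.inr ⟨p, q, ⟨hf.1, ?_, hf.2.2⟩, key _ le_addEdge hd⟩
      rw [addEdge_adj]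
      have := hf.2.1
      grind
  · have hyc : ¬ (addEdge G x y).Adj c y := fun h => hyN c hcx h.symm
    have key : ∀ R', R ≤ R' → R'.Adj c y → (∀ u v, (addEdge G x y).Adj u v → ¬ R'.Adj u v) →
        Settled (addEdge G x y) R' (insert y S) := by
      intro R' hR' hcy' hdis'
      refine settled_of_hasC4 (by omega) h4i ?_
      have hPs : potential (addEdge G x y) R' (insert y S) ⊆ potential G R S := by
        intro τ hτ
        by_cases hyτ : y ∈ τ
        · have := hopp τ (potential_subset le_rfl hR' hτ) hyτ
          exact absurd hcy' ((mem_potential.mp hτ).2.2.1 c (by simp [this]) y hyτ)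
        · apply potential_subset (G := G) (G' := addEdge G x y) le_addEdge hR'
          rw [mem_potential] at hτ ⊢
          exact ⟨(Finset.subset_insert_iff_of_notMem hyτ).mp hτ.1, hτ.2⟩
      have hTP := trianglesIn_subset_potential (S := insert y S) hG' hdis'
      have hT : trianglesIn (addEdge G x y) (insert y S) = trianglesIn G S := by
        ext τ
        constructor
        · intro hτ
          have hs := (mem_potential.mp (hPs (hTP hτ))).1
          rw [mem_trianglesIn] at hτ ⊢
          refine ⟨hs, hτ.2.1, fun u hu v hv huv => ?_⟩
          have := hτ.2.2 hu hv huv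
          have hyτ : y ∉ τ := fun h => hy (hs h)
          rw [addEdge_adj] at this
          grind
        · intro hτ
          rw [mem_trianglesIn] at hτ ⊢
          exact ⟨hτ.1.trans (Finset.subset_insert _ _), hτ.2.1, hτ.2.2.mono le_addEdge⟩
      have hP := Finset.card_le_card hPs
      have hTPc := Finset.card_le_card hTP
      rw [hT] at hTPc
      rcases h.hasC4 h6 h4 with h | ⟨h, hD⟩
      · left; omega
      · right
        rw [hT]
        refine ⟨by omega, fun τ hτ hτT τ' hτ' hτT' hne p q h1 h2 h3 h4 hf => ?_⟩
        exact hD τ (hPs hτ) hτT τ' (hPs hτ') hτT' hne p q h1 h2 h3 h4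
          ⟨hf.1, fun h => hf.2.1 (le_addEdge h), fun h => hf.2.2 (hR' h)⟩
    by_cases hR' : R.Adj c y
    · exact Or.inl (key R le_rfl hR' hdis)
    · exact Or.inr ⟨c, y, ⟨hcy, hyc, hR'⟩, key _ le_addEdge
        (addEdge_adj.mpr (by simp [hcy])) (disjoint_addEdge hdis hyc)⟩

end

end ConstructorBlocker

-- Blocker's reply to the creation of a four-cycle

namespace ConstructorBlocker

variable {V : Type*}

section

open Classical

theorem isC4_of_not_mem {G : SimpleGraph V} {x y a b c d : V} (h : IsC4 (addEdge G x y) a b c d)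
    (h1 : s(a, b) ≠ s(x, y)) (h2 : s(b, c) ≠ s(x, y)) (h3 : s(c, d) ≠ s(x, y))
    (h4 : s(d, a) ≠ s(x, y)) : IsC4 G a b c d := by
  have key : ∀ u v, (addEdge G x y).Adj u v → s(u, v) ≠ s(x, y) → G.Adj u v := by
    intro u v huv hne
    rw [addEdge_adj] at huv
    exact huv.resolve_right fun h => hne (Sym2.eq_iff.mpr h.1)
  exact ⟨key _ _ h.ab h1, key _ _ h.bc h2, key _ _ h.cd h3, key _ _ h.da h4, h.ac, h.bd⟩

/-- Removing an edge from a complete graph on four vertices leaves a cycle of length four. -/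
theorem hasC4_of_diagonals {G : SimpleGraph V} {S : Finset V} {x y a b c d : V} (ha : a ∈ S)
    (hb : b ∈ S) (hc : c ∈ S) (hd : d ∈ S) (h : IsC4 (addEdge G x y) a b c d)
    (hac : (addEdge G x y).Adj a c) (hbd : (addEdge G x y).Adj b d) : HasC4 G S := by
  have e1 : IsC4 (addEdge G x y) a c b d := ⟨hac, h.bc.symm, hbd, h.da, h.ab.ne, h.cd.ne⟩
  have e2 : IsC4 (addEdge G x y) a c d b := ⟨hac, h.cd, hbd.symm, h.ab.symm, h.da.ne', h.bc.ne'⟩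
  have := h.ab.ne; have := h.bc.ne; have := h.cd.ne; have := h.da.ne; have := h.ac; have := h.bd
  by_cases h1 : s(a, b) = s(x, y) ∨ s(c, d) = s(x, y)
  · exact ⟨a, c, b, d, ha, hc, hb, hd, isC4_of_not_mem e1 (by grind) (by grind) (by grind)
      (by grind)⟩
  by_cases h2 : s(b, c) = s(x, y) ∨ s(d, a) = s(x, y)
  · exact ⟨a, c, d, b, ha, hc, hd, hb, isC4_of_not_mem e2 (by grind) (by grind) (by grind)
      (by grind)⟩
  · exact ⟨a, b, c, d, ha, hb, hc, hd, isC4_of_not_mem h (by grind) (by grind) (by grind)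
      (by grind)⟩

/-- If `a` and `c` have three common neighbours, then removing an edge leaves a cycle of length
four. -/
theorem hasC4_of_three {G : SimpleGraph V} {S : Finset V} {x y a b c d w : V} (ha : a ∈ S)
    (hb : b ∈ S) (hc : c ∈ S) (hd : d ∈ S) (hw : w ∈ S) (h : IsC4 (addEdge G x y) a b c d)
    (hoff : Off a b c d w) (hwa : (addEdge G x y).Adj w a) (hwc : (addEdge G x y).Adj w c) :
    HasC4 G S := by
  obtain ⟨hw1, hw2, hw3, hw4⟩ := hoff
  have e1 : IsC4 (addEdge G x y) a b c w := ⟨h.ab, h.bc, hwc.symm, hwa, h.ac, hw2.symm⟩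
  have e2 : IsC4 (addEdge G x y) a d c w := ⟨h.da.symm, h.cd.symm, hwc.symm, hwa, h.ac, hw4.symm⟩
  have := h.ab.ne; have := h.bc.ne; have := h.cd.ne; have := h.da.ne; have := h.ac; have := h.bd
  by_cases h1 : s(a, b) = s(x, y) ∨ s(b, c) = s(x, y)
  · exact ⟨a, d, c, w, ha, hd, hc, hw, isC4_of_not_mem e2 (by grind) (by grind) (by grind)
      (by grind)⟩
  by_cases h2 : s(c, d) = s(x, y) ∨ s(d, a) = s(x, y)
  · exact ⟨a, b, c, w, ha, hb, hc, hw, isC4_of_not_mem e1 (by grind) (by grind) (by grind)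
      (by grind)⟩
  · exact ⟨a, b, c, d, ha, hb, hc, hd, isC4_of_not_mem h (by grind) (by grind) (by grind)
      (by grind)⟩

/-- A potential triple leaving the cycle must contain both hubs `a, c`. If these are not adjacent,
Blocker separates them and at most two triples survive. If they are, he takes `b d`, after which
every potential triple contains `a, c`. -/
theorem answerable_inner_new_C4 {G R : SimpleGraph V} {S : Finset V} {x y : V}
    (hG' : PathSixFree (addEdge G x y)) (hR : ∀ u v, G.Adj u v → ¬ R.Adj u v)
    (hxy : FreePair G R x y) (hS : IsComp (addEdge G x y) S) (hc : 6 ≤ S.card)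
    (h4 : ¬ HasC4 G S) (h4' : HasC4 (addEdge G x y) S) (h : Settled G R S) :
    Answerable (addEdge G x y) R S := by
  have hdis := disjoint_of_free hR hxy
  obtain ⟨a, b, c, d, ha, hb, hcS, hd, hC, hhub⟩ := exists_hubs hG' hS hc h4'
  -- triangles that can still arise
  have hoffτ : ∀ τ ∈ potential (addEdge G x y) R S, ∀ w ∈ τ, Off a b c d w → τ = {w, a, c} := by
    intro τ hτ w hw hwo
    obtain ⟨hsub, hcard, -, hK⟩ := mem_potential.mp hτ
    obtain ⟨w', hw'S, hw'o, hww'⟩ := exists_off_ne hc a b c d w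
    have hKc : IsC4 ((addEdge G x y) ⊔ cliqueOn τ) a b c d := hC.mono le_sup_left
    refine Finset.eq_of_subset_of_card_le ?_ (by rw [hcard]; exact Finset.card_le_three)
    intro z hz
    by_contra hzn
    simp only [Finset.mem_insert, Finset.mem_singleton, not_or] at hzn
    have hwz : ((addEdge G x y) ⊔ cliqueOn τ).Adj w z := Or.inr ⟨hw, hz, Ne.symm hzn.1⟩
    refine hKc.adj_of_off hK hwo hw'o hww'.symm ?_ ?_ hwz (by unfold Off; tauto)
    · exact (hhub w (hsub hw) hwo).imp Or.inl Or.inl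
    · exact (hhub w' hw'S hw'o).imp Or.inl Or.inl
  have hcyc : ∀ τ ∈ potential (addEdge G x y) R S, (∀ w ∈ τ, ¬ Off a b c d w) →
      τ ⊆ {a, b, c, d} := by
    intro τ hτ hno w hw
    have := hno w hw
    unfold Off at this
    simp only [Finset.mem_insert, Finset.mem_singleton]
    tauto
  have hcard4 : ({a, b, c, d} : Finset V).card = 4 := by
    have := hC.ab.ne; have := hC.bc.ne; have := hC.cd.ne; have := hC.da.ne
    have := hC.ac; have := hC.bd
    rw [Finset.card_insert_of_notMem (by grind), Finset.card_insert_of_notMem (by grind),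
      Finset.card_insert_of_notMem (by grind), Finset.card_singleton]
  by_cases hac : (addEdge G x y).Adj a c
  swap
  · refine answerable_of_pair hC.ac hac fun R' hR' hacR => ?_
    refine settled_of_hasC4 hc h4' (Or.inl ?_)
    have := card_le_two_of_pair (T := potential (addEdge G x y) R' S) hcard4 (p := a) (q := c)
      (by
        intro τ hτ
        rw [Finset.mem_powersetCard]
        have hτR := potential_subset le_rfl hR' hτ
        refine ⟨hcyc τ hτR fun w hw hwo => ?_, (mem_potential.mp hτ).2.1⟩
        have := hoffτ τ hτR w hw hwo
        exact (mem_potential.mp hτ).2.2.1 a (by simp [this]) c (by simp [this]) hacR)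
      (by simp) (by simp) (fun τ hτ hm => (mem_potential.mp hτ).2.2.1 a hm.1 c hm.2 hacR)
    omega
  have hbd : ¬ (addEdge G x y).Adj b d := fun hbd =>
    h4 (hasC4_of_diagonals ha hb hcS hd hC hac hbd)
  have key : ∀ R', R ≤ R' → R'.Adj b d → (∀ u v, (addEdge G x y).Adj u v → ¬ R'.Adj u v) →
      Settled (addEdge G x y) R' S := by
    intro R' hR' hbdR hdis'
    have hform : ∀ τ ∈ potential (addEdge G x y) R' S, ∃ w ∈ S, w ≠ a ∧ w ≠ c ∧ τ = {w, a, c} := by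
      intro τ hτ
      have hτR := potential_subset le_rfl hR' hτ
      have hm := mem_potential.mp hτ
      by_cases hno : ∀ w ∈ τ, ¬ Off a b c d w
      · have hsub := hcyc τ hτR hno
        have : ¬ (b ∈ τ ∧ d ∈ τ) := fun h => hm.2.2.1 b h.1 d h.2 hbdR
        have hcases : τ ⊆ {b, a, c} ∨ τ ⊆ {d, a, c} := by
          by_cases hdτ : d ∈ τ
          · right
            intro z hz
            have := hsub hz
            simp only [Finset.mem_insert, Finset.mem_singleton] at this ⊢
            grind
          · left
            intro z hz
            have := hsub hz
            simp only [Finset.mem_insert, Finset.mem_singleton] at this ⊢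
            grind
        rcases hcases with h | h
        · exact ⟨b, hb, hC.ab.ne', hC.bc.ne, Finset.eq_of_subset_of_card_le h
            (by rw [hm.2.1]; exact Finset.card_le_three)⟩
        · exact ⟨d, hd, hC.da.ne, hC.cd.ne', Finset.eq_of_subset_of_card_le h
            (by rw [hm.2.1]; exact Finset.card_le_three)⟩
      · push Not at hno
        obtain ⟨w, hw, hwo⟩ := hno
        exact ⟨w, hm.1 hw, hwo.1, hwo.2.2.1, hoffτ τ hτR w hw hwo⟩
    -- A third common neighbour of `a` and `c` would mean that a 4-cycle existed before this move.
    have hT : (trianglesIn (addEdge G x y) S).card ≤ 2 := by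
      have hsub : trianglesIn (addEdge G x y) S ⊆ {{b, a, c}, {d, a, c}} := by
        intro τ hτ
        obtain ⟨w, hw, hwa, hwc, rfl⟩ := hform τ (trianglesIn_subset_potential hG' hdis' hτ)
        have hcl := (mem_trianglesIn.mp hτ).2.2
        have h1 : (addEdge G x y).Adj w a := hcl (by simp) (by simp) hwa
        have h2 : (addEdge G x y).Adj w c := hcl (by simp) (by simp) hwc
        simp only [Finset.mem_insert, Finset.mem_singleton]
        by_cases hwb : w = b
        · left; rw [hwb]
        by_cases hwd : w = d
        · right; rw [hwd]
        · exact absurd (hasC4_of_three ha hb hcS hd hw hC ⟨hwa, hwb, hwc, hwd⟩ h1 h2) h4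
      exact (Finset.card_le_card hsub).trans Finset.card_le_two
    have hTP := Finset.card_le_card (trianglesIn_subset_potential (S := S) hG' hdis')
    have himage : ∀ X : Finset V, (∀ w ∈ S, w ≠ a → w ≠ c →
        {w, a, c} ∈ potential (addEdge G x y) R' S → w ∈ X) →
        (potential (addEdge G x y) R' S).card ≤ X.card := by
      intro X hX
      refine (Finset.card_le_card (t := X.image fun w => {w, a, c}) ?_).trans
        Finset.card_image_le
      intro τ hτ
      obtain ⟨w, hw, hwa, hwc, rfl⟩ := hform τ hτ
      exact Finset.mem_image_of_mem _ (hX w hw hwa hwc hτ)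
    have hX2 : ((S.erase a).erase c).card = S.card - 2 := by
      rw [Finset.card_erase_of_mem (Finset.mem_erase.mpr ⟨hC.ac.symm, hcS⟩),
        Finset.card_erase_of_mem ha]
      omega
    have hP2 := himage ((S.erase a).erase c) (fun w hw hwa hwc _ =>
      Finset.mem_erase.mpr ⟨hwc, Finset.mem_erase.mpr ⟨hwa, hw⟩⟩)
    -- Before the move `a c` was already a hub edge, hence dead, so one of the |S| - 2 triples is
    -- blocked.
    have hP3 : 7 ≤ S.card → (potential (addEdge G x y) R' S).card ≤ S.card - 3 := by
      intro h7
      have hHub : Hub G S a c := by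
        refine ⟨ha, hcS, ?_, ?_⟩
        · by_contra hac'
          rw [addEdge_adj] at hac
          have hac := Sym2.eq_iff.mpr (hac.resolve_left hac').1
          have := hC.ab.ne; have := hC.bc.ne; have := hC.cd.ne; have := hC.da.ne
          have := hC.ac; have := hC.bd
          exact h4 ⟨a, b, c, d, ha, hb, hcS, hd, isC4_of_not_mem hC (by grind) (by grind)
            (by grind) (by grind)⟩
        · intro u hu v hv huv
          by_contra hno
          simp only [not_or] at hno
          obtain ⟨hua, huc, hva, hvc⟩ := hno
          have huv' := (le_addEdge (x := x) (y := y)) huv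
          have hoff : ∀ u ∈ S, ∀ v, (addEdge G x y).Adj u v → v ≠ a → v ≠ c →
              ¬ Off a b c d u := by
            intro u hu v huv hva hvc huo
            obtain ⟨w', hw'S, hw'o, hww'⟩ := exists_off_ne hc a b c d u
            exact hC.adj_of_off hG' huo hw'o hww'.symm (hhub u hu huo) (hhub w' hw'S hw'o) huv
              (by unfold Off; tauto)
          have h1 := hoff u hu v huv' hva hvc
          have h2 := hoff v hv u huv'.symm hua huc
          unfold Off at h1 h2
          have h1' : u = b ∨ u = d := by tauto
          have h2' : v = b ∨ v = d := by tauto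
          rcases h1' with rfl | rfl <;> rcases h2' with rfl | rfl
          · exact huv.ne rfl
          · exact hbd huv'
          · exact hbd huv'.symm
          · exact huv.ne rfl
      have hdead : Dead G R S a c := by
        by_contra hnd
        exact h.seven h7 h4 a c ⟨hHub, hnd⟩
      obtain ⟨w, hw, hwa, hwc, hwR⟩ := hdead
      have := himage (((S.erase a).erase c).erase w) (by
        intro z hz hza hzc hzP
        rw [Finset.mem_erase]
        refine ⟨?_, Finset.mem_erase.mpr ⟨hzc, Finset.mem_erase.mpr ⟨hza, hz⟩⟩⟩
        rintro rfl
        have hnR := (mem_potential.mp hzP).2.2.1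
        rcases hwR with ⟨-, hr⟩ | ⟨-, hr⟩
        · exact hnR c (by simp) z (by simp) (hR' hr)
        · exact hnR a (by simp) z (by simp) (hR' hr))
      rw [Finset.card_erase_of_mem (Finset.mem_erase.mpr ⟨hwc, Finset.mem_erase.mpr ⟨hwa, hw⟩⟩),
        hX2] at this
      omega
    refine settled_of_hasC4 hc h4' (Or.inr ⟨?_, ?_⟩)
    -- With T ≤ 2: from seven vertices on, P ≤ |S| - 3 leaves room for the parity term; for six
    -- vertices, P ≤ 4 suffices because T = 2, P = 4 has even difference.
    · by_cases h7 : 7 ≤ S.card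
      · have := hP3 h7
        omega
      · omega
    -- Two such triples have only the pair `a, c` in common, and Constructor owns it.
    · intro τ hτ _ τ' hτ' _ hne u v hu hv hu' hv' hf
      obtain ⟨w, hw, hwa, hwc, rfl⟩ := hform τ hτ
      obtain ⟨w', hw', hwa', hwc', rfl⟩ := hform τ' hτ'
      have hww : w ≠ w' := fun h => hne (by rw [h])
      have huv := hf.1
      have hnadj := hf.2.1
      have hsym : (addEdge G x y).Adj c a := hac.symm
      simp only [Finset.mem_insert, Finset.mem_singleton] at hu hv hu' hv'
      grind
  by_cases hbdR : R.Adj b d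
  · exact Or.inl (key R le_rfl hbdR hdis)
  · exact Or.inr ⟨b, d, ⟨hC.bd, hbd, hbdR⟩, key _ le_addEdge
      (addEdge_adj.mpr (by simp [hC.bd])) (disjoint_addEdge hdis hbd)⟩

end

end ConstructorBlocker

-- Blocker's replies in large components without a four-cycle: hub edges

namespace ConstructorBlocker

variable {V : Type*}

section

open Classical

theorem LiveHub.symm {G R : SimpleGraph V} {S : Finset V} {a c : V} (h : LiveHub G R S a c) :
    LiveHub G R S c a := by
  obtain ⟨⟨ha, hc, hac, hcov⟩, hd⟩ := h
  refine ⟨⟨hc, ha, hac.symm, fun u hu v hv huv => ?_⟩, fun ⟨w, hw, hwa, hwc, hd'⟩ =>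
    hd ⟨w, hw, hwc, hwa, hd'.symm⟩⟩
  have := hcov u hu v hv huv
  tauto

theorem liveHub_congr {G R : SimpleGraph V} {S : Finset V} {a c a' c' : V}
    (h : s(a, c) = s(a', c')) (hl : LiveHub G R S a c) : LiveHub G R S a' c' := by
  rcases Sym2.eq_iff.mp h with ⟨rfl, rfl⟩ | ⟨rfl, rfl⟩
  · exact hl
  · exact hl.symm

/-- Blocker can make any live hub edge dead. -/
theorem LiveHub.exists_kill {G R : SimpleGraph V} {S : Finset V} {a c : V} (hS : IsComp G S)
    (hc : 6 ≤ S.card) (h4 : ¬ HasC4 G S) (h : LiveHub G R S a c) :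
    ∃ p q, FreePair G R p q ∧ ¬ LiveHub G (addEdge R p q) S a c := by
  obtain ⟨⟨ha, hcS, hac, hcov⟩, hd⟩ := h
  have hnb : ∀ w ∈ S, w ≠ a → w ≠ c → G.Adj w a ∨ G.Adj w c := by
    intro w hw hwa hwc
    obtain ⟨v, hv, hwv⟩ := hS.exists_adj (by omega) hw
    rcases hcov w hw v hv hwv with h | h | h | h
    · exact absurd h hwa
    · exact absurd h hwc
    · exact Or.inl (h ▸ hwv)
    · exact Or.inr (h ▸ hwv)
  -- Two common neighbours of `a` and `c` would form a 4-cycle. So some `w` is adjacent to exactly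
  -- one of them, and its missing edge is free because the hub edge is live.
  have hex : ∃ w ∈ S, w ≠ a ∧ w ≠ c ∧ ¬ (G.Adj w a ∧ G.Adj w c) := by
    by_contra! hno
    obtain ⟨u, hu, huo⟩ := exists_off (S := S) (by omega) a a c c
    obtain ⟨v, hv, hvo, hvu⟩ := exists_off_ne hc a a c c u
    have h1 := hno u hu huo.1 huo.2.2.1
    have h2 := hno v hv hvo.1 hvo.2.2.1
    exact h4 ⟨a, u, c, v, ha, hu, hcS, hv, h1.1.symm, h1.2, h2.2.symm, h2.1, hac.ne, hvu.symm⟩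
  obtain ⟨w, hw, hwa, hwc, hw2⟩ := hex
  rcases hnb w hw hwa hwc with h | h
  · refine ⟨c, w, ⟨hwc.symm, fun h' => hw2 ⟨h, h'.symm⟩, fun h' => hd ⟨w, hw, hwa, hwc,
      Or.inl ⟨h, h'⟩⟩⟩, fun hl => hl.2 ⟨w, hw, hwa, hwc, Or.inl ⟨h, ?_⟩⟩⟩
    exact addEdge_adj.mpr (by simp [hwc.symm])
  · refine ⟨a, w, ⟨hwa.symm, fun h' => hw2 ⟨h'.symm, h⟩, fun h' => hd ⟨w, hw, hwa, hwc,
      Or.inr ⟨h, h'⟩⟩⟩, fun hl => hl.2 ⟨w, hw, hwa, hwc, Or.inr ⟨h, ?_⟩⟩⟩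
    exact addEdge_adj.mpr (by simp [hwa.symm])

theorem answerable_of_forall_live {G R : SimpleGraph V} {S : Finset V} {x y : V}
    (hS : IsComp G S) (hc : 6 ≤ S.card) (h4 : ¬ HasC4 G S)
    (h : ∀ a c, LiveHub G R S a c → s(a, c) = s(x, y)) : Answerable G R S := by
  by_cases hl : LiveHub G R S x y
  · obtain ⟨p, q, hf, hk⟩ := hl.exists_kill hS hc h4
    have hno : ∀ a c, ¬ LiveHub G (addEdge R p q) S a c := fun a c hac =>
      hk (liveHub_congr (h a c (hac.of_le le_addEdge)) hac)
    exact Or.inr ⟨p, q, hf, settled_of_not_hasC4 hc h4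
      (fun _ a c _ _ hac => absurd hac (hno a c)) (fun _ => hno)⟩
  · have hno : ∀ a c, ¬ LiveHub G R S a c := fun a c hac => hl (liveHub_congr (h a c hac) hac)
    exact Or.inl (settled_of_not_hasC4 hc h4
      (fun _ a c _ _ hac => absurd hac (hno a c)) (fun _ => hno))

/-- Adding an edge makes it harder to be a hub edge and easier to be dead, so the new edge is the
only possible new live one. -/
theorem LiveHub.of_addEdge {G R : SimpleGraph V} {S : Finset V} {x y a c : V}
    (h : LiveHub (addEdge G x y) R S a c) : LiveHub G R S a c ∨ s(a, c) = s(x, y) := by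
  obtain ⟨⟨ha, hc, hac, hcov⟩, hd⟩ := h
  by_cases hac' : G.Adj a c
  · refine Or.inl ⟨⟨ha, hc, hac', fun u hu v hv huv => hcov u hu v hv (le_addEdge huv)⟩,
      fun ⟨w, hw, hwa, hwc, hd'⟩ => hd ⟨w, hw, hwa, hwc, ?_⟩⟩
    exact hd'.imp (fun h => ⟨le_addEdge h.1, h.2⟩) (fun h => ⟨le_addEdge h.1, h.2⟩)
  · right
    rw [addEdge_adj] at hac
    exact Sym2.eq_iff.mpr (hac.resolve_left hac').1

theorem answerable_inner_of_not_hasC4 {G R : SimpleGraph V} {S : Finset V} {x y : V}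
    (hS : IsComp (addEdge G x y) S) (hc : 6 ≤ S.card) (h4 : ¬ HasC4 (addEdge G x y) S)
    (h : Settled G R S) : Answerable (addEdge G x y) R S := by
  have h4' : ¬ HasC4 G S := by
    rintro ⟨a, b, c, d, ha, hb, hc, hd, h⟩
    exact h4 ⟨a, b, c, d, ha, hb, hc, hd, h.mono le_addEdge⟩
  rcases Nat.lt_or_ge S.card 7 with h6 | h7
  · have h6 : S.card = 6 := by omega
    by_cases hl : LiveHub (addEdge G x y) R S x y
    · obtain ⟨p, q, hf, hk⟩ := hl.exists_kill hS hc h4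
      refine Or.inr ⟨p, q, hf, settled_of_not_hasC4 hc h4 (fun _ a c a' c' h1 h2 => ?_)
        (by omega)⟩
      have key : ∀ a c, LiveHub (addEdge G x y) (addEdge R p q) S a c → LiveHub G R S a c := by
        intro a c hac
        rcases (hac.of_le le_addEdge).of_addEdge with h | h
        · exact h
        · exact absurd (liveHub_congr h hac) hk
      exact h.six h6 h4' a c a' c' (key a c h1) (key a' c' h2)
    · refine Or.inl (settled_of_not_hasC4 hc h4 (fun _ a c a' c' h1 h2 => ?_) (by omega))
      have key : ∀ a c, LiveHub (addEdge G x y) R S a c → LiveHub G R S a c := by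
        intro a c hac
        rcases hac.of_addEdge with h | h
        · exact h
        · exact absurd (liveHub_congr h hac) hl
      exact h.six h6 h4' a c a' c' (key a c h1) (key a' c' h2)
  · exact answerable_of_forall_live hS hc h4 fun a c hac =>
      hac.of_addEdge.resolve_left (h.seven h7 h4' a c)

/-- A hub edge must meet edges on both sides of the bridge `x y`, which only the bridge itself can
do; Blocker has to kill at most this one. -/
theorem answerable_join_large {G R : SimpleGraph V} {S₁ S₂ : Finset V} {x y : V}
    (hS₁ : IsComp G S₁) (hS₂ : IsComp G S₂) (hdisj : Disjoint S₁ S₂) (hx : x ∈ S₁) (hy : y ∈ S₂)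
    (hS : IsComp (addEdge G x y) (S₁ ∪ S₂)) (hc : 6 ≤ (S₁ ∪ S₂).card) (h1 : 2 ≤ S₁.card)
    (h2 : 2 ≤ S₂.card) (h4 : ¬ HasC4 (addEdge G x y) (S₁ ∪ S₂)) :
    Answerable (addEdge G x y) R (S₁ ∪ S₂) := by
  refine answerable_of_forall_live (x := x) (y := y) hS hc h4 fun a c hac => ?_
  obtain ⟨⟨ha, hc, hac, hcov⟩, -⟩ := hac
  rw [Finset.disjoint_left] at hdisj
  obtain ⟨v, hv, hxv⟩ := hS₁.exists_adj h1 hx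
  obtain ⟨w, hw, hyw⟩ := hS₂.exists_adj h2 hy
  have c1 := hcov x (by simp [hx]) v (by simp [hv]) (le_addEdge hxv)
  have c2 := hcov y (by simp [hy]) w (by simp [hw]) (le_addEdge hyw)
  have n1 : ∀ u ∈ S₁, ∀ z ∈ S₂, ¬ G.Adj u z := fun u hu z hz h =>
    hdisj (hS₁.closed u hu z h) hz
  rw [addEdge_adj] at hac
  rcases hac with hac | hac
  · exfalso
    rw [Finset.mem_union] at ha hc
    rcases ha with ha | ha <;> rcases hc with hc | hc
    · have := hdisj ha; have := hdisj hc
      grind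
    · exact n1 a ha c hc hac
    · exact n1 c hc a ha hac.symm
    · have := fun h => hdisj h ha; have := fun h => hdisj h hc
      grind
  · exact Sym2.eq_iff.mpr hac.1

/-- The pendant edge `x y` must meet every hub edge, and `y` is a leaf, so all hub edges contain
`x`. -/
theorem answerable_join_single {G R : SimpleGraph V} {S : Finset V} {x y : V}
    (hR : ∀ u v, G.Adj u v → ¬ R.Adj u v) (hxy : FreePair G R x y) (hSG : IsComp G S)
    (hS : IsComp (addEdge G x y) (insert y S)) (hc : 5 ≤ S.card)
    (hy : y ∉ S) (hxS : x ∈ S) (hyG : ∀ u, ¬ G.Adj y u) (h4 : ¬ HasC4 (addEdge G x y) (insert y S))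
    (h : Settled G R S) : Answerable (addEdge G x y) R (insert y S) := by
  have hcard : (insert y S).card = S.card + 1 := Finset.card_insert_of_notMem hy
  have h4' : ¬ HasC4 G S := by
    rintro ⟨a, b, c, d, ha, hb, hc, hd, h⟩
    exact h4 ⟨a, b, c, d, by simp [ha], by simp [hb], by simp [hc], by simp [hd],
      h.mono le_addEdge⟩
  have hyN : ∀ u, u ≠ x → ¬ (addEdge G x y).Adj y u := by
    intro u hu h
    rw [addEdge_adj] at h
    have := hyG u
    have := hxy.1
    grind
  have hyx : (addEdge G x y).Adj y x := addEdge_adj.mpr (by simp [hxy.1])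
  have hx : ∀ R' a c, LiveHub (addEdge G x y) R' (insert y S) a c →
      ∃ v, s(a, c) = s(x, v) ∧ LiveHub (addEdge G x y) R' (insert y S) x v := by
    intro R' a c hl
    have hcov := hl.1.2.2.2 x (by simp [hxS]) y (by simp) hyx.symm
    have hac := hl.1.2.2.1
    have h1 : a = x ∨ c = x := by
      by_contra hno
      have := hyN a; have := hyN c; have := hac.symm
      grind
    rcases h1 with rfl | rfl
    · exact ⟨c, rfl, hl⟩
    · exact ⟨a, Sym2.eq_swap, hl.symm⟩
  have hold : ∀ R' v, LiveHub (addEdge G x y) R' (insert y S) x v → v ≠ y →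
      v ∈ S ∧ LiveHub G R' S x v := by
    intro R' v hl hvy
    have hvS : v ∈ S := (Finset.mem_insert.mp hl.1.2.1).resolve_left hvy
    obtain ⟨⟨_, _, hxv, hcov⟩, hd⟩ := hl
    refine ⟨hvS, ⟨hxS, hvS, ?_, fun u hu w hw huw => hcov u (by simp [hu]) w (by simp [hw])
      (le_addEdge huw)⟩, fun ⟨w, hw, hwa, hwc, hd'⟩ => hd ⟨w, by simp [hw], hwa, hwc, ?_⟩⟩
    · rw [addEdge_adj] at hxv
      have := hxy.1
      grind
    · exact hd'.imp (fun h => ⟨le_addEdge h.1, h.2⟩) (fun h => ⟨le_addEdge h.1, h.2⟩)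
  have hadjxv : ∀ v, LiveHub (addEdge G x y) R (insert y S) x v → (addEdge G x y).Adj v x :=
    fun v hl => hl.1.2.2.1.symm
  rcases Nat.lt_or_ge S.card 6 with h5 | h6
  · have h5 : S.card = 5 := by omega
    -- it is enough to leave at most one live hub edge
    have hone : ∀ R', (∃ v, ∀ u, LiveHub (addEdge G x y) R' (insert y S) x u → u = v) →
        Settled (addEdge G x y) R' (insert y S) := by
      rintro R' ⟨v, hv⟩
      refine settled_of_not_hasC4 (by omega) h4 (fun _ a c a' c' h1 h2 => ?_) (by omega)
      obtain ⟨u, hu, hul⟩ := hx R' a c h1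
      obtain ⟨u', hu', hul'⟩ := hx R' a' c' h2
      rw [hu, hu', hv u hul, hv u' hul']
    -- In a star, the Blocker edge `p q` joins two leaves and kills `x p`, `x q`; the edge `u y`
    -- kills `x u`, `x y`, so only `x v` may stay live. If some edge `u v` avoids `x`, only `x u`,
    -- `x v` can be hub edges, and killing the first suffices.
    by_cases hstar : ∀ u ∈ S, ∀ v ∈ S, G.Adj u v → u = x ∨ v = x
    · have hleaf : ∀ u ∈ S, u ≠ x → G.Adj u x := by
        intro u hu hux
        obtain ⟨v, hv, huv⟩ := hSG.exists_adj (by omega) hu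
        exact ((hstar u hu v hv huv).resolve_left hux) ▸ huv
      obtain ⟨p, hp, q, hq, hpq⟩ := (h.five h5).1
      have hpx : p ≠ x := by
        rintro rfl
        exact hR q p (hleaf q hq hpq.ne') hpq.symm
      have hqx : q ≠ x := by
        rintro rfl
        exact hR p q (hleaf p hp hpq.ne) hpq
      have hcard2 : (((S.erase x).erase p).erase q).card = 2 := by
        rw [Finset.card_erase_of_mem (by simp [hq, hqx, hpq.ne']),
          Finset.card_erase_of_mem (by simp [hp, hpx]), Finset.card_erase_of_mem hxS, h5]
      obtain ⟨u, v, huv, huvE⟩ := Finset.card_eq_two.mp hcard2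
      have hmem : ∀ z, z ∈ ({u, v} : Finset V) ↔ z ≠ q ∧ z ≠ p ∧ z ≠ x ∧ z ∈ S := by
        intro z; rw [← huvE]; simp [Finset.mem_erase]
      have hu := (hmem u).mp (by simp)
      have hdead : ∀ R', R ≤ R' → ∀ s t, s ∈ insert y S → t ∈ insert y S → s ≠ x → t ≠ x →
          (addEdge G x y).Adj s x → R'.Adj t s → ¬ LiveHub (addEdge G x y) R' (insert y S) x t :=
        fun R' _ s t hs _ hsx _ hadj hr hl => hl.2 ⟨s, hs, hsx, hr.ne', Or.inl ⟨hadj, hr⟩⟩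
      have huy : u ≠ y := fun h => hy (h ▸ hu.2.2.2)
      refine answerable_of_pair huy (fun h => hyN u hu.2.2.1 h.symm) fun R' hR' huyR => ?_
      refine hone R' ⟨v, fun z hz => ?_⟩
      by_contra hzv
      have hzx : z ≠ x := hz.1.2.2.1.ne'
      have hzS := hz.1.2.1
      have hux := le_addEdge (x := x) (y := y) (hleaf u hu.2.2.2 hu.2.2.1)
      by_cases hzy : z = y
      · subst hzy
        exact hdead R' hR' u z (by simp [hu.2.2.2]) (by simp) hu.2.2.1 hzx hux huyR.symm hz
      · have hzS := (Finset.mem_insert.mp hzS).resolve_left hzy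
        by_cases hzp : z = p
        · subst hzp
          exact hdead R' hR' q z (by simp [hq]) (by simp [hp]) hqx hzx
            (le_addEdge (hleaf q hq hqx)) (hR' hpq) hz
        by_cases hzq : z = q
        · subst hzq
          exact hdead R' hR' p z (by simp [hp]) (by simp [hq]) hpx hzx
            (le_addEdge (hleaf p hp hpx)) (hR' hpq.symm) hz
        have hzuv := (hmem z).mpr ⟨hzq, hzp, hzx, hzS⟩
        simp only [Finset.mem_insert, Finset.mem_singleton] at hzuv
        have hzu : z = u := by tauto
        subst hzu
        exact hdead R' hR' y z (by simp) (by simp [hzS]) hxy.1.symm hzx hyx huyR hz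
    · push Not at hstar
      obtain ⟨u, hu, v, hv, huv, hux, hvx⟩ := hstar
      have hQ : ∀ R' z, LiveHub (addEdge G x y) R' (insert y S) x z → z = u ∨ z = v := by
        intro R' z hz
        have := hz.1.2.2.2 u (by simp [hu]) v (by simp [hv]) (le_addEdge huv)
        grind
      by_cases hl : LiveHub (addEdge G x y) R (insert y S) x u
      · obtain ⟨p, q, hf, hk⟩ := hl.exists_kill hS (by omega) h4
        refine Or.inr ⟨p, q, hf, hone _ ⟨v, fun z hz => (hQ _ z hz).resolve_left ?_⟩⟩
        rintro rfl
        exact hk hz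
      · refine Or.inl (hone _ ⟨v, fun z hz => (hQ _ z hz).resolve_left ?_⟩)
        rintro rfl
        exact hl hz
  · by_cases hv : ∃ v ∈ S, LiveHub (addEdge G x y) R (insert y S) x v
    · obtain ⟨v, hvS, hv⟩ := hv
      have hvy : v ≠ y := fun h => hy (h ▸ hvS)
      have hvx : v ≠ x := hv.1.2.2.1.ne'
      -- The single edge `v y` kills `x v` through the neighbour `y` of `x`, and `x y` through `v`.
      refine answerable_of_pair hvy (fun h => hyN v hvx h.symm) fun R' hR' hvyR => ?_
      have hno : ∀ a c, ¬ LiveHub (addEdge G x y) R' (insert y S) a c := by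
        intro a c hac
        obtain ⟨z, -, hz⟩ := hx R' a c hac
        by_cases hzy : z = y
        · subst hzy
          exact hz.2 ⟨v, by simp [hvS], hvx, hvy, Or.inl ⟨hadjxv v hv, hvyR.symm⟩⟩
        · have h1 := (hold R z (hz.of_le hR') hzy).2
          have h2 := (hold R v hv hvy).2
          rcases Nat.lt_or_ge S.card 7 with h6' | h7
          · have := h.six (by omega) h4' x z x v h1 h2
            have hzv : z = v := by
              rcases Sym2.eq_iff.mp this with h | h
              · exact h.2
              · exact h.2.trans h.1
            subst hzv
            exact hz.2 ⟨y, by simp, hxy.1.symm, hvy.symm, Or.inl ⟨hyx, hvyR⟩⟩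
          · exact h.seven h7 h4' x z h1
      exact settled_of_not_hasC4 (by omega) h4 (fun _ a c _ _ hac => absurd hac (hno a c))
        (fun _ => hno)
    · refine answerable_of_forall_live (x := x) (y := y) hS (by omega) h4 fun a c hac => ?_
      obtain ⟨z, hz, hzl⟩ := hx R a c hac
      by_cases hzy : z = y
      · rw [hz, hzy]
      · exact absurd ⟨z, (hold R z hzl hzy).1, hzl⟩ hv

end

end ConstructorBlocker

-- Blocker's strategy and the upper bound

namespace ConstructorBlocker

variable {V : Type*}

section

open Classical

/-- The new edge is a bridge, and a bridge lies on no cycle. -/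
theorem hasC4_union {G : SimpleGraph V} {S₁ S₂ : Finset V} {x y : V} (hdisj : Disjoint S₁ S₂)
    (hS₁ : IsComp G S₁) (hx : x ∈ S₁) (hy : y ∈ S₂)
    (h4 : HasC4 (addEdge G x y) (S₁ ∪ S₂)) : HasC4 G S₁ ∨ HasC4 G S₂ := by
  rw [Finset.disjoint_left] at hdisj
  obtain ⟨a, b, c, d, ha, hb, hc, hd, h⟩ := h4
  have cross : ∀ u ∈ S₁, ∀ v ∈ S₂, (addEdge G x y).Adj u v → u = x ∧ v = y := by
    intro u hu v hv huv
    rw [addEdge_adj] at huv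
    rcases huv with huv | ⟨⟨h1, h2⟩ | ⟨rfl, rfl⟩, -⟩
    · exact absurd hv (hdisj (hS₁.closed u hu v huv))
    · exact ⟨h1, h2⟩
    · exact absurd hy (hdisj hu)
  have inner₁ : ∀ u ∈ S₁, ∀ v ∈ S₁, (addEdge G x y).Adj u v → G.Adj u v := by
    intro u hu v hv huv
    rw [addEdge_adj] at huv
    have := hdisj hu; have := hdisj hv
    grind
  have inner₂ : ∀ u ∈ S₂, ∀ v ∈ S₂, (addEdge G x y).Adj u v → G.Adj u v := by
    intro u hu v hv huv
    rw [addEdge_adj] at huv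
    have := fun h => hdisj h hu; have := fun h => hdisj h hv
    grind
  obtain ⟨hab, hbc, hcd, hda, hac, hbd⟩ := h
  rw [Finset.mem_union] at ha hb hc hd
  have hboth : ∀ {u v w : V}, u ∈ S₁ → v ∈ S₂ → (addEdge G x y).Adj u v →
      (addEdge G x y).Adj u w → w ∈ S₂ → w = v := fun hu hv h1 h2 hw =>
    (cross _ hu _ hw h2).2.trans (cross _ hu _ hv h1).2.symm
  have hboth' : ∀ {u v w : V}, u ∈ S₂ → v ∈ S₁ → (addEdge G x y).Adj u v →
      (addEdge G x y).Adj u w → w ∈ S₁ → w = v := fun hu hv h1 h2 hw =>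
    (cross _ hw _ hu h2.symm).1.trans (cross _ hv _ hu h1.symm).1.symm
  have key : ∀ {a b c d : V}, a ∈ S₁ → b ∈ S₂ → c ∈ S₁ ∨ c ∈ S₂ → d ∈ S₁ ∨ d ∈ S₂ →
      (addEdge G x y).Adj a b → (addEdge G x y).Adj b c → (addEdge G x y).Adj c d →
      (addEdge G x y).Adj d a → a ≠ c → b ≠ d → False := by
    intro a b c d ha hb hc hd hab hbc hcd hda hac hbd
    have hd' : d ∈ S₁ := hd.resolve_right fun h => hbd (hboth ha hb hab hda.symm h).symm
    have hc' : c ∈ S₂ := hc.resolve_left fun h => hac (hboth' hb ha hab.symm hbc h).symm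
    exact hda.ne ((cross d hd' c hc' hcd.symm).1.trans (cross a ha b hb hab).1.symm)
  rcases ha with ha | ha <;> rcases hb with hb | hb
  · rcases hc with hc | hc
    · rcases hd with hd | hd
      · exact Or.inl ⟨a, b, c, d, ha, hb, hc, hd, inner₁ a ha b hb hab, inner₁ b hb c hc hbc,
          inner₁ c hc d hd hcd, inner₁ d hd a ha hda, hac, hbd⟩
      · exact (key ha hd (Or.inl hc) (Or.inl hb) hda.symm hcd.symm hbc.symm hab.symm hac
          hbd.symm).elim
    · exact (key hb hc hd (Or.inl ha) hbc hcd hda hab hbd hac.symm).elim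
  · exact (key ha hb hc hd hab hbc hcd hda hac hbd).elim
  · exact (key hb ha hd hc hab.symm hda.symm hcd.symm hbc.symm hbd hac).elim
  · rcases hc with hc | hc
    · exact (key hc hb (Or.inr ha) hd hbc.symm hab.symm hda.symm hcd.symm hac.symm hbd).elim
    · rcases hd with hd | hd
      · exact (key hd ha (Or.inr hb) (Or.inr hc) hda hab hbc hcd hbd.symm hac).elim
      · exact Or.inr ⟨a, b, c, d, ha, hb, hc, hd, inner₂ a ha b hb hab, inner₂ b hb c hc hbc,
          inner₂ c hc d hd hcd, inner₂ d hd a ha hda, hac, hbd⟩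

theorem insert_three {a b c e : V} : insert e {a, b, c} = ({a, b, c, e} : Finset V) := by
  ext; simp only [Finset.mem_insert, Finset.mem_singleton]; tauto

theorem insert_four {a b c d e : V} : insert e {a, b, c, d} = ({a, b, c, d, e} : Finset V) := by
  ext; simp only [Finset.mem_insert, Finset.mem_singleton]; tauto

theorem union_three {a b c d e : V} :
    {a, b, c} ∪ {d, e} = ({a, b, c, d, e} : Finset V) := by
  rw [Finset.insert_union, Finset.insert_union, Finset.insert_eq]
  rfl

theorem union_two {a x y d : V} : {x, a} ∪ {y, d} = ({a, x, y, d} : Finset V) := by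
  ext; simp only [Finset.mem_union, Finset.mem_insert, Finset.mem_singleton]; tauto

theorem exists_third {S : Finset V} {p q : V} (hS : S.card = 3) (hp : p ∈ S) (hq : q ∈ S)
    (hpq : p ≠ q) : ∃ r, r ≠ p ∧ r ≠ q ∧ S = {r, p, q} := by
  have h : ((S.erase p).erase q).card = 1 := by
    rw [Finset.card_erase_of_mem (by simp [hq, hpq.symm]), Finset.card_erase_of_mem hp, hS]
  obtain ⟨r, hr⟩ := Finset.card_eq_one.mp h
  have hrm : r ∈ (S.erase p).erase q := by rw [hr]; simp
  simp only [Finset.mem_erase] at hrm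
  refine ⟨r, hrm.2.1, hrm.1, (Finset.eq_of_subset_of_card_le ?_ ?_).symm⟩
  · intro z hz
    simp only [Finset.mem_insert, Finset.mem_singleton] at hz
    rcases hz with rfl | rfl | rfl
    · exact hrm.2.2
    · exact hp
    · exact hq
  · rw [hS, Finset.card_eq_three.mpr ⟨r, p, q, hrm.2.1, hrm.1, hpq, rfl⟩]

theorem exists_second {S : Finset V} {p : V} (hS : S.card = 2) (hp : p ∈ S) :
    ∃ r, r ≠ p ∧ S = {p, r} := by
  have h : (S.erase p).card = 1 := by rw [Finset.card_erase_of_mem hp, hS]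
  obtain ⟨r, hr⟩ := Finset.card_eq_one.mp h
  have hrm : r ∈ S.erase p := by rw [hr]; simp
  exact ⟨r, (Finset.mem_erase.mp hrm).1, by rw [← Finset.insert_erase hp, hr]⟩

/-- Blocker's answer to an edge joining two components. -/
theorem answerable_join {G R : SimpleGraph V} {S₁ S₂ : Finset V} {x y : V}
    (hG' : PathSixFree (addEdge G x y)) (hR : ∀ u v, G.Adj u v → ¬ R.Adj u v)
    (hxy : FreePair G R x y) (hS₁ : IsComp G S₁) (hS₂ : IsComp G S₂) (hdisj : Disjoint S₁ S₂)
    (hx : x ∈ S₁) (hy : y ∈ S₂) (hS : IsComp (addEdge G x y) (S₁ ∪ S₂))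
    (hle : S₂.card ≤ S₁.card) (h : Settled G R S₁) :
    Answerable (addEdge G x y) R (S₁ ∪ S₂) := by
  have hcard : (S₁ ∪ S₂).card = S₁.card + S₂.card := Finset.card_union_of_disjoint hdisj
  have hd := Finset.disjoint_left.mp hdisj
  have hpos : 0 < S₂.card := Finset.card_pos.mpr ⟨y, hy⟩
  have cross : ∀ u ∈ S₁, ∀ v ∈ S₂, (addEdge G x y).Adj u v → u = x ∧ v = y := by
    intro u hu v hv huv
    rw [addEdge_adj] at huv
    rcases huv with huv | ⟨⟨h1, h2⟩ | ⟨rfl, rfl⟩, -⟩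
    · exact absurd hv (hd (hS₁.closed u hu v huv))
    · exact ⟨h1, h2⟩
    · exact absurd hy (hd hu)
  have hne : ∀ u ∈ S₁, ∀ v ∈ S₂, u ≠ v := fun u hu v hv h => hd hu (h ▸ hv)
  rcases Nat.lt_or_ge S₂.card 2 with h1 | h2
  · obtain ⟨y', hy'⟩ := Finset.card_eq_one.mp (show S₂.card = 1 by omega)
    have : y' = y := by rw [hy', Finset.mem_singleton] at hy; exact hy.symm
    subst this
    have hyS : y' ∉ S₁ := fun h => hd h hy
    have hunion : S₁ ∪ S₂ = insert y' S₁ := by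
      rw [hy', Finset.union_comm, Finset.insert_eq]
    have hyG : ∀ u, ¬ G.Adj y' u := by
      intro u hu
      have := hS₂.closed y' hy u hu
      rw [hy', Finset.mem_singleton] at this
      exact hu.ne this.symm
    have crossy : ∀ u ∈ S₁, u ≠ x → ¬ (addEdge G x y').Adj u y' := fun u hu hux h =>
      hux (cross u hu y' hy h).1
    rw [hunion] at hS ⊢
    obtain h0 | h0 | h0 | h0 | h0 : S₁.card = 1 ∨ S₁.card = 2 ∨ S₁.card = 3 ∨ S₁.card = 4 ∨
        5 ≤ S₁.card := by
      have := Finset.card_pos.mpr ⟨x, hx⟩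
      omega
    · exact Or.inl (settled_of_card_le_two (by rw [Finset.card_insert_of_notMem hyS, h0]))
    · obtain ⟨z, hzx, rfl⟩ := exists_second h0 hx
      have : insert y' {x, z} = ({x, z, y'} : Finset V) := by ext; simp; tauto
      rw [this]
      exact answerable_two_one hxy.1 (hne z (by simp) y' hy) hzx.symm
        (crossy z (by simp) hzx)
    · obtain ⟨p, hp, q, hq, hpq⟩ := h.three h0
      obtain ⟨r, hrp, hrq, rfl⟩ := exists_third h0 hp hq hpq.ne
      refine answerable_three_one (r := r) (p := p) (q := q) (y := y') insert_three
        (by rw [Finset.card_insert_of_notMem hyS, h0]) hpq ?_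
      by_cases hpx : p = x
      · exact Or.inr (crossy q hq (hpx ▸ hpq.ne'))
      · exact Or.inl (crossy p hp hpx)
    · obtain ⟨a, b, c, d, rfl, hs⟩ := h.four h0
      refine answerable_four_one (a := a) (b := b) (c := c) (d := d) (e := y') (x := x)
        insert_four (by rw [Finset.card_insert_of_notMem hyS, h0])
        (distinct_of_card_four h0) ⟨(hne a (by simp) y' hy).symm, (hne b (by simp) y' hy).symm,
          (hne c (by simp) y' hy).symm, (hne d (by simp) y' hy).symm⟩ ?_ ?_
      · intro u hux huy
        rw [addEdge_adj] at huy
        have := hyG u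
        have := hxy.1
        grind
      · have hold : ∀ u ∈ ({a, b, c, d} : Finset V), ∀ v ∈ ({a, b, c, d} : Finset V),
            ¬ G.Adj u v → ¬ (addEdge G x y').Adj u v := by
          intro u hu v hv huv h
          rw [addEdge_adj] at h
          have := hne u hu y' hy
          have := hne v hv y' hy
          grind
        exact hs.imp_right fun hs => hs.imp_right fun hs =>
          ⟨hs.1, hold b (by simp) d (by simp) hs.2.1, hold a (by simp) d (by simp) hs.2.2⟩
    · by_cases h4 : HasC4 G S₁
      · exact answerable_join_of_hasC4 hG' hR hxy hS h0 hyS hx hyG h4 h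
      · refine answerable_join_single hR hxy hS₁ hS h0 hyS hx hyG (fun h4' => ?_) h
        rw [← hunion] at h4'
        rcases hasC4_union hdisj hS₁ hx hy h4' with h' | ⟨a, b, c, d, ha, hb, -, -, hC⟩
        · exact h4 h'
        · rw [hy', Finset.mem_singleton] at ha hb
          exact hC.ab.ne (ha.trans hb.symm)
  · obtain ⟨z, hz, hyz⟩ := hS₂.exists_adj h2 hy
    rcases Nat.lt_or_ge (S₁ ∪ S₂).card 6 with h6 | h6
    · have hS₂2 : S₂.card = 2 := by omega
      obtain ⟨e, hey, rfl⟩ := exists_second hS₂2 hy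
      obtain h0 | h0 : S₁.card = 2 ∨ S₁.card = 3 := by omega
      · obtain ⟨a, hax, rfl⟩ := exists_second h0 hx
        refine answerable_two_two (a := a) (x := x) (y := y) (d := e) union_two
          (by omega) (fun h => hax (cross a (by simp) y hy h).1)
          (fun h => hey (cross x (by simp) e (by simp) h).2)
          (fun h => hax (cross a (by simp) e (by simp) h).1)
      · obtain ⟨p, hp, q, hq, hpq⟩ := h.three h0
        obtain ⟨r, hrp, hrq, rfl⟩ := exists_third h0 hp hq hpq.ne
        have hr : r ∈ ({r, p, q} : Finset V) := by simp
        have he : e ∈ ({y, e} : Finset V) := by simp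
        refine answerable_three_two (a := r) (b := p) (c := q) (d := y) (e := e) (x := x)
          union_three (by omega) ⟨hrp, hrq, hpq.ne⟩
          ⟨(hne r hr y hy).symm, (hne p hp y hy).symm, (hne q hq y hy).symm⟩
          ⟨(hne r hr e he).symm, (hne p hp e he).symm, (hne q hq e he).symm⟩
          ⟨fun h => hey (cross r hr e he h.symm).2, fun h => hey (cross p hp e he h.symm).2,
            fun h => hey (cross q hq e he h.symm).2⟩ ?_ hpq
        intro u hux hue huy
        rw [addEdge_adj] at huy
        rcases huy with huy | huy
        · have := hS₂.closed y hy u huy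
          simp only [Finset.mem_insert, Finset.mem_singleton] at this
          rcases this with rfl | rfl
          · exact huy.ne rfl
          · exact hue rfl
        · have := hxy.1
          grind
    -- A component with a 4-cycle cannot be merged with one having an edge: a neighbour of `y` in
    -- the other part would lie off the cycle without being attached to it.
    · have hno : ∀ {S S' : Finset V} {x y : V}, PathSixFree (addEdge G x y) → IsComp G S →
          IsComp G S' → Disjoint S S' → x ∈ S → y ∈ S' →
          IsComp (addEdge G x y) (S ∪ S') → 2 ≤ S'.card → ¬ HasC4 G S := by
        intro S S' x y hG' hS hS' hdisj hx hy hU h2 ⟨a, b, c, d, ha, hb, hc, hd', hC⟩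
        have hd := Finset.disjoint_left.mp hdisj
        obtain ⟨z, hz, hyz⟩ := hS'.exists_adj h2 hy
        have hC' : IsC4 (addEdge G x y) a b c d := hC.mono le_addEdge
        have hnez : ∀ u ∈ S, z ≠ u := fun u hu h => hd hu (h ▸ hz)
        have hnadj : ∀ u ∈ S, ¬ (addEdge G x y).Adj z u := by
          intro u hu h
          rw [addEdge_adj] at h
          rcases h with h | ⟨⟨rfl, rfl⟩ | ⟨rfl, rfl⟩, -⟩
          · exact hd hu (hS'.closed z hz u h)
          · exact hd hu hy
          · exact hyz.ne rfl
        have := hC'.dominates hG' hU (Finset.mem_union_left _ ha) z (Finset.mem_union_right _ hz)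
          ⟨hnez a ha, hnez b hb, hnez c hc, hnez d hd'⟩
        rcases this with h | h | h | h
        · exact hnadj a ha h
        · exact hnadj b hb h
        · exact hnadj c hc h
        · exact hnadj d hd' h
      have n1 : ¬ HasC4 G S₁ := hno hG' hS₁ hS₂ hdisj hx hy hS h2
      have n2 : ¬ HasC4 G S₂ := by
        rw [addEdge_comm] at hG' hS
        rw [Finset.union_comm] at hS
        exact hno hG' hS₂ hS₁ hdisj.symm hy hx hS (h2.trans hle)
      refine answerable_join_large hS₁ hS₂ hdisj hx hy hS h6 (h2.trans hle) h2 fun h4 => ?_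
      exact (hasC4_union hdisj hS₁ hx hy h4).elim n1 n2

/-- Blocker's answer to an edge inside a component. -/
theorem answerable_inner {G R : SimpleGraph V} {S : Finset V} {x y : V}
    (hG' : PathSixFree (addEdge G x y)) (hR : ∀ u v, G.Adj u v → ¬ R.Adj u v)
    (hxy : FreePair G R x y) (hS : IsComp (addEdge G x y) S) (h : Settled G R S) :
    Answerable (addEdge G x y) R S := by
  rcases Nat.lt_or_ge S.card 6 with h6 | h6
  · obtain h0 | h0 | h0 | h0 : S.card ≤ 2 ∨ S.card = 3 ∨ S.card = 4 ∨ S.card = 5 := by omega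
    · exact Or.inl (settled_of_card_le_two h0)
    · exact Or.inl (settled_of_card_three h0 (h.three h0))
    · exact answerable_four_inner h0 rfl (h.four h0)
    · exact answerable_five_inner h0 rfl (h.five h0)
  · by_cases h4 : HasC4 G S
    · exact answerable_inner_of_hasC4 hG' hR hxy h6 h4 (h.hasC4 h6 h4)
    · by_cases h4' : HasC4 (addEdge G x y) S
      · exact answerable_inner_new_C4 hG' hR hxy hS h6 h4 h4' h
      · exact answerable_inner_of_not_hasC4 hS h6 h4' h

section Fintype

variable [Fintype V]

/-- The vertex set of the component of `v`. -/
noncomputable def compOf (G : SimpleGraph V) (v : V) : Finset V :=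
  Finset.univ.filter fun u => G.Reachable v u

theorem mem_compOf {G : SimpleGraph V} {u v : V} : u ∈ compOf G v ↔ G.Reachable v u := by
  simp [compOf]

theorem self_mem_compOf {G : SimpleGraph V} {v : V} : v ∈ compOf G v :=
  mem_compOf.mpr (SimpleGraph.Reachable.refl v)

theorem isComp_compOf {G : SimpleGraph V} {v : V} : IsComp G (compOf G v) where
  nonempty := ⟨v, self_mem_compOf⟩
  closed u hu w huw := by
    rw [mem_compOf] at hu ⊢
    exact hu.trans huw.reachable
  reachable u hu w hw := by
    rw [mem_compOf] at hu hw
    exact hu.symm.trans hw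

/-- Blocker can settle all components with at most one move. -/
theorem exists_answer {G R : SimpleGraph V} {x y : V}
    (hG' : PathSixFree (addEdge G x y)) (hR : ∀ u v, G.Adj u v → ¬ R.Adj u v)
    (hxy : FreePair G R x y) (h : ∀ S, IsComp G S → Settled G R S) :
    (∀ S, IsComp (addEdge G x y) S → Settled (addEdge G x y) R S) ∨
      ∃ p q, FreePair (addEdge G x y) R p q ∧
        ∀ S, IsComp (addEdge G x y) S → Settled (addEdge G x y) (addEdge R p q) S := by
  have hdis := disjoint_of_free hR hxy
  have hadj : (addEdge G x y).Adj x y := addEdge_adj.mpr (by simp [hxy.1])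
  have hother : ∀ S, IsComp (addEdge G x y) S → x ∉ S → Settled (addEdge G x y) R S := by
    intro S hS hxS
    have hyS : y ∉ S := fun h => hxS (hS.closed y h x hadj.symm)
    have hagree : ∀ u ∈ S, ∀ v, (addEdge G x y).Adj u v ↔ G.Adj u v := by
      intro u hu v
      rw [addEdge_adj]
      grind
    have hSG : IsComp G S := by
      refine ⟨hS.nonempty, fun u hu v huv => hS.closed u hu v (le_addEdge huv), ?_⟩
      intro u hu v hv
      exact hS.forall_of_closed (X := fun z => G.Reachable u z) hu
        (SimpleGraph.Reachable.refl u) (fun a ha hua b _ hab =>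
          hua.trans ((hagree a ha b).mp hab).reachable) v hv
    exact (h S hSG).congr le_addEdge hG' hdis (fun u hu v _ => hagree u hu v)
  have hmain : Answerable (addEdge G x y) R (compOf (addEdge G x y) x) := by
    have hSx : IsComp (addEdge G x y) (compOf (addEdge G x y) x) := isComp_compOf
    by_cases hyx : y ∈ compOf G x
    · have hU : IsComp (addEdge G x y) (compOf G x) := by
        refine ⟨⟨x, self_mem_compOf⟩, fun u hu v huv => ?_, fun u hu v hv =>
          (isComp_compOf.reachable u hu v hv).mono le_addEdge⟩
        rw [addEdge_adj] at huv
        rcases huv with huv | ⟨⟨rfl, rfl⟩ | ⟨rfl, rfl⟩, -⟩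
        · exact isComp_compOf.closed u hu v huv
        · exact hyx
        · exact self_mem_compOf
      rw [hSx.eq_of_mem hU self_mem_compOf self_mem_compOf]
      exact answerable_inner hG' hR hxy hU (h _ isComp_compOf)
    · have hdisj : Disjoint (compOf G x) (compOf G y) := by
        rw [Finset.disjoint_left]
        intro z hz hz'
        rw [mem_compOf] at hz hz' hyx
        exact hyx (hz.trans hz'.symm)
      have hU : IsComp (addEdge G x y) (compOf G x ∪ compOf G y) := by
        refine ⟨⟨x, Finset.mem_union_left _ self_mem_compOf⟩, fun u hu v huv => ?_, ?_⟩
        · rw [Finset.mem_union] at hu ⊢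
          rw [addEdge_adj] at huv
          rcases huv with huv | ⟨⟨-, rfl⟩ | ⟨-, rfl⟩, -⟩
          · exact hu.imp (fun hu => isComp_compOf.closed u hu v huv)
              (fun hu => isComp_compOf.closed u hu v huv)
          · exact Or.inr self_mem_compOf
          · exact Or.inl self_mem_compOf
        · have hreach : ∀ u ∈ compOf G x ∪ compOf G y, (addEdge G x y).Reachable x u := by
            intro u hu
            rw [Finset.mem_union, mem_compOf, mem_compOf] at hu
            rcases hu with hu | hu
            · exact hu.mono le_addEdge
            · exact hadj.reachable.trans (hu.mono le_addEdge)
          exact fun u hu v hv => (hreach u hu).symm.trans (hreach v hv)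
      rw [hSx.eq_of_mem hU self_mem_compOf (Finset.mem_union_left _ self_mem_compOf)]
      rcases le_total (compOf G y).card (compOf G x).card with hle | hle
      · exact answerable_join hG' hR hxy isComp_compOf isComp_compOf hdisj self_mem_compOf
          self_mem_compOf hU hle (h _ isComp_compOf)
      · rw [addEdge_comm] at hG' hU ⊢
        rw [Finset.union_comm] at hU ⊢
        exact answerable_join hG' hR hxy.symm isComp_compOf isComp_compOf hdisj.symm
          self_mem_compOf self_mem_compOf hU hle (h _ isComp_compOf)
  have hcase : ∀ S, IsComp (addEdge G x y) S → x ∈ S → S = compOf (addEdge G x y) x :=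
    fun S hS hx => hS.eq_of_mem isComp_compOf hx self_mem_compOf
  rcases hmain with hm | ⟨p, q, hf, hm⟩
  · left
    intro S hS
    by_cases hx : x ∈ S
    · rw [hcase S hS hx]; exact hm
    · exact hother S hS hx
  · right
    refine ⟨p, q, hf, fun S hS => ?_⟩
    by_cases hx : x ∈ S
    · rw [hcase S hS hx]; exact hm
    · exact (hother S hS hx).addEdge hG' hdis hf.2.1

/-- A position all of whose components are settled has few triangles. -/
theorem card_triangles_le {G R : SimpleGraph V} (hG : PathSixFree G)
    (hR : ∀ u v, G.Adj u v → ¬ R.Adj u v) (h : ∀ S, IsComp G S → Settled G R S) :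
    2 * (triangles G).card ≤ Fintype.card V := by
  set comps : Finset (Finset V) := Finset.univ.image (compOf G) with hcomps
  have hsub : triangles G ⊆ comps.biUnion (trianglesIn G) := by
    intro τ hτ
    rw [mem_triangles] at hτ
    obtain ⟨v, hv⟩ : τ.Nonempty := Finset.card_pos.mp (by rw [hτ.card_eq]; norm_num)
    rw [Finset.mem_biUnion]
    refine ⟨compOf G v, Finset.mem_image_of_mem _ (Finset.mem_univ v), ?_⟩
    rw [mem_trianglesIn]
    refine ⟨fun u hu => ?_, hτ.card_eq, hτ.isClique⟩
    rw [mem_compOf]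
    by_cases huv : v = u
    · rw [huv]
    · exact (hτ.isClique hv hu huv).reachable
  have hc : ∀ S ∈ comps, IsComp G S := by
    intro S hS
    obtain ⟨v, -, rfl⟩ := Finset.mem_image.mp hS
    exact isComp_compOf
  calc 2 * (triangles G).card ≤ 2 * ∑ S ∈ comps, (trianglesIn G S).card :=
        Nat.mul_le_mul_left 2 ((Finset.card_le_card hsub).trans Finset.card_biUnion_le)
    _ = ∑ S ∈ comps, 2 * (trianglesIn G S).card := Finset.mul_sum _ _ _
    _ ≤ ∑ S ∈ comps, S.card := Finset.sum_le_sum fun S hS =>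
        (h S (hc S hS)).bound hG hR (hc S hS)
    _ = (comps.biUnion id).card := by
        rw [Finset.card_biUnion]
        · rfl
        · intro S hS S' hS' hne
          rw [Function.onFun, Finset.disjoint_left]
          intro v hv hv'
          exact hne ((hc S hS).eq_of_mem (hc S' hS') hv hv')
    _ ≤ Fintype.card V := Finset.card_le_univ _

end Fintype

end

/-- The graph formed by a set of claimed edges. -/
def graphOf (C : Finset (Sym2 V)) : SimpleGraph V := SimpleGraph.fromEdgeSet (↑C : Set (Sym2 V))

open Classical in
theorem graphOf_insert {C : Finset (Sym2 V)} {x y : V} :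
    graphOf (insert s(x, y) C) = addEdge (graphOf C) x y := by
  ext u v
  rw [addEdge_adj, graphOf, graphOf, SimpleGraph.fromEdgeSet_adj, SimpleGraph.fromEdgeSet_adj]
  simp only [Finset.coe_insert, Set.mem_insert_iff, Finset.mem_coe, Sym2.eq_iff]
  grind

theorem mem_freeEdges_iff [Fintype V] {C B : Finset (Sym2 V)} {x y : V} :
    s(x, y) ∈ freeEdges C B ↔ FreePair (graphOf C) (graphOf B) x y := by
  rw [mem_freeEdges, FreePair, graphOf, graphOf, SimpleGraph.fromEdgeSet_adj,
    SimpleGraph.fromEdgeSet_adj]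
  simp only [Sym2.mk_isDiag_iff, Finset.mem_coe]
  tauto

open Classical in
theorem mem_legalEdges_iff [Fintype V] {C B : Finset (Sym2 V)} {x y : V} :
    s(x, y) ∈ legalEdges (SimpleGraph.pathGraph 6) C B ↔
      FreePair (graphOf C) (graphOf B) x y ∧ PathSixFree (addEdge (graphOf C) x y) := by
  rw [legalEdges, Finset.mem_filter, mem_freeEdges_iff, pathSixFree_iff, ← graphOf_insert]
  rfl

open Classical in
theorem constructorValue_upper [Fintype V] :
    constructorValue (⊤ : SimpleGraph (Fin 3)) (SimpleGraph.pathGraph 6)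
      (∅ : Finset (Sym2 V)) ∅ ≤ Fintype.card V / 2 := by
  let Inv : Finset (Sym2 V) → Finset (Sym2 V) → Prop := fun C B =>
    PathSixFree (graphOf C) ∧ (∀ u v, (graphOf C).Adj u v → ¬ (graphOf B).Adj u v) ∧
      ∀ S, IsComp (graphOf C) S → Settled (graphOf C) (graphOf B) S
  have hscore : ∀ C B, Inv C B → copies (⊤ : SimpleGraph (Fin 3)) C ≤ Fintype.card V / 2 := by
    intro C B ⟨h1, h2, h3⟩
    have := card_triangles_le h1 h2 h3
    rw [copies_triangle]
    unfold graphOf at this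
    omega
  apply constructorValue_le_of_invariant Inv hscore
  · intro C B e ⟨h1, h2, h3⟩ he
    induction e with
    | h x y =>
    obtain ⟨hf, hG'⟩ := mem_legalEdges_iff.mp he
    have hdis := disjoint_of_free h2 hf
    have hmove : ∀ p q, FreePair (addEdge (graphOf C) x y) (graphOf B) p q →
        (∀ S, IsComp (addEdge (graphOf C) x y) S →
          Settled (addEdge (graphOf C) x y) (addEdge (graphOf B) p q) S) →
        ∃ f ∈ freeEdges (insert s(x, y) C) B, Inv (insert s(x, y) C) (insert f B) := by
      intro p q hpq hS
      refine ⟨s(p, q), ?_, ?_⟩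
      · rw [mem_freeEdges_iff, graphOf_insert]; exact hpq
      · refine ⟨?_, ?_, ?_⟩
        · rw [graphOf_insert]; exact hG'
        · rw [graphOf_insert, graphOf_insert]; exact disjoint_addEdge hdis hpq.2.1
        · rw [graphOf_insert, graphOf_insert]; exact hS
    rcases exists_answer hG' h2 hf h3 with hS | ⟨p, q, hpq, hS⟩
    -- Nothing needs an answer, so Blocker plays an arbitrary free edge if there is one.
    · by_cases hne : (freeEdges (insert s(x, y) C) B).Nonempty
      · obtain ⟨f, hfree⟩ := hne
        left
        induction f with
        | h p q =>
        rw [mem_freeEdges_iff, graphOf_insert] at hfree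
        exact hmove p q hfree fun S hSc => (hS S hSc).addEdge hG' hdis hfree.2.1
      · right
        refine ⟨Finset.not_nonempty_iff_eq_empty.mp hne, hscore _ B ⟨?_, ?_, ?_⟩⟩
        · rw [graphOf_insert]; exact hG'
        · rw [graphOf_insert]; exact hdis
        · rw [graphOf_insert]; exact hS
    · exact Or.inl (hmove p q hpq hS)
  · refine ⟨?_, ?_, ?_⟩
    · intro a b c d e f _ h
      simp [graphOf] at h
    · intro u v h
      simp [graphOf] at h
    · intro S hS
      apply settled_of_card_le_two
      by_contra! h
      obtain ⟨u, hu⟩ := hS.nonempty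
      obtain ⟨v, -, huv⟩ := hS.exists_adj (by omega) hu
      simp [graphOf] at huv

end ConstructorBlocker

-- Constructor's strategy: friendship graphs

namespace ConstructorBlocker

variable {V : Type*}

section

open Classical

/-- Every component of `G` is a star with centre given by `φ` together with a matching of its
leaves. -/
structure Friendship (G : SimpleGraph V) (φ : V → V) : Prop where
  map_eq : ∀ v w, G.Adj v w → φ v = φ w
  uniq : ∀ v w w', v ≠ φ v → G.Adj v w → G.Adj v w' → w ≠ φ v → w' ≠ φ v → w = w'

/-- Among `a, b, c` one is the centre, since a non-centre `b` has at most one non-central neighbour.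
The same holds for `d, e, f`, but the centre is common to the whole path. -/
theorem Friendship.pathSixFree {G : SimpleGraph V} {φ : V → V} (h : Friendship G φ) :
    PathSixFree G := by
  intro a b c d e f hn hab hbc hcd hde hef
  simp only [List.nodup_cons, List.mem_cons, List.not_mem_nil, or_false, not_or, List.nodup_nil,
    not_false_eq_true, and_true] at hn
  obtain ⟨⟨-, hac, had, hae, haf⟩, ⟨-, hbd, hbe, hbf⟩, ⟨-, hce, hcf⟩, ⟨-, hdf⟩, -⟩ := hn
  have e1 := h.map_eq _ _ hab
  have e2 := h.map_eq _ _ hbc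
  have e3 := h.map_eq _ _ hcd
  have e4 := h.map_eq _ _ hde
  have e5 := h.map_eq _ _ hef
  have u1 : b = φ a ∨ a = φ a ∨ c = φ a := by
    by_contra! hno
    exact hac (h.uniq b a c (e1 ▸ hno.1) hab.symm hbc (e1 ▸ hno.2.1) (e1 ▸ hno.2.2))
  have u2 : e = φ a ∨ d = φ a ∨ f = φ a := by
    have e6 : φ e = φ a := by rw [← e4, ← e3, ← e2, ← e1]
    by_contra! hno
    rw [← e6] at hno
    exact hdf (h.uniq e d f hno.1 hde.symm hef hno.2.1 hno.2.2)
  have := hcd.ne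
  grind

/-- The isolated vertices of a graph. -/
noncomputable def isolated [Fintype V] (G : SimpleGraph V) : Finset V :=
  Finset.univ.filter fun v => ∀ w, ¬ G.Adj v w

theorem mem_isolated [Fintype V] {G : SimpleGraph V} {v : V} :
    v ∈ isolated G ↔ ∀ w, ¬ G.Adj v w := by
  simp [isolated]

/-- Constructor is building a friendship graph with centre `u` and unmatched leaves `L`, and `X`
is a reservoir of vertices that neither player has used. -/
structure Stage (G R : SimpleGraph V) (φ : V → V) (u : V) (L X : Finset V) : Prop where
  friend : Friendship G φ
  center : φ u = u
  leaf : ∀ l ∈ L, ∀ w, G.Adj l w ↔ w = u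
  fresh : ∀ x ∈ X, ∀ w, ¬ G.Adj x w
  center_notMem : u ∉ X
  leaf_notMem : ∀ l ∈ L, l ∉ X
  clean : ∀ x ∈ X, ∀ w, w ∈ X ∨ w ∈ L ∨ w = u → ¬ R.Adj x w

theorem Stage.leaf_ne {G R : SimpleGraph V} {φ : V → V} {u : V} {L X : Finset V}
    (h : Stage G R φ u L X) {l : V} (hl : l ∈ L) : l ≠ u := by
  rintro rfl
  exact ((h.leaf l hl l).mpr rfl).ne rfl

/-- Dropping both ends of Blocker's reply `p q` from the reservoir keeps the remaining vertices
clean. -/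
theorem Stage.addLeaf {G R : SimpleGraph V} {φ : V → V} {u : V} {L X : Finset V}
    (h : Stage G R φ u L X) {x : V} (hx : x ∈ X) (p q : V) :
    Stage (addEdge G u x) (addEdge R p q) (Function.update φ x u) u (insert x L)
      (((X.erase x).erase p).erase q) := by
  have hxu : x ≠ u := fun h' => h.center_notMem (h' ▸ hx)
  have hfx := h.fresh x hx
  have hfx' : ∀ v, ¬ G.Adj v x := fun v hv => hfx v hv.symm
  have hmem : ∀ z ∈ ((X.erase x).erase p).erase q, z ∈ X ∧ z ≠ x ∧ z ≠ p ∧ z ≠ q := by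
    intro z hz
    simp only [Finset.mem_erase] at hz
    tauto
  refine ⟨⟨fun v w hvw => ?_, fun v w w' hv hw hw' hne hne' => ?_⟩, ?_, ?_, ?_, ?_, ?_, ?_⟩
  · rw [addEdge_adj] at hvw
    rcases hvw with hvw | ⟨⟨rfl, rfl⟩ | ⟨rfl, rfl⟩, -⟩
    · have h1 : v ≠ x := fun h' => hfx w (h' ▸ hvw)
      have h2 : w ≠ x := fun h' => hfx' v (h' ▸ hvw)
      rw [Function.update_of_ne h1, Function.update_of_ne h2, h.friend.map_eq v w hvw]
    · rw [Function.update_self, Function.update_of_ne hxu.symm, h.center]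
    · rw [Function.update_self, Function.update_of_ne hxu.symm, h.center]
  · rw [addEdge_adj] at hw hw'
    by_cases hvx : v = x
    · subst hvx
      rw [Function.update_self] at hne hne'
      have := hfx w
      grind
    · rw [Function.update_of_ne hvx] at hv hne hne'
      have hvu : v ≠ u := by
        rintro rfl
        exact hv h.center.symm
      exact h.friend.uniq v w w' hv (by grind) (by grind) hne hne'
  · rw [Function.update_of_ne hxu.symm, h.center]
  · intro l hl w
    rw [addEdge_adj]
    rcases Finset.mem_insert.mp hl with rfl | hl
    · have := hfx w
      grind
    · have := h.leaf l hl w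
      have := h.leaf_ne hl
      have : l ≠ x := fun h' => h.leaf_notMem l hl (h' ▸ hx)
      grind
  · intro z hz w
    obtain ⟨hzX, hzx, -, -⟩ := hmem z hz
    have := h.fresh z hzX w
    have : z ≠ u := fun h' => h.center_notMem (h' ▸ hzX)
    rw [addEdge_adj]
    grind
  · exact fun hu => h.center_notMem (hmem u hu).1
  · intro l hl hlX
    obtain ⟨h1, h2, -, -⟩ := hmem l hlX
    rcases Finset.mem_insert.mp hl with rfl | hl
    · exact h2 rfl
    · exact h.leaf_notMem l hl h1
  · intro z hz w hw
    obtain ⟨hzX, hzx, hzp, hzq⟩ := hmem z hz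
    have hw' : w ∈ X ∨ w ∈ L ∨ w = u := by
      rcases hw with hw | hw | hw
      · exact Or.inl (hmem w hw).1
      · rcases Finset.mem_insert.mp hw with rfl | hw
        · exact Or.inl hx
        · exact Or.inr (Or.inl hw)
      · exact Or.inr (Or.inr hw)
    have := h.clean z hzX w hw'
    rw [addEdge_adj]
    grind

theorem Stage.matchLeaves {G R : SimpleGraph V} {φ : V → V} {u : V} {L X : Finset V}
    (h : Stage G R φ u L X) {l l' : V} (hl : l ∈ L) (hl' : l' ∈ L) (hne : l ≠ l') (p q : V) :
    Stage (addEdge G l l') (addEdge R p q) φ u ((L.erase l).erase l') ((X.erase p).erase q) := by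
  have hlu := h.leaf_ne hl
  have hlu' := h.leaf_ne hl'
  have hφl : φ l = u := by
    rw [h.friend.map_eq l u ((h.leaf l hl u).mpr rfl), h.center]
  have hφl' : φ l' = u := by
    rw [h.friend.map_eq l' u ((h.leaf l' hl' u).mpr rfl), h.center]
  have hmem : ∀ z ∈ (X.erase p).erase q, z ∈ X ∧ z ≠ p ∧ z ≠ q := by
    intro z hz
    simp only [Finset.mem_erase] at hz
    tauto
  have hmemL : ∀ z ∈ (L.erase l).erase l', z ∈ L ∧ z ≠ l ∧ z ≠ l' := by
    intro z hz
    simp only [Finset.mem_erase] at hz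
    tauto
  refine ⟨⟨fun v w hvw => ?_, fun v w w' hv hw hw' hn hn' => ?_⟩, h.center, ?_, ?_, ?_, ?_, ?_⟩
  · rw [addEdge_adj] at hvw
    rcases hvw with hvw | ⟨⟨rfl, rfl⟩ | ⟨rfl, rfl⟩, -⟩
    · exact h.friend.map_eq v w hvw
    · rw [hφl, hφl']
    · rw [hφl, hφl']
  · rw [addEdge_adj] at hw hw'
    by_cases hvl : v = l
    · subst hvl
      rw [hφl] at hn hn'
      have := h.leaf v hl w; have := h.leaf v hl w'
      grind
    by_cases hvl' : v = l'
    · subst hvl'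
      rw [hφl'] at hn hn'
      have := h.leaf v hl' w; have := h.leaf v hl' w'
      grind
    · exact h.friend.uniq v w w' hv (by grind) (by grind) hn hn'
  · intro z hz w
    obtain ⟨hzL, h1, h2⟩ := hmemL z hz
    have := h.leaf z hzL w
    rw [addEdge_adj]
    grind
  · intro z hz w
    obtain ⟨hzX, -, -⟩ := hmem z hz
    have := h.fresh z hzX w
    have : z ≠ l := fun h' => h.leaf_notMem l hl (h' ▸ hzX)
    have : z ≠ l' := fun h' => h.leaf_notMem l' hl' (h' ▸ hzX)
    rw [addEdge_adj]
    grind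
  · exact fun hu => h.center_notMem (hmem u hu).1
  · intro z hz hzX
    exact h.leaf_notMem z (hmemL z hz).1 (hmem z hzX).1
  · intro z hz w hw
    obtain ⟨hzX, hzp, hzq⟩ := hmem z hz
    have hw' : w ∈ X ∨ w ∈ L ∨ w = u := by
      rcases hw with hw | hw | hw
      · exact Or.inl (hmem w hw).1
      · exact Or.inr (Or.inl (hmemL w hw).1)
      · exact Or.inr (Or.inr hw)
    have := h.clean z hzX w hw'
    rw [addEdge_adj]
    grind

theorem graphOf_le_insert {C : Finset (Sym2 V)} {e : Sym2 V} : graphOf C ≤ graphOf (insert e C) :=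
  SimpleGraph.fromEdgeSet_mono (by exact_mod_cast Finset.subset_insert e C)

theorem card_erase_erase {X : Finset V} (p q : V) : X.card ≤ ((X.erase p).erase q).card + 2 := by
  have h1 := Finset.pred_card_le_card_erase (s := X) (a := p)
  have h2 := Finset.pred_card_le_card_erase (s := X.erase p) (a := q)
  omega

/-- A graph with degrees less than `D` has large independent sets. -/
theorem exists_independent {R : SimpleGraph V} {D : ℕ} (hD : 0 < D) : ∀ (M : ℕ) (A : Finset V),
    (∀ v ∈ A, (A.filter fun w => R.Adj v w).card < D) → M * D ≤ A.card →
    ∃ X ⊆ A, X.card = M ∧ ∀ x ∈ X, ∀ y ∈ X, ¬ R.Adj x y := by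
  intro M
  induction M with
  | zero => exact fun A _ _ => ⟨∅, by simp, rfl, by simp⟩
  | succ M ih =>
    intro A hA hc
    obtain ⟨v, hv⟩ : A.Nonempty := Finset.card_pos.mp
      (lt_of_lt_of_le (Nat.mul_pos (Nat.succ_pos M) hD) hc)
    have hvD := hA v hv
    set A' := (A.erase v) \ (A.filter fun w => R.Adj v w) with hA'
    have hsub : A' ⊆ A := Finset.sdiff_subset.trans (Finset.erase_subset v A)
    have hcard : M * D ≤ A'.card := by
      have h1 : (A.erase v).card - (A.filter fun w => R.Adj v w).card ≤ A'.card :=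
        Finset.le_card_sdiff _ _
      rw [Finset.card_erase_of_mem hv] at h1
      rw [Nat.succ_mul] at hc
      omega
    obtain ⟨X, hX, hXc, hXi⟩ := ih A' (fun w hw => lt_of_le_of_lt
      (Finset.card_le_card (Finset.filter_subset_filter _ hsub)) (hA w (hsub hw))) hcard
    have hvX : v ∉ X := fun h => by
      have := hX h
      simp [hA'] at this
    have hnv : ∀ x ∈ X, ¬ R.Adj v x := by
      intro x hx h
      have := hX hx
      simp [hA', h] at this
      tauto
    refine ⟨insert v X, ?_, by rw [Finset.card_insert_of_notMem hvX, hXc], ?_⟩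
    · intro x hx
      rcases Finset.mem_insert.mp hx with rfl | hx
      · exact hv
      · exact hsub (hX hx)
    · intro x hx y hy hxy
      rcases Finset.mem_insert.mp hx with rfl | hx' <;> rcases Finset.mem_insert.mp hy with rfl | hy'
      · exact hxy.ne rfl
      · exact hnv y hy' hxy
      · exact hnv x hx' hxy.symm
      · exact hXi x hx' y hy' hxy

variable [Fintype V]

/-- Playing one move of Constructor in a stage. -/
theorem le_value_of_move {k : ℕ} {C B : Finset (Sym2 V)} {x y : V}
    (hxy : FreePair (graphOf C) (graphOf B) x y) (hP : PathSixFree (addEdge (graphOf C) x y))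
    (hne : ∃ p q, FreePair (addEdge (graphOf C) x y) (graphOf B) p q)
    (h : ∀ p q, k ≤ constructorValue (⊤ : SimpleGraph (Fin 3)) (SimpleGraph.pathGraph 6)
      (insert s(x, y) C) (insert s(p, q) B)) :
    k ≤ constructorValue (⊤ : SimpleGraph (Fin 3)) (SimpleGraph.pathGraph 6) C B := by
  refine le_constructorValue_of_move (mem_legalEdges_iff.mpr ⟨hxy, hP⟩) ?_ ?_
  · obtain ⟨p, q, hpq⟩ := hne
    exact ⟨s(p, q), by rw [mem_freeEdges_iff, graphOf_insert]; exact hpq⟩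
  · intro f _
    induction f with
    | h p q => exact h p q

/-- Building `t` more triangles with the same centre. -/
theorem Stage.le_value {k τ β ω : ℕ} {u : V}
    (hk : ∀ (C B : Finset (Sym2 V)) (φ : V → V), Friendship (graphOf C) φ →
      τ ≤ (triangles (graphOf C)).card → B.card ≤ β → ω ≤ (isolated (graphOf C)).card →
      k ≤ constructorValue (⊤ : SimpleGraph (Fin 3)) (SimpleGraph.pathGraph 6) C B) :
    ∀ (N t : ℕ) (C B : Finset (Sym2 V)) (φ : V → V) (L X : Finset V),
      4 * t + 3 ≤ N + L.card → Stage (graphOf C) (graphOf B) φ u L X → L.card ≤ 3 →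
      (t = 0 → L.card = 1) →
      (L.card = 3 → ∃ l ∈ L, ∃ l' ∈ L, l ≠ l' ∧ ¬ (graphOf B).Adj l l') →
      9 * t + 6 ≤ X.card + 3 * L.card → τ ≤ (triangles (graphOf C)).card + t →
      B.card + 3 * t + 1 ≤ β + L.card →
      ω + 2 * t + 1 ≤ ((isolated (graphOf C)).erase u).card + L.card →
      k ≤ constructorValue (⊤ : SimpleGraph (Fin 3)) (SimpleGraph.pathGraph 6) C B := by
  -- Budgets: a leaf move trades one unit of `N` for one leaf, and a matching move lowers `t` by 1
  -- and `L.card` by 2. A leaf move removes at most three reservoir vertices, a matching move at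
  -- most two, whence the coefficients 9 and 3. Per triangle there are three Blocker replies and two
  -- newly used vertices. The block ends with one spare leaf, so `t = 0` must come with `L.card =
  -- 1`, which also rules out `N = 0`.
  intro N
  induction N with
  | zero =>
    intro t C B φ L X h1 hS h2 h3 hL3 hX hτ hβ hω
    have ht : t = 0 := by omega
    have := h3 ht
    omega
  | succ N ih =>
    intro t C B φ L X h1 hS h2 h3 hL3 hX hτ hβ hω
    by_cases ht : t = 0
    · have hL := h3 ht
      have := Finset.card_erase_le (s := isolated (graphOf C)) (a := u)
      exact hk C B φ hS.friend (by omega) (by omega) (by omega)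
    have hX6 : 6 ≤ X.card := by omega
    by_cases hL : L.card = 3
    · obtain ⟨l, hl, l', hl', hne, hR⟩ := hL3 hL
      have hlu := hS.leaf_ne hl
      have hlu' := hS.leaf_ne hl'
      have hG : ¬ (graphOf C).Adj l l' := fun h => hlu' ((hS.leaf l hl l').mp h)
      refine le_value_of_move ⟨hne, hG, hR⟩
        (hS.matchLeaves hl hl' hne l l').friend.pathSixFree ?_ fun p q => ?_
      · obtain ⟨p, hp, q, hq, hpq⟩ := Finset.one_lt_card.mp (show 1 < X.card by omega)
        refine ⟨p, q, hpq, ?_, hS.clean p hp q (Or.inl hq)⟩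
        rw [addEdge_adj]
        have := hS.fresh p hp q
        have : p ≠ l := fun h => hS.leaf_notMem l hl (h ▸ hp)
        have : p ≠ l' := fun h => hS.leaf_notMem l' hl' (h ▸ hp)
        grind
      · have hS' := hS.matchLeaves hl hl' hne p q
        rw [← graphOf_insert, ← graphOf_insert] at hS'
        have hLc : ((L.erase l).erase l').card = 1 := by
          rw [Finset.card_erase_of_mem (by simp [hl', hne.symm]), Finset.card_erase_of_mem hl, hL]
        have hXc := card_erase_erase (X := X) p q
        have hBc := Finset.card_insert_le s(p, q) B
        have hiso : (isolated (graphOf C)).erase u ⊆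
            (isolated (graphOf (insert s(l, l') C))).erase u := by
          intro z hz
          rw [Finset.mem_erase, mem_isolated] at hz ⊢
          refine ⟨hz.1, fun w hw => ?_⟩
          rw [graphOf_insert, addEdge_adj] at hw
          rcases hw with hw | ⟨⟨rfl, -⟩ | ⟨rfl, -⟩, -⟩
          · exact hz.2 w hw
          · exact hz.2 u ((hS.leaf z hl u).mpr rfl)
          · exact hz.2 u ((hS.leaf z hl' u).mpr rfl)
        have hisoc := Finset.card_le_card hiso
        have htri : (triangles (graphOf C)).card + 1 ≤
            (triangles (graphOf (insert s(l, l') C))).card := by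
          have hnot : ({u, l, l'} : Finset V) ∉ triangles (graphOf C) := by
            rw [mem_triangles]
            exact fun h => hG (h.isClique (by simp) (by simp) hne)
          rw [← Finset.card_insert_of_notMem hnot]
          apply Finset.card_le_card
          intro σ hσ
          rcases Finset.mem_insert.mp hσ with rfl | hσ
          · rw [mem_triangles, SimpleGraph.is3Clique_triple_iff, graphOf_insert, addEdge_adj,
              addEdge_adj, addEdge_adj]
            exact ⟨Or.inl ((hS.leaf l hl u).mpr rfl).symm,
              Or.inl ((hS.leaf l' hl' u).mpr rfl).symm, Or.inr ⟨Or.inl ⟨rfl, rfl⟩, hne⟩⟩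
          · exact triangles_mono graphOf_le_insert hσ
        refine ih (t - 1) _ _ φ _ _ ?_ hS' ?_ ?_ ?_ ?_ ?_ ?_ ?_
        all_goals omega
    · obtain ⟨x, hx⟩ : X.Nonempty := Finset.card_pos.mp (by omega)
      have hxu : u ≠ x := fun h => hS.center_notMem (h ▸ hx)
      have hG : ¬ (graphOf C).Adj u x := fun h => hS.fresh x hx u h.symm
      have hR : ¬ (graphOf B).Adj u x := fun h =>
        hS.clean x hx u (Or.inr (Or.inr rfl)) h.symm
      have hxL : x ∉ L := fun h => hS.leaf_notMem x h hx
      refine le_value_of_move ⟨hxu, hG, hR⟩ (hS.addLeaf hx u x).friend.pathSixFree ?_ fun p q => ?_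
      · obtain ⟨p, hp, q, hq, hpq⟩ := Finset.one_lt_card.mp (show 1 < (X.erase x).card by
          rw [Finset.card_erase_of_mem hx]; omega)
        rw [Finset.mem_erase] at hp hq
        refine ⟨p, q, hpq, ?_, hS.clean p hp.2 q (Or.inl hq.2)⟩
        rw [addEdge_adj]
        have := hS.fresh p hp.2 q
        have : p ≠ u := fun h => hS.center_notMem (h ▸ hp.2)
        grind
      · have hS' := hS.addLeaf hx p q
        rw [← graphOf_insert, ← graphOf_insert] at hS'
        have hLc : (insert x L).card = L.card + 1 := Finset.card_insert_of_notMem hxL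
        have hXc := card_erase_erase (X := X.erase x) p q
        rw [Finset.card_erase_of_mem hx] at hXc
        have hBc := Finset.card_insert_le s(p, q) B
        have hiso : ((isolated (graphOf C)).erase u).erase x ⊆
            (isolated (graphOf (insert s(u, x) C))).erase u := by
          intro z hz
          rw [Finset.mem_erase, Finset.mem_erase, mem_isolated] at hz
          rw [Finset.mem_erase, mem_isolated]
          refine ⟨hz.2.1, fun w hw => ?_⟩
          rw [graphOf_insert, addEdge_adj] at hw
          rcases hw with hw | ⟨⟨rfl, -⟩ | ⟨rfl, -⟩, -⟩
          · exact hz.2.2 w hw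
          · exact hz.2.1 rfl
          · exact hz.1 rfl
        have hisoc := Finset.card_le_card hiso
        have hisoc' := Finset.pred_card_le_card_erase (s := (isolated (graphOf C)).erase u)
          (a := x)
        have htri := Finset.card_le_card
          (triangles_mono (graphOf_le_insert (C := C) (e := s(u, x))))
        refine ih t _ _ _ _ _ ?_ hS' ?_ ?_ ?_ ?_ ?_ ?_ ?_
        · omega
        · omega
        · intro h; omega
        -- The new leaf `x` was clean before Blocker's reply, which can occupy only one of the two
        -- pairs joining it to the older leaves.
        · intro h3
          obtain ⟨l₁, l₂, hl, rfl⟩ := Finset.card_eq_two.mp (show L.card = 2 by omega)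
          have n1 := hS.clean x hx l₁ (by simp)
          have n2 := hS.clean x hx l₂ (by simp)
          have x1 : x ≠ l₁ := fun h => hxL (by simp [h])
          have x2 : x ≠ l₂ := fun h => hxL (by simp [h])
          by_cases hadj : (graphOf (insert s(p, q) B)).Adj x l₁
          · refine ⟨x, by simp, l₂, by simp, x2, fun hadj' => ?_⟩
            rw [graphOf_insert, addEdge_adj] at hadj hadj'
            grind
          · exact ⟨x, by simp, l₁, by simp, x1, hadj⟩
        all_goals omega

/-- Building `t` triangles with a new centre inside a reservoir `X`. -/
theorem le_value_of_block {k t : ℕ} {C B : Finset (Sym2 V)} {φ : V → V} {X : Finset V}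
    (hφ : Friendship (graphOf C) φ) (ht : t ≠ 0) (hX : X ⊆ isolated (graphOf C))
    (hind : ∀ x ∈ X, ∀ y ∈ X, ¬ (graphOf B).Adj x y) (hcard : 9 * t + 7 ≤ X.card)
    (hk : ∀ (C' B' : Finset (Sym2 V)) (φ : V → V), Friendship (graphOf C') φ →
      (triangles (graphOf C)).card + t ≤ (triangles (graphOf C')).card →
      B'.card ≤ B.card + (3 * t + 1) →
      (isolated (graphOf C)).card - (2 * t + 2) ≤ (isolated (graphOf C')).card →
      k ≤ constructorValue (⊤ : SimpleGraph (Fin 3)) (SimpleGraph.pathGraph 6) C' B')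
    (hiso : 2 * t + 2 ≤ (isolated (graphOf C)).card) :
    k ≤ constructorValue (⊤ : SimpleGraph (Fin 3)) (SimpleGraph.pathGraph 6) C B := by
  obtain ⟨u, hu⟩ : X.Nonempty := Finset.card_pos.mp (by omega)
  have hiu := mem_isolated.mp (hX hu)
  have hiu' : ∀ v, ¬ (graphOf C).Adj v u := fun v hv => hiu v hv.symm
  have hS : Stage (graphOf C) (graphOf B) (Function.update φ u u) u ∅ (X.erase u) := by
    refine ⟨⟨fun v w hvw => ?_, fun v w w' hv hw hw' hne hne' => ?_⟩, Function.update_self _ _ _,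
      by simp, fun x hx w => ?_, by simp, by simp, fun x hx w hw => ?_⟩
    · have h1 : v ≠ u := fun h' => hiu w (h' ▸ hvw)
      have h2 : w ≠ u := fun h' => hiu' v (h' ▸ hvw)
      rw [Function.update_of_ne h1, Function.update_of_ne h2, hφ.map_eq v w hvw]
    · have h1 : v ≠ u := fun h' => hiu w (h' ▸ hw)
      rw [Function.update_of_ne h1] at hv hne hne'
      exact hφ.uniq v w w' hv hw hw' hne hne'
    · exact mem_isolated.mp (hX (Finset.mem_of_mem_erase hx)) w
    · refine hind x (Finset.mem_of_mem_erase hx) w ?_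
      rcases hw with hw | hw | rfl
      · exact Finset.mem_of_mem_erase hw
      · simp at hw
      · exact hu
  refine hS.le_value hk (4 * t + 3) t C B _ ∅ _ (by simp) ?_ ?_ ?_ ?_ le_rfl ?_ ?_
  · simp
  · intro h; exact absurd h ht
  · simp
  · rw [Finset.card_erase_of_mem hu]; simp; omega
  · simp
  · rw [Finset.card_erase_of_mem (hX hu)]; simp; omega

theorem sum_degree_le (B : Finset (Sym2 V)) :
    ∑ v, (Finset.univ.filter fun w => (graphOf B).Adj v w).card ≤ 2 * B.card := by
  have h := (graphOf B).sum_degrees_eq_twice_card_edges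
  have h1 : (graphOf B).edgeFinset.card ≤ B.card := by
    apply Finset.card_le_card
    intro e he
    rw [SimpleGraph.mem_edgeFinset, graphOf, SimpleGraph.edgeSet_fromEdgeSet] at he
    exact_mod_cast he.1
  calc _ = ∑ v, (graphOf B).degree v := by
        refine Finset.sum_congr rfl fun v _ => ?_
        rw [← SimpleGraph.card_neighborFinset_eq_degree, SimpleGraph.neighborFinset_eq_filter]
    _ ≤ 2 * B.card := by rw [h]; omega

/-- A large set contains a large independent set of a graph with few edges. -/
theorem exists_independent_of_card {B : Finset (Sym2 V)} {A : Finset V} {M D : ℕ} (hD : 0 < D)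
    (h : 2 * B.card + M * D * D ≤ A.card * D) :
    ∃ X ⊆ A, X.card = M ∧ ∀ x ∈ X, ∀ y ∈ X, ¬ (graphOf B).Adj x y := by
  set deg : V → ℕ := fun v => (Finset.univ.filter fun w => (graphOf B).Adj v w).card with hdeg
  -- Few vertices have degree at least `D`, by summing degrees; the greedy choice is then made among
  -- the others.
  have hbad : (A.filter fun v => ¬ deg v < D).card * D ≤ 2 * B.card := by
    calc (A.filter fun v => ¬ deg v < D).card * D
        = ∑ _v ∈ A.filter fun v => ¬ deg v < D, D := by rw [Finset.sum_const, smul_eq_mul]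
      _ ≤ ∑ v ∈ A.filter fun v => ¬ deg v < D, deg v := by
          refine Finset.sum_le_sum fun v hv => ?_
          exact Nat.le_of_not_lt (Finset.mem_filter.mp hv).2
      _ ≤ ∑ v, deg v := Finset.sum_le_sum_of_subset (Finset.subset_univ _)
      _ ≤ 2 * B.card := sum_degree_le B
  have hsplit := Finset.card_filter_add_card_filter_not (s := A) (fun v => deg v < D)
  have hgood : M * D ≤ (A.filter fun v => deg v < D).card := by
    refine Nat.le_of_mul_le_mul_right ?_ hD
    have : A.card * D = (A.filter fun v => deg v < D).card * D +
        (A.filter fun v => ¬ deg v < D).card * D := by rw [← add_mul, hsplit]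
    omega
  have hlow : ∀ v ∈ A.filter fun v => deg v < D,
      ((A.filter fun v => deg v < D).filter fun w => (graphOf B).Adj v w).card < D := by
    intro v hv
    refine lt_of_le_of_lt (Finset.card_le_card ?_) (Finset.mem_filter.mp hv).2
    intro w hw
    rw [Finset.mem_filter] at hw ⊢
    exact ⟨Finset.mem_univ _, hw.2⟩
  obtain ⟨X, hX, hXc, hXi⟩ := exists_independent hD M _ hlow hgood
  exact ⟨X, hX.trans (Finset.filter_subset _ _), hXc, hXi⟩

end

end ConstructorBlocker

-- Assembling the blocks and the asymptotics

namespace ConstructorBlocker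

open Classical in
/-- Constructor can play `J` blocks of `q` triangles each, as long as this leaves a proportion of
`1 / q` of the vertices unused. -/
theorem le_constructorValue_blocks {n q J : ℕ} (hq : 0 < q)
    (hJ : n + q * (J * (2 * q + 2)) ≤ q * n) (hn : 16 * q * q * (9 * q + 7) ≤ n) :
    q * J ≤ constructorValue (⊤ : SimpleGraph (Fin 3)) (SimpleGraph.pathGraph 6)
      (∅ : Finset (Sym2 (Fin n))) ∅ := by
  have hJn : J * (2 * q + 2) ≤ n := Nat.le_of_mul_le_mul_left (by omega) hq
  have key : ∀ (i d : ℕ) (C B : Finset (Sym2 (Fin n))) (φ : Fin n → Fin n), i + d = J →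
      Friendship (graphOf C) φ → q * d ≤ (triangles (graphOf C)).card → B.card ≤ (3 * q + 1) * d →
      n ≤ (isolated (graphOf C)).card + (2 * q + 2) * d →
      q * J ≤ constructorValue (⊤ : SimpleGraph (Fin 3)) (SimpleGraph.pathGraph 6) C B := by
    intro i
    induction i with
    | zero =>
      intro d C B φ hd _ hT _ _
      have h := copies_le_constructorValue (F := SimpleGraph.pathGraph 6) C B
      rw [copies_triangle] at h
      rw [← hd, zero_add]
      exact hT.trans h
    | succ i ih =>
      intro d C B φ hd hφ hT hB hI
      have hdJ : d ≤ J := by omega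
      have hqI : n ≤ q * (isolated (graphOf C)).card := by
        have h1 : q * n ≤ q * ((isolated (graphOf C)).card + (2 * q + 2) * d) :=
          Nat.mul_le_mul_left q hI
        have h2 : q * ((2 * q + 2) * d) ≤ q * (J * (2 * q + 2)) := by
          rw [mul_comm J]
          exact Nat.mul_le_mul_left q (Nat.mul_le_mul_left _ hdJ)
        rw [mul_add] at h1
        omega
      have hB2 : B.card ≤ 2 * n := by nlinarith
      -- With `D = 8q`, the n/q isolated vertices give `A.card * D` at least 8n. Blocker's at most
      -- 2n edges use 4n of this, and the assumed lower bound on n makes `M * D * D` at most 4n.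
      obtain ⟨X, hX, hXc, hXi⟩ := exists_independent_of_card (B := B)
        (A := isolated (graphOf C)) (M := 9 * q + 7) (D := 8 * q) (by omega) (by nlinarith)
      have hI2 : 2 * q + 2 ≤ (isolated (graphOf C)).card := by
        refine Nat.le_of_mul_le_mul_left (le_trans ?_ hqI) hq
        nlinarith
      refine le_value_of_block hφ hq.ne' hX hXi hXc.ge ?_ hI2
      intro C' B' φ' hφ' hT' hB' hI'
      refine ih (d + 1) C' B' φ' (by omega) hφ' ?_ ?_ ?_
      · rw [mul_add, mul_one]; omega
      · rw [mul_add, mul_one]; omega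
      · rw [mul_add, mul_one]; omega
  refine key J 0 ∅ ∅ id (by omega) ⟨fun v w h => ?_, fun v w w' h => absurd rfl h⟩ (by simp)
    (by simp) ?_
  · simp [graphOf] at h
  · have : isolated (graphOf (∅ : Finset (Sym2 (Fin n)))) = Finset.univ := by
      ext v
      simp [mem_isolated, graphOf]
    rw [this]
    simp

theorem g_le (n : ℕ) :
    g n (⊤ : SimpleGraph (Fin 3)) (SimpleGraph.pathGraph 6) ≤ n / 2 := by
  have h := constructorValue_upper (V := Fin n)
  rwa [Fintype.card_fin] at h

/-- The largest admissible number `J` of blocks is a floor, and rounding loses less than one block,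
that is `q` triangles. -/
theorem le_g {n q : ℕ} (hq : 0 < q) (hn : 16 * q * q * (9 * q + 7) ≤ n) :
    ((q : ℝ) - 1) * n / (2 * (q + 1)) - q ≤
      g n (⊤ : SimpleGraph (Fin 3)) (SimpleGraph.pathGraph 6) := by
  set J := (q - 1) * n / (q * (2 * q + 2)) with hJdef
  have hpos : 0 < q * (2 * q + 2) := by positivity
  have h1 : J * (q * (2 * q + 2)) ≤ (q - 1) * n := Nat.div_mul_le_self _ _
  have h2 : (q - 1) * n < (J + 1) * (q * (2 * q + 2)) := by
    rw [mul_comm (J + 1)]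
    exact Nat.lt_mul_div_succ _ hpos
  obtain ⟨r, rfl⟩ : ∃ r, q = r + 1 := ⟨q - 1, by omega⟩
  rw [Nat.add_sub_cancel] at h1 h2
  have hJ : n + (r + 1) * (J * (2 * (r + 1) + 2)) ≤ (r + 1) * n := by nlinarith
  have h3 := le_constructorValue_blocks hq hJ hn
  have h4 : ((r + 1 : ℕ) : ℝ) * J ≤ g n (⊤ : SimpleGraph (Fin 3)) (SimpleGraph.pathGraph 6) := by
    exact_mod_cast h3
  refine le_trans ?_ h4
  have h5 : (r : ℝ) * n ≤ (J + 1) * ((r + 1) * (2 * (r + 1) + 2)) := by exact_mod_cast h2.le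
  rw [sub_le_iff_le_add, div_le_iff₀ (by positivity)]
  push_cast
  linarith

end ConstructorBlocker

theorem theorem2 :
    ∃ ε : ℕ → ℝ, Tendsto ε atTop (𝓝 0) ∧
      ∀ n : ℕ, (ConstructorBlocker.g n (⊤ : SimpleGraph (Fin 3)) (SimpleGraph.pathGraph 6) : ℝ) =
        (1 + ε n) * ((n : ℝ) / 2) := by
  have hup : ∀ n : ℕ, (ConstructorBlocker.g n (⊤ : SimpleGraph (Fin 3))
      (SimpleGraph.pathGraph 6) : ℝ) ≤ n / 2 := fun n => by
    have h := ConstructorBlocker.g_le n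
    have h' : 2 * ConstructorBlocker.g n (⊤ : SimpleGraph (Fin 3)) (SimpleGraph.pathGraph 6) ≤ n := by
      omega
    have : (2 : ℝ) * ConstructorBlocker.g n (⊤ : SimpleGraph (Fin 3)) (SimpleGraph.pathGraph 6) ≤
        n := by exact_mod_cast h'
    linarith
  refine ⟨fun n => (ConstructorBlocker.g n (⊤ : SimpleGraph (Fin 3))
    (SimpleGraph.pathGraph 6) : ℝ) / ((n : ℝ) / 2) - 1, ?_, fun n => ?_⟩
  · rw [Metric.tendsto_atTop]
    intro δ hδ
    -- Relative to n/2 the lower bound loses 2/(q + 1) + 2q/n; the choices of `q` and `m` make each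
    -- term less than δ/2.
    obtain ⟨q, hq⟩ := exists_nat_gt (4 / δ)
    have hq0 : (0 : ℝ) < q := lt_trans (by positivity) hq
    have hq' : 0 < q := by exact_mod_cast hq0
    obtain ⟨m, hm⟩ := exists_nat_gt (4 * q / δ)
    refine ⟨max m (16 * q * q * (9 * q + 7)), fun n hn => ?_⟩
    have hn1 : m ≤ n := (le_max_left _ _).trans hn
    have hlow := ConstructorBlocker.le_g hq' ((le_max_right _ _).trans hn)
    have hmn : (m : ℝ) ≤ n := by exact_mod_cast hn1
    have hn0 : (0 : ℝ) < n := lt_of_lt_of_le (lt_trans (by positivity) hm) hmn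
    rw [div_lt_iff₀ hδ] at hq hm
    have hu := hup n
    set v : ℝ := (ConstructorBlocker.g n (⊤ : SimpleGraph (Fin 3)) (SimpleGraph.pathGraph 6) : ℝ)
    rw [Real.dist_eq, sub_zero, abs_lt]
    constructor
    · rw [lt_sub_iff_add_lt, lt_div_iff₀ (by positivity)]
      refine lt_of_lt_of_le ?_ hlow
      rw [lt_sub_iff_add_lt, lt_div_iff₀ (by positivity)]
      have h1 : 4 * (q : ℝ) < n * δ := hm.trans_le (mul_le_mul_of_nonneg_right hmn hδ.le)
      have h2 : 4 * (n : ℝ) < q * δ * n := mul_lt_mul_of_pos_right hq hn0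
      nlinarith [mul_lt_mul_of_pos_right h1 (by positivity : (0 : ℝ) < (q : ℝ) + 1)]
    · rw [sub_lt_iff_lt_add]
      refine lt_of_le_of_lt ((div_le_one (by positivity)).mpr hu) (by linarith)
  -- For n = 0 the quotient defining ε is a division by zero, but both sides of the identity vanish.
  · rcases Nat.eq_zero_or_pos n with rfl | hn
    · have := hup 0
      have h0 : (0 : ℝ) ≤ ConstructorBlocker.g 0 (⊤ : SimpleGraph (Fin 3))
        (SimpleGraph.pathGraph 6) := Nat.cast_nonneg _
      simp only [Nat.cast_zero, zero_div, mul_zero] at this ⊢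
      linarith
    · have : (0 : ℝ) < n := by exact_mod_cast hn
      rw [add_sub_cancel, div_mul_cancel₀ _ (by positivity)]
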